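/- Let $\mathbb F_q$ be a finite field, let $\sigma$ be an automorphism of the field $\mathbb F_q(t)$ of finite order $n\ge 1$, and let $\lambda\in\mathbb F_q(t)$ be nonzero with $\sigma(\lambda)=\lambda$. Let $\mathbb F_q(t)[x;\sigma]$ be the skew polynomial ring with $xa=\sigma(a)x$, and let $\mathcal A=\mathbb F_q(t)[x;\sigma]/(x^n-\lambda)$, a central simple algebra over $\mathbb F_q(t)^\sigma$. Every element of $\mathcal A$ is uniquely $\sum_{i<n}a_ix^i$ with $a_i\in\mathbb F_q(t)$; the Hamming distance of two elements is the number of coefficients in which they differ, and $\sigma$ also acts on $\mathcal A$ coefficientwise. Let $m$ be the index of $\mathcal A$, that is, $\mathcal A\cong M_{n/m}(D)$ for a division algebra $D$ of dimension $m^2$ over its centre. Let $e_0\in\mathcal A$ be a primitive idempotent such that $e_0,\sigma^m(e_0),\sigma^{2m}(e_0),\dots,\sigma^{n-m}(e_0)$ are pairwise orthogonal, put $e=1-e_0$, and let $1\le k\le n/m$. Then the elements $e,\sigma^m(e),\dots,\sigma^{m(k-2)}(e)$ of $\mathcal A$ have a least common left multiple $[e,\sigma^m(e),\dots,\sigma^{m(k-2)}(e)]_\ell$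 in $\mathcal A$ (for $k=1$ the family is empty and this is $1$). Let $C$ be the left ideal of $\mathcal A$ generated by it. Then: 1. any two distinct elements of $C$ have Hamming distance at least $k$; 2. $C$ admits a polynomial-time decoding algorithm: there is one deterministic algorithm, independent of $q$ and of all the other data, which on input $\sigma,\lambda,m,k,e_0$ and a received word $r\in\mathcal A$ halts after a number of steps (operations in $\mathbb F_q$ and elementary operations on data structures) that is polynomial in the size of the input, produces an output of polynomial size, and outputs $c$ whenever $c\in C$ has Hamming distance less than $k/2$ from $r$. Here rational functions are given as fractions of coefficient lists; elements of $\mathcal A$ by their $n$ coefficients; $m,k$ in unary; and $\sigma$ by elements $a,b,c,d\in\mathbb F_q$ with $\sigma(t)=(at+b)/(ct+d)$ together with the binary expansion of an integer $Q$ such that $\sigma(u)=u^Q$ for $u\in\mathbb F_q$. The size is the number of nodes of the input tree, field elements counting one each. -/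

import Mathlib

universe u

namespace SkewConstacyclic

noncomputable section

/-! ### Skew polynomials and the algebra `K[x; σ] / (x ^ n - lam)` -/

/-- A copy of `K`, on which the generator of `Multiplicative ℕ` acts through `σ`. -/
def Twist {K : Type u} [Field K] (_σ : RingAut K) : Type u := K

instance {K : Type u} [Field K] (σ : RingAut K) : Field (Twist σ) :=
  inferInstanceAs (Field K)

instance {K : Type u} [Field K] (σ : RingAut K) :
    MulSemiringAction (Multiplicative ℕ) (Twist σ) :=
  MulSemiringAction.compHom K (powersHom (RingAut K) σ)

/-- The skew polynomial ring `K[x; σ]`, with `x * a = σ a * x`. -/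
abbrev SkewPoly {K : Type u} [Field K] (σ : RingAut K) : Type u := SkewPolynomial (Twist σ)

/-- The skew polynomial `a x ^ i`. -/
def mono {K : Type u} [Field K] (σ : RingAut K) (i : ℕ) (a : K) : SkewPoly σ :=
  SkewPolynomial.monomial (R := Twist σ) i a

/-- The algebra `K[x; σ] / (x ^ n - lam)`. -/
abbrev Alg {K : Type u} [Field K] (σ : RingAut K) (n : ℕ) (lam : K) : Type u :=
  (TwoSidedIdeal.span {mono σ n 1 - mono σ 0 lam}).ringCon.Quotient

section Alg

variable {K : Type u} [Field K] {σ : RingAut K} {n : ℕ} {lam : K}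

/-- The class of `∑ i < n, a i x ^ i`. -/
def ofCoeffs (σ : RingAut K) (lam : K) (a : Fin n → K) : Alg σ n lam :=
  (TwoSidedIdeal.span {mono σ n 1 - mono σ 0 lam}).ringCon.mk' (∑ i : Fin n, mono σ i (a i))

/-- Auxiliary module on which the algebra acts: two-sided sequences `w` with
`w r = lam * w (r + n)`. -/
def seqGroup (n : ℕ) (lam : K) : AddSubgroup (ℤ → K) where
  carrier := {w | ∀ r, w r = lam * w (r + n)}
  zero_mem' := by intro r; simp
  add_mem' := by
    intro a b ha hb r
    simp only [Set.mem_ofPred_eq, Pi.add_apply] at *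
    rw [ha r, hb r, mul_add]
  neg_mem' := by
    intro a ha r
    simp only [Set.mem_ofPred_eq, Pi.neg_apply] at *
    rw [ha r, mul_neg]

/-- Multiplication by constants on `seqGroup`. -/
def seqMul (n : ℕ) (lam : K) : K →+* AddMonoid.End (seqGroup n lam) where
  toFun a :=
    { toFun := fun w => ⟨fun r => a * w.1 r, fun r => by
        change a * w.1 r = lam * (a * w.1 (r + n))
        rw [w.2 r, mul_left_comm]⟩
      map_zero' := by ext r; simp
      map_add' := by intro v w; ext r; simp [mul_add] }
  map_one' := by ext w r; exact one_mul _
  map_mul' := by intro a b; ext w r; exact mul_assoc _ _ _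
  map_zero' := by ext w r; exact zero_mul _
  map_add' := by intro a b; ext w r; exact add_mul _ _ _

/-- The twisted shift on `seqGroup`. -/
def seqShift (σ : RingAut K) (n : ℕ) (lam : K) (h : σ lam = lam) :
    AddMonoid.End (seqGroup n lam) where
  toFun w := ⟨fun r => σ (w.1 (r - 1)), fun r => by
    change σ (w.1 (r - 1)) = lam * σ (w.1 (r + n - 1))
    rw [w.2 (r - 1), map_mul, h, sub_add_eq_add_sub]⟩
  map_zero' := by ext r; simp
  map_add' := by intro v w; ext r; simp

lemma seqShift_pow (h : σ lam = lam) (j : ℕ) (w : seqGroup n lam) (r : ℤ) :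
    ((seqShift σ n lam h ^ j) w).1 r = (σ ^ j) (w.1 (r - j)) := by
  induction j generalizing r with
  | zero => simp
  | succ j ih =>
    rw [pow_succ']
    change σ (((seqShift σ n lam h ^ j) w).1 (r - 1)) = _
    rw [ih, pow_succ', RingAut.mul_apply]
    rw [Nat.cast_succ, sub_sub, add_comm (1 : ℤ)]

lemma smul_twist (y : Multiplicative ℕ) (a : Twist σ) :
    (y • a : Twist σ) = (σ ^ (Multiplicative.toAdd y)) (show K from a) := rfl

/-- The action of skew polynomials on `seqGroup`. -/
def seqAct (σ : RingAut K) (n : ℕ) (lam : K) (h : σ lam = lam) :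
    SkewPoly σ →+* AddMonoid.End (seqGroup n lam) :=
  SkewMonoidAlgebra.liftNCRingHom (k := Twist σ) (G := Multiplicative ℕ)
    (seqMul n lam : K →+* _) (powersHom _ (seqShift σ n lam h)) (by
      intro x y
      ext w r
      change ((σ ^ (Multiplicative.toAdd y)) (show K from x) : K) *
        ((seqShift σ n lam h ^ (Multiplicative.toAdd y)) w).1 r =
        ((seqShift σ n lam h ^ (Multiplicative.toAdd y)) (seqMul n lam (show K from x) w)).1 r
      rw [seqShift_pow, seqShift_pow]
      change _ = (σ ^ (Multiplicative.toAdd y)) ((show K from x) * _)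
      rw [map_mul])

lemma seqAct_mono (h : σ lam = lam) (i : ℕ) (a : K) (w : seqGroup n lam) (r : ℤ) :
    (seqAct σ n lam h (mono σ i a) w).1 r = a * (σ ^ i) (w.1 (r - i)) := by
  have : seqAct σ n lam h (mono σ i a) = seqMul n lam a * seqShift σ n lam h ^ i := by
    exact SkewMonoidAlgebra.liftNC_single _ _ _ _
  rw [this, ← seqShift_pow h]
  rfl

/-- The sequence corresponding to the unit element. -/
def seqOne (n : ℕ) (hn : 0 < n) (lam : K) (h0 : lam ≠ 0) : seqGroup n lam :=
  ⟨fun r => if (n : ℤ) ∣ r then lam ^ (-(r / n)) else 0, fun r => by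
    beta_reduce
    have hn' : (n : ℤ) ≠ 0 := by exact_mod_cast hn.ne'
    by_cases hr : (n : ℤ) ∣ r
    · rw [if_pos hr, if_pos (by simpa using hr), Int.add_ediv_of_dvd_left hr,
        Int.ediv_self hn', neg_add, zpow_add₀ h0, zpow_neg_one]
      field_simp
    · rw [if_neg hr, if_neg (by simpa using hr), mul_zero]⟩

lemma mono_add (i : ℕ) (a b : K) : mono σ i (a + b) = mono σ i a + mono σ i b :=
  SkewPolynomial.monomial_add (R := Twist σ) i a b

lemma mono_mul_mono (i j : ℕ) (a b : K) :
    mono σ i a * mono σ j b = mono σ (i + j) (a * (σ ^ i) b) :=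
  SkewMonoidAlgebra.single_mul_single

/-- Every element of the algebra has a unique expression `∑ i < n, a i x ^ i`. -/
theorem ofCoeffs_bijective (hn : 0 < n) (hσ : σ ^ n = 1) (h : σ lam = lam) (h0 : lam ≠ 0) :
    Function.Bijective (ofCoeffs (n := n) σ lam) := by
  classical
  set I : TwoSidedIdeal (SkewPoly σ) := TwoSidedIdeal.span {mono σ n 1 - mono σ 0 lam} with hI
  have hmk : ∀ f g : SkewPoly σ, I.ringCon.mk' f = I.ringCon.mk' g ↔ f - g ∈ I := fun f g => by
    rw [← I.rel_iff]; exact Quotient.eq''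
  constructor
  · intro a b hab
    have hle : I ≤ TwoSidedIdeal.ker (seqAct σ n lam h) := by
      rw [hI, TwoSidedIdeal.span_le]
      rintro f rfl
      rw [SetLike.mem_coe, TwoSidedIdeal.mem_ker, map_sub, sub_eq_zero]
      ext w r
      rw [seqAct_mono, seqAct_mono, hσ]
      simp only [one_mul, pow_zero, RingAut.one_apply, Nat.cast_zero, sub_zero]
      rw [w.2 (r - n), sub_add_cancel]
    have h1 := hle ((hmk _ _).1 hab)
    rw [TwoSidedIdeal.mem_ker, map_sub, sub_eq_zero] at h1
    have key : ∀ (c : Fin n → K) (r : Fin n),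
        (seqAct σ n lam h (∑ i : Fin n, mono σ i (c i)) (seqOne n hn lam h0)).1 (r : ℤ) = c r := by
      intro c r
      let ev : AddMonoid.End (seqGroup n lam) →+ K :=
        { toFun := fun f => (f (seqOne n hn lam h0)).1 (r : ℤ)
          map_zero' := rfl
          map_add' := fun _ _ => rfl }
      change ev _ = _
      rw [map_sum, map_sum]
      change ∑ i : Fin n, (seqAct σ n lam h (mono σ i (c i)) (seqOne n hn lam h0)).1 (r : ℤ) = c r
      rw [Finset.sum_eq_single r]
      · rw [seqAct_mono]
        simp [seqOne]
      · intro i _ hi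
        rw [seqAct_mono]
        have : ¬ ((n : ℤ) ∣ (r : ℤ) - (i : ℤ)) := by
          intro hd
          apply hi
          have h2 := Int.eq_zero_of_abs_lt_dvd hd (by rw [abs_lt]; omega)
          ext; omega
        simp [seqOne, this]
      · simp
    funext r
    rw [← key a r, ← key b r, h1]
  · have hadd : ∀ a b : Fin n → K,
        ofCoeffs (n := n) σ lam (a + b) = ofCoeffs σ lam a + ofCoeffs σ lam b := by
      intro a b
      simp only [ofCoeffs, Pi.add_apply, mono_add, Finset.sum_add_distrib, map_add]
    have hzero : ofCoeffs (n := n) σ lam 0 = 0 := by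
      have := hadd 0 0
      rwa [add_zero, left_eq_add] at this
    have hmono : ∀ (i : ℕ) (a : K), ∃ c, ofCoeffs (n := n) σ lam c = I.ringCon.mk' (mono σ i a) := by
      intro i
      induction i using Nat.strong_induction_on with
      | _ i ih =>
        intro a
        by_cases hi : i < n
        · refine ⟨Pi.single ⟨i, hi⟩ a, ?_⟩
          unfold ofCoeffs
          congr 1
          rw [Finset.sum_eq_single ⟨i, hi⟩]
          · simp
          · intro j _ hj
            rw [Pi.single_eq_of_ne hj]
            exact map_zero (SkewPolynomial.monomial (R := Twist σ) j)
          · simp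
        · obtain ⟨c, hc⟩ := ih (i - n) (by omega) (a * (σ ^ (i - n)) lam)
          refine ⟨c, hc.trans ?_⟩
          have e1 : mono σ i a = mono σ (i - n) a * mono σ n 1 := by
            rw [mono_mul_mono, map_one, mul_one]; congr 1; omega
          have e2 : mono σ (i - n) (a * (σ ^ (i - n)) lam) = mono σ (i - n) a * mono σ 0 lam := by
            rw [mono_mul_mono, add_zero]
          rw [e1, e2, map_mul, map_mul]
          congr 1
          symm
          rw [hmk]
          exact TwoSidedIdeal.subset_span rfl
    intro x
    obtain ⟨f, rfl⟩ := I.ringCon.mk'_surjective x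
    induction f using SkewPolynomial.induction with
    | h0 => exact ⟨0, by rw [hzero, map_zero]⟩
    | ha i r q _ _ ih =>
      obtain ⟨c, hc⟩ := ih
      obtain ⟨d, hd⟩ := hmono i r
      exact ⟨d + c, by rw [hadd, hc, hd, map_add]; rfl⟩

/-- The vector `(a 0, ..., a (n - 1))` of coefficients of `∑ i < n, a i x ^ i`. -/
def coords (f : Alg σ n lam) : Fin n → K := Function.invFun (ofCoeffs σ lam) f

theorem coords_ofCoeffs (hn : 0 < n) (hσ : σ ^ n = 1) (h : σ lam = lam) (h0 : lam ≠ 0)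
    (a : Fin n → K) : coords (ofCoeffs σ lam a) = a :=
  Function.leftInverse_invFun (ofCoeffs_bijective hn hσ h h0).1 a

theorem ofCoeffs_coords (hn : 0 < n) (hσ : σ ^ n = 1) (h : σ lam = lam) (h0 : lam ≠ 0)
    (f : Alg σ n lam) : ofCoeffs σ lam (coords f) = f :=
  Function.rightInverse_invFun (ofCoeffs_bijective hn hσ h h0).2 f

open Classical in
/-- The Hamming distance on the algebra: the number of coefficients in which `f`, `g` differ. -/
def hamming (f g : Alg σ n lam) : ℕ := hammingDist (coords f) (coords g)

/-- `σ ^ j` applied coefficientwise. -/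
def coeffAut (j : ℕ) (f : Alg σ n lam) : Alg σ n lam :=
  ofCoeffs σ lam (fun i => (σ ^ j) (coords f i))

end Alg

/-! ### Notions for arbitrary rings -/

/-- `A` is a matrix ring over a division ring of dimension `m ^ 2` over its centre. -/
def HasIndex (A : Type u) [Ring A] (m : ℕ) : Prop :=
  ∃ (D : Type u) (_ : DivisionRing D) (r : ℕ), 0 < r ∧
    Nonempty (A ≃+* Matrix (Fin r) (Fin r) D) ∧
    0 < m ∧ Module.finrank (Subring.center D) D = m ^ 2

/-- A nonzero idempotent which is not a sum of two nonzero orthogonal idempotents. -/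
def IsPrimitiveIdempotent {A : Type u} [Ring A] (e : A) : Prop :=
  IsIdempotentElem e ∧ e ≠ 0 ∧
    ∀ f g : A, IsIdempotentElem f → IsIdempotentElem g → f * g = 0 → g * f = 0 →
      e = f + g → f = 0 ∨ g = 0

/-- `g` is a least common left multiple of the family `f`. -/
def IsLCLM {A : Type u} [Ring A] {ι : Type} (f : ι → A) (g : A) : Prop :=
  (∀ i, ∃ a, g = a * f i) ∧ ∀ h, (∀ i, ∃ a, h = a * f i) → ∃ b, h = b * g

/-! ### Machine model

Programs of a uniform WHILE language over binary trees whose leaves are empty or carry an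
element of a field `F`. Building a pair (of pointers), taking a component, a field operation
and a test each cost one step. The programs do not depend on `F`; for a finite field each
step can be carried out with a number of bit operations polynomial in the size of the data. -/

/-- Data: binary trees with empty leaves and leaves carrying a field element. -/
inductive Val (F : Type u) : Type u
  | nil : Val F
  | atom (a : F) : Val F
  | cons (l r : Val F) : Val F

namespace Val

variable {F : Type u}

/-- The number of nodes. -/
def size : Val F → ℕ
  | nil => 1
  | atom _ => 1
  | cons l r => 1 + l.size + r.size

/-- The test of the language: empty leaves and zero field elements are false. -/
def Truthy [Zero F] : Val F → Prop
  | nil => False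
  | atom a => a ≠ 0
  | cons _ _ => True

/-- First component. -/
def fst : Val F → Val F
  | cons l _ => l
  | _ => nil

/-- Second component. -/
def snd : Val F → Val F
  | cons _ r => r
  | _ => nil

/-- Apply a binary field operation to a pair of field elements. -/
def map₂ (op : F → F → F) : Val F → Val F
  | cons (atom a) (atom b) => atom (op a b)
  | _ => nil

/-- Apply a unary field operation to a field element. -/
def map (op : F → F) : Val F → Val F
  | atom a => atom (op a)
  | _ => nil

/-- Encoding of a list. -/
def ofList : List (Val F) → Val F
  | [] => nil
  | v :: l => cons v (ofList l)

/-- Unary encoding of a natural number. -/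
def ofNat (k : ℕ) : Val F := ofList (List.replicate k nil)

/-- Encoding of a list of field elements. -/
def ofAtoms (l : List F) : Val F := ofList (l.map atom)

/-- Encoding of a list of bits. -/
def ofBits [Zero F] [One F] (l : List Bool) : Val F := ofAtoms (l.map fun b => if b then 1 else 0)

end Val

/-- Elementary instructions. -/
inductive Instr : Type
  | nil | zero | one | fst | snd | add | mul | neg | inv

/-- The effect of an elementary instruction. -/
def Instr.eval {F : Type u} [Field F] : Instr → Val F → Val F
  | .nil, _ => .nil
  | .zero, _ => .atom 0
  | .one, _ => .atom 1
  | .fst, v => v.fst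
  | .snd, v => v.snd
  | .add, v => v.map₂ (· + ·)
  | .mul, v => v.map₂ (· * ·)
  | .neg, v => v.map (- ·)
  | .inv, v => v.map (·⁻¹)

/-- Programs; each one computes a partial function from data to data. -/
inductive Prog : Type
  | skip
  | instr (i : Instr)
  | pair (f g : Prog)
  | seq (f g : Prog)
  | ite (c f g : Prog)
  | while (c f : Prog)

/-- `Runs P v w t`: the program `P`, started on `v`, halts with output `w` after `t` steps. -/
inductive Runs {F : Type u} [Field F] : Prog → Val F → Val F → ℕ → Prop
  | skip (v) : Runs .skip v v 1
  | instr (i v) : Runs (.instr i) v (i.eval v) 1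
  | pair {f g v a b s t} : Runs f v a s → Runs g v b t →
      Runs (.pair f g) v (.cons a b) (s + t + 1)
  | seq {f g v a b s t} : Runs f v a s → Runs g a b t → Runs (.seq f g) v b (s + t + 1)
  | ite_true {c f g v a b s t} : Runs c v a s → a.Truthy → Runs f v b t →
      Runs (.ite c f g) v b (s + t + 1)
  | ite_false {c f g v a b s t} : Runs c v a s → ¬ a.Truthy → Runs g v b t →
      Runs (.ite c f g) v b (s + t + 1)
  | while_true {c f v a b w s t r} : Runs c v a s → a.Truthy → Runs f v b t →
      Runs (.while c f) b w r → Runs (.while c f) v w (s + t + r + 1)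
  | while_false {c f v a s} : Runs c v a s → ¬ a.Truthy → Runs (.while c f) v v (s + 1)

/-! ### Encodings of the objects of coding theory as data -/

section Encoding

variable {F : Type u} [Field F]

/-- The polynomial with the given coefficients, constant coefficient first. -/
def polyOf : List F → Polynomial F
  | [] => 0
  | a :: l => Polynomial.C a + Polynomial.X * polyOf l

/-- `v` encodes the rational function `f` as a (not necessarily reduced) fraction of two
polynomials given by their lists of coefficients. -/
def EncodesRat (v : Val F) (f : RatFunc F) : Prop :=
  ∃ a b : List F, v = .cons (.ofAtoms a) (.ofAtoms b) ∧ polyOf b ≠ 0 ∧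
    f = algebraMap _ (RatFunc F) (polyOf a) / algebraMap _ (RatFunc F) (polyOf b)

/-- `v` encodes the automorphism `σ` of `F(t)`. On constants `σ` is `u ↦ u ^ Q` for some `Q`,
which is given in binary (least significant bit first); moreover `σ t = (a t + b) / (c t + d)`
for some `a b c d`, which are given as well. -/
def EncodesAut (v : Val F) (σ : RingAut (RatFunc F)) : Prop :=
  ∃ (bits : List Bool) (a b c d : F),
    v = .cons (.ofBits bits) (.ofAtoms [a, b, c, d]) ∧
    (∀ u : F, σ (RatFunc.C u) = RatFunc.C (u ^ Nat.ofDigits 2 (bits.map Bool.toNat))) ∧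
    σ RatFunc.X = (RatFunc.C a * RatFunc.X + RatFunc.C b) /
      (RatFunc.C c * RatFunc.X + RatFunc.C d)

/-- `v` encodes the element `f` of `F(t)[x; σ] / (x ^ n - lam)` by its `n` coefficients. -/
def EncodesAlg {σ : RingAut (RatFunc F)} {n : ℕ} {lam : RatFunc F} (v : Val F)
    (f : Alg σ n lam) : Prop :=
  ∃ c : Fin n → Val F, v = .ofList (List.ofFn c) ∧ ∀ i, EncodesRat (c i) (coords f i)

/-- `v` encodes a decoding problem: the automorphism `σ`, the constant `lam`, the natural numbers
`m`, `k` (in unary), the idempotent `e₀` and the received word `r`. -/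
def EncodesInput {σ : RingAut (RatFunc F)} {n : ℕ} {lam : RatFunc F} (v : Val F) (m k : ℕ)
    (e₀ r : Alg σ n lam) : Prop :=
  ∃ vσ vlam ve vr : Val F, EncodesAut vσ σ ∧ EncodesRat vlam lam ∧ EncodesAlg ve e₀ ∧
    EncodesAlg vr r ∧ v = .ofList [vσ, vlam, .ofNat m, .ofNat k, ve, vr]

end Encoding

end

end SkewConstacyclic

open SkewConstacyclic

/-!
The code consists of the `c` with `c * θ ^ b (e₀) = 0` for `b < k - 1`, where `θ` is `σ ^ m`
acting on coefficients. Conjugation by `x` has this effect, so that `θ` is an automorphism of the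
algebra, and comparing dimensions over centres shows that the `n / m` orthogonal idempotents
`θ ^ b (e₀)` have sum `1` (`IsCyclicDatum.index`).

*Distance.* If `f` has at most `s` nonzero coefficients and is annihilated by `s` consecutive
idempotents `θ ^ b (e₀)`, then `f = 0` (`IsCyclicDatum.eq_zero_of_mul_eq_zero`). Normalise one
coefficient of `f` to be `1`; then `f - θ f` has fewer coefficients and is annihilated by `s - 1`
consecutive idempotents, so `θ f = f` by induction, `f` is annihilated by all the idempotents, and
hence by their sum.

*Decoding.* Let `f` be the error, with at most `τ = (k - 1) / 2` nonzero coefficients. The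
syndromes `y b = θ ^ (-b) (f) * e₀` with `0 ≤ b ≤ k - 2` do not change if `f` is replaced by the
received word. There is a nonzero vector `Γ` of `τ + 1` rational functions such that
`∑ l, Γ l * θ ^ (-l) (f) = 0`, since this amounts to `τ` linear equations. It implies
`∑ l, Γ l * θ ^ b (y (b + l)) = 0` for all `b`, and by the statement on distances these equations
for `b ≤ k - 2 - τ` conversely imply `∑ l, Γ l * θ ^ (-l) (f) = 0`. Therefore any nonzero solution
`Γ` of the known equations gives a twisted recurrence for the whole sequence `y`. After removal of
leading zeros from `Γ` it determines `y (-1), y (-2), ...`, and `f` is the sum of the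
`θ ^ (n / m - b) (y (-b))` with `1 ≤ b ≤ n / m` (`IsCyclicDatum.eq_sum_syndromes`).

*Running time.* Intermediate results must have polynomial size. There is a solution `Γ` with
polynomial entries of small degree (`exists_small_solution`). It is found by linear algebra over
`F`: the equations are packed into one relation between polynomials, whose solutions with bounded
degree are obtained by eliminating coefficients one at a time (`relation_spec`). The automorphism
`σ` acts on a polynomial only up to a power of the denominator of `σ t`; all polynomials are padded
so that the factors which occur are common to whole equations (`exists_twist_factor`). That the
decoder is a program of the machine model with polynomial running time is shown together with its
definition: `Computes F c f` says that the code `c` computes `f` within its bound, and the rules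
for composition, pairing, and loops over lists reduce the claim to bounds for the sizes of
intermediate results.
-/

universe v w z

namespace SkewConstacyclic

noncomputable section

open Polynomial

/-! ### Programs on typed data -/

/-- Types whose elements are encoded as data of the machine model. `dim` measures the widest
list occurring in an element; it is polynomially equivalent to the size of the encoding, but,
unlike the size, it behaves well under the formation of lists. -/
class Enc (F : Type u) (α : Type v) where
  /-- The encoding. -/
  enc : α → Val F
  /-- The largest length of a list occurring in an element. -/
  dim : α → ℕ
  dim_le : ∀ x, dim x ≤ (enc x).size

open Enc

variable {F : Type u}

/-- The size of the encoding. -/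
def sz (F : Type u) {α : Type v} [Enc F α] (x : α) : ℕ := (enc (F := F) x).size

lemma dim_le_sz {α : Type v} [Enc F α] (x : α) : dim F x ≤ sz F x := dim_le x

instance instEncBase : Enc F F := ⟨Val.atom, fun _ => 0, fun _ => Nat.zero_le _⟩

instance : Enc F Unit := ⟨fun _ => Val.nil, fun _ => 0, fun _ => Nat.zero_le _⟩

instance {α : Type v} {β : Type w} [Enc F α] [Enc F β] : Enc F (α × β) where
  enc x := .cons (enc x.1) (enc x.2)
  dim x := max (dim F x.1) (dim F x.2)
  dim_le x := by
    have h1 := dim_le (F := F) x.1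
    have h2 := dim_le (F := F) x.2
    simp only [Val.size]; omega

/-- The largest length occurring in a list of elements. -/
def listDim (F : Type u) {α : Type v} [Enc F α] (l : List α) : ℕ :=
  max l.length (l.foldr (fun a n => max (dim F a) n) 0)

instance {α : Type v} [Enc F α] : Enc F (List α) where
  enc l := .ofList (l.map enc)
  dim l := listDim F l
  dim_le l := by
    induction l with
    | nil => simp [listDim]
    | cons a l ih =>
      have := dim_le (F := F) a
      simp only [listDim, List.length_cons, List.foldr_cons, List.map_cons, Val.ofList,
        Val.size] at *
      omega

section sizes

variable {α : Type v} {β : Type w} [Enc F α] [Enc F β]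

@[simp] lemma enc_pair (a : α) (b : β) : enc (F := F) (a, b) = .cons (enc a) (enc b) := rfl
@[simp] lemma enc_nil : enc (F := F) ([] : List α) = .nil := rfl
@[simp] lemma enc_cons (a : α) (l : List α) : enc (F := F) (a :: l) = .cons (enc a) (enc l) := rfl
@[simp] lemma sz_pair (x : α × β) : sz F x = 1 + sz F x.1 + sz F x.2 := rfl
@[simp] lemma sz_nil : sz F ([] : List α) = 1 := rfl
@[simp] lemma sz_cons (a : α) (l : List α) : sz F (a :: l) = 1 + sz F a + sz F l := rfl
@[simp] lemma sz_base (a : F) : sz F a = 1 := rfl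
@[simp] lemma sz_unit (a : Unit) : sz F a = 1 := rfl

lemma length_lt_sz (l : List α) : l.length < sz F l := by
  induction l with
  | nil => simp
  | cons a l ih => simp; omega

lemma sz_mem {l : List α} {a : α} (h : a ∈ l) : sz F a ≤ sz F l := by
  induction l with
  | nil => simp at h
  | cons b l ih =>
    rcases List.mem_cons.1 h with rfl | h
    · simp; omega
    · have := ih h; simp; omega

@[simp] lemma dim_base (a : F) : dim F a = 0 := rfl
@[simp] lemma dim_unit (a : Unit) : dim F a = 0 := rfl

lemma dim_pair_le {x : α × β} {N : ℕ} : dim F x ≤ N ↔ dim F x.1 ≤ N ∧ dim F x.2 ≤ N :=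
  max_le_iff

lemma dim_list_le {l : List α} {N : ℕ} :
    dim F l ≤ N ↔ l.length ≤ N ∧ ∀ a ∈ l, dim F a ≤ N := by
  have : ∀ l : List α, l.foldr (fun a n => max (dim F a) n) 0 ≤ N ↔ ∀ a ∈ l, dim F a ≤ N := by
    intro l
    induction l with
    | nil => simp
    | cons a l ih => simp [ih]
  rw [← this]
  exact max_le_iff

lemma dim_poly_le {l : List F} {N : ℕ} : dim F l ≤ N ↔ l.length ≤ N := by
  simp [dim_list_le]

end sizes

/-- A program together with a bound for its running time and the size of its output. -/
structure Code where
  /-- The program. -/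
  prog : Prog
  /-- The bound, in terms of the size of the input. -/
  bound : ℕ[X]

/-- The program of `c` computes the function `f` within the bound of `c`. -/
def Computes (F : Type u) [Field F] {α : Type v} {β : Type w} [Enc F α] [Enc F β] (c : Code)
    (f : α → β) : Prop :=
  ∀ x, ∃ t, Runs c.prog (enc (F := F) x) (enc (f x)) t ∧ t + sz F (f x) ≤ c.bound.eval (sz F x)

/-- The code of a composition. -/
def Code.comp (d c : Code) : Code :=
  ⟨.seq c.prog d.prog, c.bound + d.bound.comp c.bound + 1⟩

/-- The code of a pair of functions. -/
def Code.pair (c d : Code) : Code := ⟨.pair c.prog d.prog, c.bound + d.bound + 2⟩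

lemma eval_mono (p : ℕ[X]) {a b : ℕ} (h : a ≤ b) : p.eval a ≤ p.eval b := by
  rw [eval_eq_sum, eval_eq_sum]
  exact Finset.sum_le_sum fun i _ => Nat.mul_le_mul_left _ (Nat.pow_le_pow_left h i)

/-- Every element of the type has size at most the value of `p` at its `dim`. -/
def SizeBound (F : Type u) (α : Type v) [Enc F α] (p : ℕ[X]) : Prop :=
  ∀ x : α, sz F x ≤ p.eval (dim F x)

namespace SizeBound

lemma base : SizeBound F F 1 := fun x => by simp

lemma unit : SizeBound F Unit 1 := fun x => by simp

variable {α : Type v} {β : Type w} [Enc F α] [Enc F β] {p q : ℕ[X]}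

lemma prod (hp : SizeBound F α p) (hq : SizeBound F β q) : SizeBound F (α × β) (1 + p + q) := by
  intro x
  have h1 := (hp x.1).trans (eval_mono p (dim_pair_le.1 (le_refl (dim F x))).1)
  have h2 := (hq x.2).trans (eval_mono q (dim_pair_le.1 (le_refl (dim F x))).2)
  simp only [sz_pair, eval_add, eval_one]; omega

lemma list (hp : SizeBound F α p) : SizeBound F (List α) (1 + X * (1 + p)) := by
  intro l
  obtain ⟨h1, h2⟩ := dim_list_le.1 (le_refl (dim F l))
  generalize dim F l = N at h1 h2
  have : sz F l ≤ 1 + l.length * (1 + p.eval N) := by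
    clear h1
    induction l with
    | nil => simp
    | cons a l ih =>
      have h3 := (hp a).trans (eval_mono p (h2 a (by simp)))
      have h4 := ih fun b hb => h2 b (by simp [hb])
      simp only [sz_cons, List.length_cons, add_mul]; omega
  simp only [eval_add, eval_mul, eval_one, eval_X]
  exact this.trans (by gcongr)

end SizeBound

/-- Case distinction on a list. -/
def listElim {γ : Type z} {β : Type w} (l : List γ) (b : β) (g : γ → List γ → β) : β :=
  match l with
  | [] => b
  | a :: t => g a t

@[simp] lemma listElim_nil {γ : Type z} {β : Type w} (b : β) (g : γ → List γ → β) :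
    listElim [] b g = b := rfl

@[simp] lemma listElim_cons {γ : Type z} {β : Type w} (b : β) (g : γ → List γ → β) (a : γ)
    (t : List γ) : listElim (a :: t) b g = g a t := rfl

namespace Computes

variable [Field F] {α : Type v} {β : Type w} {γ : Type z} [Enc F α] [Enc F β] [Enc F γ]
  {c d e : Code}

lemma id : Computes F ⟨.skip, X + 1⟩ (fun x : α => x) := fun x =>
  ⟨1, .skip _, by simp; omega⟩

lemma comp {f : α → β} {g : β → γ} (hg : Computes F d g) (hf : Computes F c f) :
    Computes F (d.comp c) (fun x => g (f x)) := by
  intro x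
  obtain ⟨s, hs, hs'⟩ := hf x
  obtain ⟨t, ht, ht'⟩ := hg (f x)
  refine ⟨_, .seq hs ht, ?_⟩
  have := eval_mono d.bound (show sz F (f x) ≤ c.bound.eval (sz F x) by omega)
  simp only [Code.comp, eval_add, eval_comp, eval_one]; omega

lemma pair {f : α → β} {g : α → γ} (hf : Computes F c f) (hg : Computes F d g) :
    Computes F (c.pair d) (fun x => (f x, g x)) := by
  intro x
  obtain ⟨s, hs, hs'⟩ := hf x
  obtain ⟨t, ht, ht'⟩ := hg x
  refine ⟨_, .pair hs ht, ?_⟩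
  simp only [Code.pair, eval_add, eval_ofNat, sz_pair]; omega

/-- One elementary instruction. -/
lemma instr {f : α → β} (i : Instr)
    (h : ∀ x, i.eval (enc (F := F) x) = enc (f x)) (h' : ∀ x, sz F (f x) ≤ sz F x + 1) :
    Computes F ⟨.instr i, X + 2⟩ f := by
  intro x
  refine ⟨1, h x ▸ .instr i _, ?_⟩
  have := h' x
  simp only [eval_add, eval_ofNat, eval_X]; omega

lemma fst {f : α → β × γ} (hf : Computes F c f) :
    Computes F (Code.comp ⟨.instr .fst, X + 2⟩ c) (fun x => (f x).1) :=
  comp (g := Prod.fst) (instr .fst (fun _ => rfl) (fun x => by simp; omega)) hf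

lemma snd {f : α → β × γ} (hf : Computes F c f) :
    Computes F (Code.comp ⟨.instr .snd, X + 2⟩ c) (fun x => (f x).2) :=
  comp (g := Prod.snd) (instr .snd (fun _ => rfl) (fun x => by simp; omega)) hf

lemma nil : Computes F ⟨.instr .nil, X + 2⟩ (fun _ : α => ([] : List β)) :=
  instr .nil (fun _ => rfl) (fun x => by simp)

lemma unit : Computes F ⟨.instr .nil, X + 2⟩ (fun _ : α => ()) :=
  instr .nil (fun _ => rfl) (fun x => by simp)

lemma zero : Computes F ⟨.instr .zero, X + 2⟩ (fun _ : α => (0 : F)) :=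
  instr .zero (fun _ => rfl) (fun x => by simp)

lemma one : Computes F ⟨.instr .one, X + 2⟩ (fun _ : α => (1 : F)) :=
  instr .one (fun _ => rfl) (fun x => by simp)

/-- Composition with a function of two arguments. -/
lemma comp₂ {δ : Type*} [Enc F δ] {g : β → γ → δ} {f : α → β} {f' : α → γ}
    (hg : Computes F e (fun y : β × γ => g y.1 y.2)) (hf : Computes F c f)
    (hf' : Computes F d f') :
    Computes F (e.comp (c.pair d)) (fun x => g (f x) (f' x)) :=
  comp hg (pair hf hf')

lemma cons {f : α → β} {l : α → List β} (hf : Computes F c f) (hl : Computes F d l) :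
    Computes F (c.pair d) (fun x => f x :: l x) :=
  pair hf hl

lemma addF : Computes F ⟨.instr .add, X + 2⟩ (fun x : F × F => x.1 + x.2) :=
  instr .add (fun _ => rfl) (fun x => by simp)

lemma mulF : Computes F ⟨.instr .mul, X + 2⟩ (fun x : F × F => x.1 * x.2) :=
  instr .mul (fun _ => rfl) (fun x => by simp)

lemma negF : Computes F ⟨.instr .neg, X + 2⟩ (fun x : F => -x) :=
  instr .neg (fun _ => rfl) (fun x => by simp)

lemma invF : Computes F ⟨.instr .inv, X + 2⟩ (fun x : F => x⁻¹) :=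
  instr .inv (fun _ => rfl) (fun x => by simp)

open Classical in
lemma iteZero {t : α → F} {f g : α → β} (ht : Computes F c t) (hf : Computes F d f)
    (hg : Computes F e g) :
    Computes F ⟨.ite c.prog e.prog d.prog, c.bound + d.bound + e.bound + 1⟩
      (fun x => if t x = 0 then f x else g x) := by
  intro x
  obtain ⟨s, hs, hs'⟩ := ht x
  obtain ⟨r, hr, hr'⟩ := hf x
  obtain ⟨q, hq, hq'⟩ := hg x
  by_cases h : t x = 0
  · refine ⟨_, .ite_false hs (by simpa [Val.Truthy, Enc.enc] using h)
      (by simpa only [if_pos h] using hr), ?_⟩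
    simp only [if_pos h, eval_add, eval_one]; omega
  · refine ⟨_, .ite_true hs (by simpa [Val.Truthy, Enc.enc] using h)
      (by simpa only [if_neg h] using hq), ?_⟩
    simp only [if_neg h, eval_add, eval_one]; omega

/-- Case distinction: a nonempty list has the encoding of the pair formed by its head
and its tail. -/
lemma listCase {l : α → List γ} {f : α → β} {g : α → γ → List γ → β}
    (hl : Computes F c l) (hf : Computes F d f)
    (hg : Computes F e (fun y : α × γ × List γ => g y.1 y.2.1 y.2.2)) :
    Computes F ⟨.ite c.prog (.seq (.pair .skip c.prog) e.prog) d.prog,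
        2 * c.bound + d.bound + e.bound.comp (X + c.bound + 2) + 4⟩
      (fun x => listElim (l x) (f x) (g x)) := by
  intro x
  obtain ⟨s, hs, hs'⟩ := hl x
  rcases h : l x with _ | ⟨a, t⟩
  · rw [h] at hs
    simp only [h, listElim_nil]
    obtain ⟨r, hr, hr'⟩ := hf x
    refine ⟨_, .ite_false hs (by simp [Val.Truthy]) hr, ?_⟩
    simp only [eval_add, eval_mul, eval_ofNat]; omega
  · rw [h] at hs hs'
    obtain ⟨r, hr, hr'⟩ := hg (x, a, t)
    simp only [h, listElim_cons]
    dsimp only at hr hr'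
    refine ⟨_, .ite_true hs trivial (.seq (.pair (.skip _) hs) hr), ?_⟩
    have := eval_mono e.bound (show sz F (x, a, t) ≤ sz F x + c.bound.eval (sz F x) + 2 by
      simp at *; omega)
    simp only [eval_add, eval_mul, eval_ofNat, eval_comp, eval_X] at *; omega

end Computes

/-! ### Loops over lists -/

/-- The body of the loop behind `List.foldl`; it works on `(list, (context, state))`. -/
def foldBody (e : Prog) : Prog :=
  .pair (.seq (.instr .fst) (.instr .snd))
    (.pair (.seq (.instr .snd) (.instr .fst))
      (.seq (.pair (.seq (.instr .snd) (.instr .fst))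
        (.pair (.seq (.instr .snd) (.instr .snd)) (.seq (.instr .fst) (.instr .fst)))) e))

/-- The program behind `List.foldl`. -/
def foldProg (c d e : Prog) : Prog :=
  .seq (.pair c (.pair .skip d))
    (.seq (.while (.instr .fst) (foldBody e)) (.seq (.instr .snd) (.instr .snd)))

/-- The code of a loop, given a bound for the size of its state. -/
def Code.fold (c d e : Code) (B : ℕ[X]) : Code :=
  ⟨foldProg c.prog d.prog e.prog,
    c.bound + d.bound + c.bound * (e.bound.comp (X + 2 * (B + c.bound) + 2) + 30) + B + 20⟩

/-- The code of a loop whose steps increase the size of the state by at most `Q`. -/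
def Code.foldAdd (c d e : Code) (Q : ℕ[X]) : Code := c.fold d e (d.bound + c.bound * Q)

/-- The code of a loop whose steps increase the dimension of the state by at most `Q`. -/
def Code.foldDim (c d e : Code) (b Q : ℕ[X]) : Code :=
  c.fold d e (b.comp (X + d.bound + c.bound * Q))

section fold

variable [Field F] {α : Type v} {β : Type w} {γ : Type z} [Enc F α] [Enc F β] [Enc F γ]
  {c d e : Code}

lemma runs_fold {s : α → β → γ → β}
    (hs : Computes F e (fun y : α × β × γ => s y.1 y.2.1 y.2.2)) (x : α) (M : ℕ) (l : List γ) :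
    ∀ st : β, (∀ l', l' <+: l → sz F (l'.foldl (s x) st) ≤ M) → (∀ a ∈ l, sz F a ≤ M) →
    ∃ t, Runs (.while (.instr .fst) (foldBody e.prog))
        (.cons (enc (F := F) l) (.cons (enc x) (enc st)))
        (.cons .nil (.cons (enc x) (enc (l.foldl (s x) st)))) t ∧
      t ≤ l.length * (e.bound.eval (sz F x + 2 * M + 2) + 30) + 2 := by
  induction l with
  | nil =>
    intro st _ _
    exact ⟨2, .while_false (.instr _ _) (by simp [Instr.eval, Val.fst, Val.Truthy]), by simp⟩
  | cons a l ih =>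
    intro st h1 h2
    obtain ⟨t, ht, ht'⟩ := hs (x, st, a)
    obtain ⟨r, hr, hr'⟩ := ih (s x st a)
      (fun l' hl' => h1 (a :: l') (by simpa using hl'))
      (fun b hb => h2 b (by simp [hb]))
    have hbody : ∃ q, Runs (foldBody e.prog)
        (.cons (enc (F := F) (a :: l)) (.cons (enc x) (enc st)))
        (.cons (enc (F := F) l) (.cons (enc x) (enc (s x st a)))) q ∧ q ≤ t + 27 :=
      ⟨_, .pair (.seq (.instr .fst _) (.instr .snd _))
        (.pair (.seq (.instr .snd _) (.instr .fst _))
          (.seq (.pair (.seq (.instr .snd _) (.instr .fst _))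
            (.pair (.seq (.instr .snd _) (.instr .snd _))
              (.seq (.instr .fst _) (.instr .fst _)))) ht)), by omega⟩
    obtain ⟨q, hq, hq'⟩ := hbody
    refine ⟨_, .while_true (.instr .fst _) trivial hq hr, ?_⟩
    have h3 := h1 [] (by simp)
    have h4 := h2 a (by simp)
    have := eval_mono e.bound (show sz F (x, st, a) ≤ sz F x + 2 * M + 2 by
      simp at *; omega)
    simp only [List.length_cons, add_mul]; omega

/-- A loop over a list is feasible if the size of its state is bounded by a polynomial. -/
lemma Computes.foldl {l : α → List γ} {i : α → β} {s : α → β → γ → β}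
    (hl : Computes F c l) (hi : Computes F d i)
    (hs : Computes F e (fun y : α × β × γ => s y.1 y.2.1 y.2.2)) (B : ℕ[X])
    (hB : ∀ x l', l' <+: l x → sz F (l'.foldl (s x) (i x)) ≤ B.eval (sz F x)) :
    Computes F (c.fold d e B) (fun x => (l x).foldl (s x) (i x)) := by
  intro x
  obtain ⟨t1, ht1, ht1'⟩ := hl x
  obtain ⟨t2, ht2, ht2'⟩ := hi x
  obtain ⟨t3, ht3, ht3'⟩ := runs_fold hs x (B.eval (sz F x) + c.bound.eval (sz F x)) (l x) (i x)
    (fun l' hl' => (hB x l' hl').trans (by omega))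
    (fun a ha => (sz_mem ha).trans (by omega))
  refine ⟨_, .seq (.pair ht1 (.pair (.skip _) ht2)) (.seq ht3 (.seq (.instr .snd _)
    (.instr .snd _))), ?_⟩
  have h1 := hB x (l x) List.prefix_rfl
  have h2 : (l x).length ≤ c.bound.eval (sz F x) := by
    have := length_lt_sz (F := F) (l x); omega
  have h3 := ht3'.trans (Nat.add_le_add_right (Nat.mul_le_mul_right _ h2) 2)
  simp only [Code.fold, eval_add, eval_mul, eval_ofNat, eval_comp, eval_X] at *
  omega

/-- A loop whose steps increase the size of the state by a bounded amount. -/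
lemma Computes.foldlAdd {l : α → List γ} {i : α → β} {s : α → β → γ → β}
    (hl : Computes F c l) (hi : Computes F d i)
    (hs : Computes F e (fun y : α × β × γ => s y.1 y.2.1 y.2.2)) (Q : ℕ[X])
    (hQ : ∀ x st, ∀ a ∈ l x, sz F (s x st a) ≤ sz F st + Q.eval (sz F x)) :
    Computes F (c.foldAdd d e Q) (fun x => (l x).foldl (s x) (i x)) := by
  refine hl.foldl hi hs _ fun x l' hl' => ?_
  have key : ∀ (l' : List γ) st, (∀ a ∈ l', a ∈ l x) →
      sz F (l'.foldl (s x) st) ≤ sz F st + l'.length * Q.eval (sz F x) := by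
    intro l'
    induction l' with
    | nil => intro st _; simp
    | cons a l' ih =>
      intro st h
      have h1 := ih (s x st a) fun b hb => h b (by simp [hb])
      have h2 := hQ x st a (h a (by simp))
      simp only [List.foldl_cons, List.length_cons, add_mul]; omega
  refine (key l' (i x) fun a ha => hl'.subset ha).trans ?_
  obtain ⟨_, _, h1⟩ := hl x
  obtain ⟨_, _, h2⟩ := hi x
  have h3 := length_lt_sz (F := F) (l x)
  have h4 := hl'.length_le
  simp only [eval_add, eval_mul]
  exact Nat.add_le_add (by omega) (Nat.mul_le_mul_right _ (by omega))

/-- A loop whose steps increase the dimension of the state by a bounded amount. -/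
lemma Computes.foldlDim {l : α → List γ} {i : α → β} {s : α → β → γ → β}
    (hl : Computes F c l) (hi : Computes F d i)
    (hs : Computes F e (fun y : α × β × γ => s y.1 y.2.1 y.2.2)) {b : ℕ[X]}
    (hb : SizeBound F β b) (Q : ℕ[X])
    (hQ : ∀ x st, ∀ a ∈ l x, ∀ N, sz F x ≤ N → dim F st ≤ N →
      dim F (s x st a) ≤ N + Q.eval (sz F x)) :
    Computes F (c.foldDim d e b Q) (fun x => (l x).foldl (s x) (i x)) := by
  refine hl.foldl hi hs _ fun x l' hl' => ?_
  have key : ∀ (l' : List γ) st N, (∀ a ∈ l', a ∈ l x) → sz F x ≤ N → dim F st ≤ N →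
      dim F (l'.foldl (s x) st) ≤ N + l'.length * Q.eval (sz F x) := by
    intro l'
    induction l' with
    | nil => intro st N _ _ h; simpa using h
    | cons a l' ih =>
      intro st N h hN hst
      have h1 := ih (s x st a) (N + Q.eval (sz F x)) (fun b hb => h b (by simp [hb])) (by omega)
        (hQ x st a (h a (by simp)) N hN hst)
      simp only [List.foldl_cons, List.length_cons, add_mul]; omega
  obtain ⟨_, _, h1⟩ := hl x
  obtain ⟨_, _, h2⟩ := hi x
  have h3 := length_lt_sz (F := F) (l x)
  have h4 := hl'.length_le
  have h5 := dim_le_sz (F := F) (i x)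
  refine (hb _).trans ?_
  rw [eval_comp]
  refine eval_mono b ((key l' (i x) (sz F x + d.bound.eval (sz F x)) (fun a ha => hl'.subset ha)
    (by omega) (by omega)).trans ?_)
  simp only [eval_add, eval_mul, eval_X]
  exact Nat.add_le_add_left (Nat.mul_le_mul_right _ (by omega)) _

end fold

open Enc

/-! ### Feasible operations on lists -/

lemma exists_reverse : ∃ c : Code, ∀ (F : Type u) [Field F] (α : Type v) [Enc F α],
    Computes F c (fun l : List α => l.reverse) := by
  apply Exists.intro
  intro F _ α _
  have := Computes.foldlAdd (F := F) (l := fun l : List α => l) (i := fun _ => ([] : List α))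
    (s := fun _ st a => a :: st) .id .nil (.cons (.snd (.snd .id)) (.fst (.snd .id))) (1 + X)
    (fun x st a ha => by
      have := sz_mem (F := F) ha
      simp; omega)
  simpa only [List.foldl_flip_cons_eq_append, List.map_id_fun', List.append_nil, id_eq] using this

/-- The code reversing a list. -/
def Code.rev : Code := exists_reverse.{u, v}.choose

section rules

variable {F : Type u} [Field F] {α : Type v} {β : Type w} {γ : Type z} [Enc F α] [Enc F β]
  [Enc F γ] {c d e : Code}

namespace Computes

lemma reverse {l : α → List γ} (hl : Computes F c l) :
    Computes F (Code.rev.{u, z}.comp c) (fun x => (l x).reverse) :=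
  comp (exists_reverse.choose_spec F γ) hl

lemma foldrAdd {l : α → List γ} {i : α → β} {s : α → β → γ → β}
    (hl : Computes F c l) (hi : Computes F d i)
    (hs : Computes F e (fun y : α × β × γ => s y.1 y.2.1 y.2.2)) (Q : ℕ[X])
    (hQ : ∀ x st, ∀ a ∈ l x, sz F (s x st a) ≤ sz F st + Q.eval (sz F x)) :
    Computes F ((Code.rev.{u, z}.comp c).foldAdd d e Q)
      (fun x => (l x).foldr (fun a st => s x st a) (i x)) := by
  simpa only [List.foldl_reverse] using
    (hl.reverse).foldlAdd hi hs Q (fun x st a ha => hQ x st a (by simpa using ha))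

lemma foldrDim {l : α → List γ} {i : α → β} {s : α → β → γ → β}
    (hl : Computes F c l) (hi : Computes F d i)
    (hs : Computes F e (fun y : α × β × γ => s y.1 y.2.1 y.2.2)) {b : ℕ[X]}
    (hb : SizeBound F β b) (Q : ℕ[X])
    (hQ : ∀ x st, ∀ a ∈ l x, ∀ N, sz F x ≤ N → dim F st ≤ N →
      dim F (s x st a) ≤ N + Q.eval (sz F x)) :
    Computes F ((Code.rev.{u, z}.comp c).foldDim d e b Q)
      (fun x => (l x).foldr (fun a st => s x st a) (i x)) := by
  simpa only [List.foldl_reverse] using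
    (hl.reverse).foldlDim hi hs hb Q (fun x st a ha => hQ x st a (by simpa using ha))

end Computes

/-- The code of `List.map`. -/
def Code.map (c e : Code) : Code :=
  (Code.rev.{u, z}.comp c).foldAdd ⟨.instr .nil, X + 2⟩
    ((e.comp (Code.pair (Code.comp ⟨.instr .fst, X + 2⟩ ⟨.skip, X + 1⟩)
      (Code.comp ⟨.instr .snd, X + 2⟩ (Code.comp ⟨.instr .snd, X + 2⟩ ⟨.skip, X + 1⟩)))).pair
      (Code.comp ⟨.instr .fst, X + 2⟩ (Code.comp ⟨.instr .snd, X + 2⟩ ⟨.skip, X + 1⟩)))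
    (1 + e.bound.comp (1 + X + c.bound))

namespace Computes

lemma map {l : α → List γ} {f : α → γ → β} (hl : Computes F c l)
    (hf : Computes F e (fun y : α × γ => f y.1 y.2)) :
    Computes F (Code.map.{u, z} c e) (fun x => (l x).map (f x)) := by
  have := foldrAdd (s := fun x st a => f x a :: st) hl (nil (β := β))
    (cons (comp₂ hf (fst id) (snd (snd id))) (fst (snd id))) (1 + e.bound.comp (1 + X + c.bound))
    (fun x st a ha => by
      obtain ⟨t, _, ht⟩ := hf (x, a)
      obtain ⟨t', _, ht'⟩ := hl x
      have := sz_mem (F := F) ha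
      have := eval_mono e.bound (show sz F (x, a) ≤ 1 + sz F x + c.bound.eval (sz F x) by
        simp; omega)
      dsimp only at ht
      simp only [sz_cons, eval_add, eval_one, eval_comp, eval_X]; omega)
  simp only [← List.map_eq_foldr] at this
  exact this

end Computes

end rules

lemma exists_append : ∃ c : Code, ∀ (F : Type u) [Field F] (α : Type v) [Enc F α],
    Computes F c (fun x : List α × List α => x.1 ++ x.2) := by
  apply Exists.intro
  intro F _ α _
  have := Computes.foldrAdd (F := F) (l := fun x : List α × List α => x.1) (i := fun x => x.2)
    (s := fun _ st a => a :: st) (.fst .id) (.snd .id)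
    (.cons (.snd (.snd .id)) (.fst (.snd .id))) (1 + X)
    (fun x st a ha => by
      have := sz_mem (F := F) ha
      simp; omega)
  simpa using this

lemma exists_tail : ∃ c : Code, ∀ (F : Type u) [Field F] (α : Type v) [Enc F α],
    Computes F c (fun l : List α => l.tail) := by
  apply Exists.intro
  intro F _ α _
  have := Computes.listCase (F := F) (l := fun x : List α => x) (f := fun _ => [])
    (g := fun _ _ t => t) .id .nil (.snd (.snd .id))
  refine (congrArg (Computes F _) (funext fun l => ?_)).mp this
  cases l <;> rfl

lemma exists_drop : ∃ c : Code, ∀ (F : Type u) [Field F] (α : Type v) [Enc F α],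
    Computes F c (fun x : List Unit × List α => x.2.drop x.1.length) := by
  apply Exists.intro
  intro F _ α _
  have := Computes.foldlAdd (F := F) (l := fun x : List Unit × List α => x.1) (i := fun x => x.2)
    (s := fun _ st _ => st.tail) (.fst .id) (.snd .id)
    (.comp (exists_tail.choose_spec F α) (.fst (.snd .id))) 0
    (fun x st a ha => by cases st <;> simp)
  refine (congrArg (Computes F _) (funext fun ⟨l, m⟩ => ?_)).mp this
  dsimp only
  induction l generalizing m with
  | nil => simp
  | cons a l ih => simp [ih]

/-- The loop behind `List.zip`: the second list is consumed along with the first one. -/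
lemma foldl_zip {α : Type v} {β : Type w} (l : List α) (l' : List β) (acc : List (α × β)) :
    (l.foldl (fun st a => listElim st.1 st fun b t => (t, (a, b) :: st.2)) (l', acc)).2 =
      (l.zip l').reverse ++ acc := by
  induction l generalizing l' acc with
  | nil => simp
  | cons a l ih =>
    cases l' with
    | nil =>
      simp only [List.foldl_cons]
      rw [ih]; simp
    | cons b l' => simp [ih]

lemma exists_zip : ∃ c : Code, ∀ (F : Type u) [Field F] (α : Type v) [Enc F α] (β : Type w)
    [Enc F β], Computes F c (fun x : List α × List β => x.1.zip x.2) := by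
  apply Exists.intro
  intro F _ α _ β _
  have := Computes.reverse (.snd (Computes.foldlAdd (F := F)
    (l := fun x : List α × List β => x.1) (i := fun x => (x.2, ([] : List (α × β))))
    (s := fun _ st a => listElim st.1 st fun b t => (t, (a, b) :: st.2))
    (.fst .id) (.pair (.snd .id) .nil)
    (.listCase (.fst (.fst (.snd .id))) (.fst (.snd .id))
      (.pair (.snd (.snd .id)) (.cons (.pair (.snd (.snd (.fst .id))) (.fst (.snd .id)))
        (.snd (.fst (.snd (.fst .id)))))))
    (1 + X)
    (fun x st a ha => by
      have := sz_mem (F := F) ha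
      rcases st with ⟨_ | ⟨b, t⟩, s⟩ <;> simp
      omega)))
  simpa only [foldl_zip, List.append_nil, List.reverse_reverse] using this

/-- The concatenation of a list of lists. -/
lemma exists_flatten : ∃ c : Code, ∀ (F : Type u) [Field F] (α : Type v) [Enc F α],
    Computes F c (fun l : List (List α) => l.flatten) := by
  have hsz : ∀ (F : Type u) [Field F] (α : Type v) [Enc F α] (l l' : List α),
      sz F (l ++ l') ≤ sz F l + sz F l' := by
    intro F _ α _ l l'
    induction l with
    | nil => simp
    | cons a l ih => simp; omega
  apply Exists.intro
  intro F _ α _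
  have := Computes.foldrAdd (F := F) (l := fun x : List (List α) => x) (i := fun _ => [])
    (s := fun _ st a => a ++ st) .id .nil
    (.comp₂ (exists_append.choose_spec F α) (.snd (.snd .id)) (.fst (.snd .id))) X
    (fun x st a ha => by
      have := sz_mem (F := F) ha
      have := hsz F α a st
      simp; omega)
  refine (congrArg (Computes F _) (funext fun l => ?_)).mp this
  induction l with
  | nil => simp
  | cons a l ih => simp_all

section rules

variable {F : Type u} [Field F] {α : Type v} {β : Type w} {γ : Type z} [Enc F α] [Enc F β]
  [Enc F γ] {c d e : Code}

namespace Computes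

lemma append {f g : α → List β} (hf : Computes F c f) (hg : Computes F d g) :
    Computes F (exists_append.{u, w}.choose.comp (c.pair d)) (fun x => f x ++ g x) :=
  comp₂ (exists_append.choose_spec F β) hf hg

lemma tail {f : α → List β} (hf : Computes F c f) :
    Computes F (exists_tail.{u, w}.choose.comp c) (fun x => (f x).tail) :=
  comp (exists_tail.choose_spec F β) hf

lemma drop {m : α → List Unit} {f : α → List β} (hm : Computes F c m) (hf : Computes F d f) :
    Computes F (exists_drop.{u, w}.choose.comp (c.pair d)) (fun x => (f x).drop (m x).length) :=
  comp (exists_drop.choose_spec F β) (pair hm hf)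

lemma zip {f : α → List β} {g : α → List γ} (hf : Computes F c f) (hg : Computes F d g) :
    Computes F (exists_zip.{u, w, z}.choose.comp (c.pair d)) (fun x => (f x).zip (g x)) :=
  comp (exists_zip.choose_spec F β γ) (pair hf hg)

lemma flatten {f : α → List (List β)} (hf : Computes F c f) :
    Computes F (exists_flatten.{u, w}.choose.comp c) (fun x => (f x).flatten) :=
  comp (exists_flatten.choose_spec F β) hf

end Computes

end rules

/-! ### Arithmetic of polynomials given by lists of coefficients -/

section defs

variable {F : Type u} [Field F]

/-- Sum of polynomials. -/
def padd : List F → List F → List F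
  | [], q => q
  | p, [] => p
  | a :: p, b :: q => (a + b) :: padd p q

/-- Product of a polynomial and a constant. -/
def psmul (a : F) (p : List F) : List F := p.map fun b => a * b

/-- Product of polynomials. -/
def pmul (p q : List F) : List F := p.foldr (fun a acc => padd (psmul a q) (0 :: acc)) []

/-- The zero polynomial, with as many coefficients as the length of a list. -/
def zeros {α : Type v} (l : List α) : List F := l.map fun _ => 0

open Classical in
/-- The value of `u ↦ u ^ Q`, where `Q` is given by its bits. -/
def frob (bits : List F) (x : F) : F :=
  bits.foldr (fun b acc => if b = 0 then acc * acc else x * (acc * acc)) 1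

/-- The product of a polynomial and `a t + b`. -/
def plin (a b : F) (p : List F) : List F := padd (psmul b p) (0 :: psmul a p)

/-- The entry of a list with a given index, or zero. -/
def entry (i : ℕ) (l : List F) : F := (l.drop i).headD 0

/-- The homogenised action of the automorphism with data `s` on polynomials: the value at a
list with `N + 1` entries is the numerator of the image with respect to the denominator
`(c t + d) ^ N`. The number of entries is preserved. -/
def phom (s : List F × List F) (p : List F) : List F :=
  (p.foldr (fun x st => (padd (psmul (frob s.1 x) st.2)
    (plin (entry 0 s.2) (entry 1 s.2) st.1), plin (entry 2 s.2) (entry 3 s.2) st.2)) ([], [1])).1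

end defs

section lengths

variable {F : Type u} [Field F]

@[simp] lemma length_padd (p q : List F) : (padd p q).length = max p.length q.length := by
  induction p generalizing q with
  | nil => simp [padd]
  | cons a p ih => cases q <;> simp [padd, ih]

@[simp] lemma length_psmul (a : F) (p : List F) : (psmul a p).length = p.length := by
  simp [psmul]

@[simp] lemma length_zeros {α : Type v} (l : List α) : (zeros l : List F).length = l.length := by
  simp [zeros]

lemma length_pmul (p q : List F) (hq : q ≠ []) (hp : p ≠ []) :
    (pmul p q).length + 1 = p.length + q.length := by
  have hq := List.length_pos_iff.2 hq
  induction p with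
  | nil => simp at hp
  | cons a p ih =>
    rcases eq_or_ne p [] with rfl | h
    · simp [pmul]; omega
    · have := ih h
      have h' := List.length_pos_iff.2 h
      simp only [pmul, List.foldr_cons, length_padd, length_psmul, List.length_cons] at *
      omega

lemma length_pmul_le (p q : List F) : (pmul p q).length ≤ p.length + q.length := by
  induction p with
  | nil => simp [pmul]
  | cons a p ih =>
    simp only [pmul, List.foldr_cons, length_padd, length_psmul, List.length_cons] at *
    omega

lemma length_plin (a b : F) (p : List F) : (plin a b p).length = p.length + 1 := by
  simp [plin]

lemma length_phom_aux (s : List F × List F) (p : List F) :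
    (p.foldr (fun x st => (padd (psmul (frob s.1 x) st.2)
      (plin (entry 0 s.2) (entry 1 s.2) st.1),
      plin (entry 2 s.2) (entry 3 s.2) st.2)) (([], [1]) : List F × List F)).1.length = p.length ∧
    (p.foldr (fun x st => (padd (psmul (frob s.1 x) st.2)
      (plin (entry 0 s.2) (entry 1 s.2) st.1),
      plin (entry 2 s.2) (entry 3 s.2) st.2)) (([], [1]) : List F × List F)).2.length =
      p.length + 1 := by
  induction p with
  | nil => simp
  | cons a p ih =>
    simp only [List.foldr_cons, length_padd, length_psmul, length_plin, ih, List.length_cons]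
    simp

@[simp] lemma length_phom (s : List F × List F) (p : List F) : (phom s p).length = p.length :=
  (length_phom_aux s p).1

lemma sz_poly {F : Type u} (p : List F) : sz F p = 2 * p.length + 1 := by
  induction p with
  | nil => simp
  | cons a p ih => simp [ih]; omega

end lengths

section feasible

lemma exists_zeros : ∃ c : Code, ∀ (F : Type u) [Field F] (α : Type v) [Enc F α],
    Computes F c (fun l : List α => (zeros l : List F)) := by
  apply Exists.intro
  intro F _ α _
  exact Computes.map (.id) .zero

lemma exists_head : ∃ c : Code, ∀ (F : Type u) [Field F],
    Computes F c (fun l : List F => l.headD 0) := by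
  apply Exists.intro
  intro F _
  have := Computes.listCase (F := F) (l := fun x : List F => x) (f := fun _ => 0)
    (g := fun _ a _ => a) .id .zero (.fst (.snd .id))
  refine (congrArg (Computes F _) (funext fun l => ?_)).mp this
  cases l <;> rfl

lemma exists_entry (i : ℕ) : ∃ c : Code, ∀ (F : Type u) [Field F],
    Computes F c (fun l : List F => entry i l) := by
  have : ∃ c : Code, ∀ (F : Type u) [Field F], Computes F c (fun l : List F => l.drop i) := by
    induction i with
    | zero =>
      apply Exists.intro
      intro F _
      exact .id
    | succ i ih =>
      apply Exists.intro
      intro F _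
      have := (ih.choose_spec F).tail
      simp only [List.tail_drop] at this
      exact this
  apply Exists.intro
  intro F _
  exact .comp (g := fun l : List F => l.headD 0) (f := fun l : List F => l.drop i)
    (exists_head.choose_spec F) (this.choose_spec F)

lemma exists_psmul : ∃ c : Code, ∀ (F : Type u) [Field F],
    Computes F c (fun x : F × List F => psmul x.1 x.2) := by
  apply Exists.intro
  intro F _
  exact .map (.snd .id) (.comp .mulF (.pair (.fst (.fst .id)) (.snd .id)))

/-- The loop behind `padd`. -/
lemma foldl_padd {F : Type u} [Field F] (p q acc : List F) :
    (p.foldl (fun st a => (st.1.tail, (a + st.1.headD 0) :: st.2)) (q, acc)).2.foldl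
      (fun l a => a :: l)
      (p.foldl (fun st a => (st.1.tail, (a + st.1.headD 0) :: st.2)) (q, acc)).1 =
    acc.reverse ++ padd p q := by
  induction p generalizing q acc with
  | nil => simp [padd]
  | cons a p ih =>
    cases q with
    | nil =>
      simp only [List.foldl_cons]
      rw [ih]
      cases p <;> simp [padd]
    | cons b q =>
      simp only [List.foldl_cons]
      rw [ih]
      simp [padd]

lemma exists_padd : ∃ c : Code, ∀ (F : Type u) [Field F],
    Computes F c (fun x : List F × List F => padd x.1 x.2) := by
  have : ∃ c : Code, ∀ (F : Type u) [Field F], Computes F c (fun x : List F × List F =>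
      x.1.foldl (fun (st : List F × List F) a => (st.1.tail, (a + st.1.headD 0) :: st.2))
        (x.2, [])) := by
    apply Exists.intro
    intro F _
    exact Computes.foldlAdd (s := fun (x : List F × List F) st a =>
        (st.1.tail, (a + st.1.headD 0) :: st.2)) (.fst .id) (.pair (.snd .id) .nil)
      (.pair (.tail (.fst (.fst (.snd .id)))) (.cons (.comp .addF (.pair (.snd (.snd .id))
        (.comp (exists_head.choose_spec F) (.fst (.fst (.snd .id))))))
        (.snd (.fst (.snd .id))))) 2
      (fun x st a _ => by
        rcases st with ⟨_ | ⟨b, t⟩, s⟩ <;> simp <;> omega)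
  apply Exists.intro
  intro F _
  have := Computes.comp (F := F) (g := fun st : List F × List F =>
      st.2.foldl (fun l a => a :: l) st.1)
    (.foldlAdd (s := fun _ l a => a :: l) (.snd .id) (.fst .id)
      (.cons (.snd (.snd .id)) (.fst (.snd .id))) 2 (fun x st a _ => by simp; omega))
    (this.choose_spec F)
  refine (congrArg (Computes F _) (funext fun x => ?_)).mp this
  exact foldl_padd x.1 x.2 []

lemma exists_pmul : ∃ c : Code, ∀ (F : Type u) [Field F],
    Computes F c (fun x : List F × List F => pmul x.1 x.2) := by
  apply Exists.intro
  intro F _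
  exact .foldrAdd (s := fun (x : List F × List F) acc a => padd (psmul a x.2) (0 :: acc))
    (.fst .id) .nil
    (.comp₂ (exists_padd.choose_spec F)
      (.comp₂ (exists_psmul.choose_spec F) (.snd (.snd .id)) (.snd (.fst .id)))
      (.cons .zero (.fst (.snd .id)))) (X + 2)
    (fun x st a _ => by simp [sz_poly]; omega)

lemma exists_frob : ∃ c : Code, ∀ (F : Type u) [Field F],
    Computes F c (fun x : List F × F => frob x.1 x.2) := by
  classical
  apply Exists.intro
  intro F _
  exact .foldrAdd (s := fun (x : List F × F) acc b =>
      if b = 0 then acc * acc else x.2 * (acc * acc))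
    (.fst .id) .one
    (.iteZero (.snd (.snd .id)) (.comp .mulF (.pair (.fst (.snd .id)) (.fst (.snd .id))))
      (.comp .mulF (.pair (.snd (.fst .id))
        (.comp .mulF (.pair (.fst (.snd .id)) (.fst (.snd .id)))))))
    0 (fun x st a _ => by simp)

lemma exists_plin : ∃ c : Code, ∀ (F : Type u) [Field F],
    Computes F c (fun x : (F × F) × List F => plin x.1.1 x.1.2 x.2) := by
  apply Exists.intro
  intro F _
  exact .comp₂ (exists_padd.choose_spec F)
    (.comp₂ (exists_psmul.choose_spec F) (.snd (.fst .id)) (.snd .id))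
    (.cons .zero (.comp₂ (exists_psmul.choose_spec F) (.fst (.fst .id)) (.snd .id)))

lemma exists_phom : ∃ c : Code, ∀ (F : Type u) [Field F],
    Computes F c (fun x : (List F × List F) × List F => phom x.1 x.2) := by
  apply Exists.intro
  intro F _
  exact .fst (.foldrDim (s := fun (x : (List F × List F) × List F) (st : List F × List F) a =>
      (padd (psmul (frob x.1.1 a) st.2) (plin (entry 0 x.1.2) (entry 1 x.1.2) st.1),
        plin (entry 2 x.1.2) (entry 3 x.1.2) st.2))
    (.snd .id) (.pair .nil (.cons .one .nil))
    (.pair (.comp₂ (exists_padd.choose_spec F)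
        (.comp₂ (exists_psmul.choose_spec F) (.comp₂ (exists_frob.choose_spec F)
          (.fst (.fst (.fst .id))) (.snd (.snd .id))) (.snd (.fst (.snd .id))))
        (.comp₂ (g := fun (y : F × F) (p : List F) => plin y.1 y.2 p)
          (exists_plin.choose_spec F) (.pair
            (.comp ((exists_entry 0).choose_spec F) (.snd (.fst (.fst .id))))
            (.comp ((exists_entry 1).choose_spec F) (.snd (.fst (.fst .id)))))
          (.fst (.fst (.snd .id)))))
      (.comp₂ (g := fun (y : F × F) (p : List F) => plin y.1 y.2 p)
          (exists_plin.choose_spec F) (.pair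
            (.comp ((exists_entry 2).choose_spec F) (.snd (.fst (.fst .id))))
            (.comp ((exists_entry 3).choose_spec F) (.snd (.fst (.fst .id)))))
          (.snd (.fst (.snd .id)))))
    (.prod (.list .base) (.list .base)) 1
    (fun x st a _ N _ h => by
      simp only [dim_pair_le, dim_poly_le, length_padd, length_psmul, length_plin] at *
      simp only [eval_one]
      omega))

end feasible

/-! ### The meaning of lists of coefficients -/

section semantics

variable {F : Type u} [Field F]

/-- The rational function given by a list of coefficients. -/
def pval (p : List F) : RatFunc F := algebraMap F[X] (RatFunc F) (polyOf p)

lemma polyOf_padd (p q : List F) : polyOf (padd p q) = polyOf p + polyOf q := by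
  induction p generalizing q with
  | nil => simp [padd, polyOf]
  | cons a p ih =>
    cases q with
    | nil => simp [padd, polyOf]
    | cons b q => simp [padd, polyOf, ih]; ring

lemma polyOf_psmul (a : F) (p : List F) : polyOf (psmul a p) = C a * polyOf p := by
  induction p with
  | nil => simp [psmul, polyOf]
  | cons b p ih =>
    simp only [psmul, List.map_cons, polyOf] at *
    rw [ih, C_mul]; ring

lemma polyOf_pmul (p q : List F) : polyOf (pmul p q) = polyOf p * polyOf q := by
  induction p with
  | nil => simp [pmul, polyOf]
  | cons b p ih =>
    simp only [pmul, List.foldr_cons, polyOf_padd, polyOf_psmul, polyOf, map_zero] at *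
    rw [ih]; ring

lemma polyOf_append (p q : List F) : polyOf (p ++ q) = polyOf p + X ^ p.length * polyOf q := by
  induction p with
  | nil => simp [polyOf]
  | cons b p ih => simp [polyOf, ih, pow_succ]; ring

@[simp] lemma polyOf_zeros {α : Type v} (l : List α) : polyOf (zeros l : List F) = 0 := by
  induction l with
  | nil => simp [polyOf, zeros]
  | cons b p ih => simp [polyOf, zeros] at *; simp [ih]

lemma coeff_polyOf (p : List F) (i : ℕ) : (polyOf p).coeff i = p.getD i 0 := by
  induction p generalizing i with
  | nil => simp [polyOf]
  | cons a p ih => cases i <;> simp [polyOf, ih, coeff_C]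

lemma polyOf_mem_degreeLT (p : List F) : polyOf p ∈ degreeLT F p.length := by
  rw [mem_degreeLT, degree_lt_iff_coeff_zero]
  intro i hi
  rw [coeff_polyOf, List.getD_eq_default _ _ hi]

@[simp] lemma pval_padd (p q : List F) : pval (padd p q) = pval p + pval q := by
  simp [pval, polyOf_padd]

@[simp] lemma pval_psmul (a : F) (p : List F) : pval (psmul a p) = RatFunc.C a * pval p := by
  simp [pval, polyOf_psmul]

@[simp] lemma pval_pmul (p q : List F) : pval (pmul p q) = pval p * pval q := by
  simp [pval, polyOf_pmul]

@[simp] lemma pval_nil : pval ([] : List F) = 0 := by simp [pval, polyOf]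

@[simp] lemma pval_cons (a : F) (p : List F) :
    pval (a :: p) = RatFunc.C a + RatFunc.X * pval p := by simp [pval, polyOf]

@[simp] lemma pval_plin (a b : F) (p : List F) :
    pval (plin a b p) = (RatFunc.C a * RatFunc.X + RatFunc.C b) * pval p := by
  simp [plin]; ring

lemma pval_eq_zero {p : List F} : pval p = 0 ↔ polyOf p = 0 := by
  simp [pval]

lemma frob_eq (l : List Bool) (x : F) :
    frob (l.map fun b => if b then 1 else 0) x = x ^ Nat.ofDigits 2 (l.map Bool.toNat) := by
  induction l with
  | nil => simp [frob]
  | cons b l ih =>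
    simp only [frob, List.map_cons, List.foldr_cons] at *
    rw [ih, Nat.ofDigits_cons]
    cases b <;> simp <;> ring

/-- The data `s` describe the automorphism `σ` of the field of rational functions. -/
structure IsAutData (s : List F × List F) (σ : RingAut (RatFunc F)) : Prop where
  const : ∀ x, σ (RatFunc.C x) = RatFunc.C (frob s.1 x)
  ne_zero : RatFunc.C (entry 2 s.2) * RatFunc.X + RatFunc.C (entry 3 s.2) ≠ (0 : RatFunc F)
  var : σ RatFunc.X * (RatFunc.C (entry 2 s.2) * RatFunc.X + RatFunc.C (entry 3 s.2)) =
    RatFunc.C (entry 0 s.2) * RatFunc.X + RatFunc.C (entry 1 s.2)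

variable {s : List F × List F} {σ : RingAut (RatFunc F)}

lemma IsAutData.phom (h : IsAutData s σ) (p : List F) :
    pval (phom s p) * (RatFunc.C (entry 2 s.2) * RatFunc.X + RatFunc.C (entry 3 s.2)) =
      σ (pval p) * (RatFunc.C (entry 2 s.2) * RatFunc.X + RatFunc.C (entry 3 s.2)) ^ p.length := by
  have h1 := h.var
  have h2 := h.const
  unfold SkewConstacyclic.phom
  revert h1
  generalize hw : (RatFunc.C (entry 2 s.2) * RatFunc.X + RatFunc.C (entry 3 s.2)) = w
  intro h1
  suffices H : ∀ q : List F × List F, q = p.foldr (fun x st => (padd (psmul (frob s.1 x) st.2)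
      (plin (entry 0 s.2) (entry 1 s.2) st.1),
      plin (entry 2 s.2) (entry 3 s.2) st.2)) (([], [1]) : List F × List F) →
      pval q.1 * w = σ (pval p) * w ^ p.length ∧ pval q.2 = w ^ p.length from (H _ rfl).1
  induction p with
  | nil => rintro q rfl; simp
  | cons a p ih =>
    rintro q rfl
    obtain ⟨h3, h4⟩ := ih _ rfl
    simp only [List.foldr_cons, pval_padd, pval_psmul, pval_plin, ← h1, h4, hw, pval_cons,
      map_add, map_mul, List.length_cons, h2]
    refine ⟨?_, by ring⟩
    linear_combination (σ RatFunc.X * w) * h3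

/-- The homogenised action agrees with the automorphism up to a factor that depends only on the
number of coefficients. -/
lemma IsAutData.exists_factor (h : IsAutData s σ) (L j : ℕ) : ∃ κ : RatFunc F, κ ≠ 0 ∧
    ∀ p : List F, p.length = L → pval ((SkewConstacyclic.phom s)^[j] p) =
      κ * (σ ^ j) (pval p) := by
  induction j with
  | zero => exact ⟨1, one_ne_zero, by simp⟩
  | succ j ih =>
    obtain ⟨κ, h0, hκ⟩ := ih
    refine ⟨_, mul_ne_zero (div_ne_zero (pow_ne_zero L h.ne_zero) h.ne_zero)
      ((map_ne_zero_iff σ σ.injective).2 h0), fun p hp => ?_⟩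
    have hlen : ((SkewConstacyclic.phom s)^[j] p).length = L := by
      clear hκ
      induction j with
      | zero => simpa
      | succ j ih => rw [Function.iterate_succ_apply', length_phom]; exact ih
    have h1 := h.phom ((SkewConstacyclic.phom s)^[j] p)
    rw [hlen, hκ p hp] at h1
    have h2 := h.ne_zero
    rw [Function.iterate_succ_apply', pow_succ', RingAut.mul_apply]
    rw [map_mul] at h1
    field_simp
    linear_combination h1

end semantics

/-! ### Iterates, counting and division in unary notation -/

/-- The list `[g^[N] i, ..., g^[2] i, g i]`, where `N` is the length of `l`. -/
def iters {α : Type v} {β : Type w} (g : α → α) (l : List β) (i : α) : List α :=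
  (l.foldl (fun st _ => (g st.1, g st.1 :: st.2)) (i, [])).2

/-- The unary representations of the numbers less than the length of `l`, in increasing order. -/
def upto {β : Type w} (l : List β) : List (List Unit) :=
  ((iters (List.cons ()) l []).map List.tail).reverse

/-- The length of a list, in unary notation. -/
def unary {β : Type w} (l : List β) : List Unit := l.map fun _ => ()

/-- Integer division in unary notation: the quotient is the number of times that `m` entries can
be removed from `() :: l` before this list is exhausted. -/
def udiv (l m : List Unit) : List Unit :=
  (l.foldl (fun (st : List Unit × List Unit) _ => (st.1.drop m.length,
    listElim (st.1.drop m.length) st.2 fun _ _ => () :: st.2)) (() :: l, [])).2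

lemma foldl_iters {α : Type v} {β : Type w} (g : α → α) (l : List β) (i : α) (acc : List α) :
    l.foldl (fun st _ => (g st.1, g st.1 :: st.2)) (i, acc) =
      (g^[l.length] i, ((List.range l.length).map fun j => g^[j + 1] i).reverse ++ acc) := by
  induction l generalizing i acc with
  | nil => simp
  | cons a l ih =>
    rw [List.foldl_cons, ih, List.length_cons, List.range_succ_eq_map]
    simp [Function.comp_def]

lemma iters_eq {α : Type v} {β : Type w} (g : α → α) (l : List β) (i : α) :
    iters g l i = ((List.range l.length).map fun j => g^[j + 1] i).reverse := by
  rw [iters, foldl_iters, List.append_nil]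

lemma upto_eq {β : Type w} (l : List β) :
    upto l = (List.range l.length).map fun j => List.replicate j () := by
  rw [upto, iters_eq, List.map_reverse, List.reverse_reverse, List.map_map]
  refine List.map_congr_left fun j hj => ?_
  clear hj
  simp only [Function.comp_apply, Function.iterate_succ_apply', List.tail_cons]
  induction j with
  | zero => rfl
  | succ j ih => rw [Function.iterate_succ_apply', ih, List.replicate_succ]

lemma length_udiv_aux (m l L acc : List Unit) (hm : 0 < m.length) :
    (l.foldl (fun (st : List Unit × List Unit) _ => (st.1.drop m.length,
      listElim (st.1.drop m.length) st.2 fun _ _ => () :: st.2)) (L, acc)).2.length =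
      acc.length + min l.length ((L.length - 1) / m.length) := by
  induction l generalizing L acc with
  | nil => simp
  | cons a l ih =>
    rw [List.foldl_cons, ih]
    rcases h : L.drop m.length with _ | ⟨b, t⟩
    · have h1 : L.length ≤ m.length := by simpa using h
      have h2 : (L.length - 1) / m.length = 0 := Nat.div_eq_of_lt (by omega)
      simp [h2]
    · have h1 : m.length < L.length := by
        by_contra h2
        rw [List.drop_eq_nil_of_le (by omega)] at h
        simp at h
      have h2 : (b :: t).length = L.length - m.length := by rw [← h, List.length_drop]
      have h3 : (L.length - 1) / m.length = (L.length - m.length - 1) / m.length + 1 := by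
        rw [Nat.div_eq_sub_div hm (by omega)]
        congr 2; omega
      rw [listElim_cons, h2, h3]
      simp only [List.length_cons]; omega

lemma length_udiv (l m : List Unit) (hm : 0 < m.length) :
    (udiv l m).length = l.length / m.length := by
  rw [udiv, length_udiv_aux m l _ _ hm]
  have := Nat.div_le_self l.length m.length
  simpa using this

section rules

variable {F : Type u} [Field F] {α : Type v} {β : Type w} {γ : Type z} [Enc F α] [Enc F β]
  [Enc F γ] {c d e : Code}

/-- The code of `iters`. -/
def Code.iters (c d e : Code) (b Q : ℕ[X]) : Code :=
  Code.comp ⟨.instr .snd, X + 2⟩ (c.foldDim (d.pair ⟨.instr .nil, X + 2⟩)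
    ((e.comp (Code.pair (Code.comp ⟨.instr .fst, X + 2⟩ ⟨.skip, X + 1⟩)
      (Code.comp ⟨.instr .fst, X + 2⟩ (Code.comp ⟨.instr .fst, X + 2⟩
        (Code.comp ⟨.instr .snd, X + 2⟩ ⟨.skip, X + 1⟩))))).pair
    ((e.comp (Code.pair (Code.comp ⟨.instr .fst, X + 2⟩ ⟨.skip, X + 1⟩)
      (Code.comp ⟨.instr .fst, X + 2⟩ (Code.comp ⟨.instr .fst, X + 2⟩
        (Code.comp ⟨.instr .snd, X + 2⟩ ⟨.skip, X + 1⟩))))).pair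
      (Code.comp ⟨.instr .snd, X + 2⟩ (Code.comp ⟨.instr .fst, X + 2⟩
        (Code.comp ⟨.instr .snd, X + 2⟩ ⟨.skip, X + 1⟩)))))
    (1 + b + (1 + X * (1 + b))) (Q + 1))

lemma Computes.iters {l : α → List γ} {i : α → β} {g : α → β → β}
    (hl : Computes F c l) (hi : Computes F d i)
    (hg : Computes F e (fun y : α × β => g y.1 y.2)) {b : ℕ[X]} (hb : SizeBound F β b) (Q : ℕ[X])
    (hQ : ∀ x st N, sz F x ≤ N → dim F st ≤ N → dim F (g x st) ≤ N + Q.eval (sz F x)) :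
    Computes F (c.iters d e b Q) (fun x => iters (g x) (l x) (i x)) := by
  refine .snd (.foldlDim (s := fun x st _ => (g x st.1, g x st.1 :: st.2)) hl (.pair hi .nil)
    (.pair (.comp₂ hg (.fst .id) (.fst (.fst (.snd .id))))
      (.cons (.comp₂ hg (.fst .id) (.fst (.fst (.snd .id)))) (.snd (.fst (.snd .id)))))
    (.prod hb (.list hb)) (Q + 1) fun x st a _ N hN h => ?_)
  rw [dim_pair_le, dim_list_le] at h
  have := hQ x st.1 N hN h.1
  simp only [dim_pair_le, dim_list_le, List.length_cons, List.mem_cons, eval_add, eval_one]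
  refine ⟨by omega, by omega, ?_⟩
  rintro a (rfl | ha)
  · omega
  · have := h.2.2 a ha; omega

end rules

lemma exists_unary : ∃ c : Code, ∀ (F : Type u) [Field F] (α : Type v) [Enc F α],
    Computes F c (fun l : List α => unary l) := by
  apply Exists.intro
  intro F _ α _
  exact .map .id .unit

lemma exists_upto : ∃ c : Code, ∀ (F : Type u) [Field F],
    Computes F c (fun l : List Unit => upto l) := by
  apply Exists.intro
  intro F _
  refine .reverse (.map (.iters (g := fun _ l => () :: l) .id .nil (.cons .unit (.snd .id))
    (.list .unit) 1 (fun x st N _ h => ?_)) (.tail (.snd .id)))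
  simp only [dim_list_le, List.length_cons, dim_unit, eval_one] at *
  exact ⟨by omega, by simp⟩

lemma exists_udiv : ∃ c : Code, ∀ (F : Type u) [Field F],
    Computes F c (fun x : List Unit × List Unit => udiv x.1 x.2) := by
  apply Exists.intro
  intro F _
  have key : ∀ m (L : List Unit), sz F (L.drop m) ≤ sz F L := by
    intro m
    induction m with
    | zero => simp
    | succ m ih =>
      intro L
      cases L with
      | nil => simp
      | cons a L => have := ih L; simp; omega
  exact .snd (.foldlAdd (s := fun (x : List Unit × List Unit) (st : List Unit × List Unit) _ =>
      (st.1.drop x.2.length,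
        listElim (st.1.drop x.2.length) st.2 fun _ _ => () :: st.2))
    (.fst .id) (.pair (.cons .unit (.fst .id)) .nil)
    (.pair (.drop (.snd (.fst .id)) (.fst (.fst (.snd .id))))
      (.listCase (.drop (.snd (.fst .id)) (.fst (.fst (.snd .id)))) (.snd (.fst (.snd .id)))
        (.cons .unit (.snd (.fst (.snd (.fst .id))))))) 2
    (fun x st a _ => by
      have := key x.2.length st.1
      have : sz F (listElim (st.1.drop x.2.length) st.2 fun _ _ => () :: st.2) ≤
          sz F st.2 + 2 := by
        cases st.1.drop x.2.length <;> simp; omega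
      simp only [sz_pair, eval_ofNat]; omega))

/-! ### Rational functions and vectors of rational functions -/

section defs

variable {F : Type u} [Field F]

/-- Sum of fractions. -/
def fadd (x y : List F × List F) : List F × List F :=
  (padd (pmul x.1 y.2) (pmul y.1 x.2), pmul x.2 y.2)

/-- Product of fractions. -/
def fmul (x y : List F × List F) : List F × List F := (pmul x.1 y.1, pmul x.2 y.2)

/-- The same fraction, with as many entries in the numerator as in the denominator. -/
def fpad (x : List F × List F) : List F × List F := (x.1 ++ zeros x.2, x.2 ++ zeros x.1)

/-- The automorphism with data `s`, applied to a fraction whose numerator and denominator have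
the same number of entries. -/
def fhom (s x : List F × List F) : List F × List F := (phom s x.1, phom s x.2)

/-- The `m`-th power of the automorphism with data `s`, applied to a polynomial. -/
def ptwist (s : (List F × List F) × List Unit) (p : List F) : List F :=
  s.2.foldl (fun p _ => phom s.1 p) p

/-- The `m`-th power of the automorphism with data `s`, applied to a fraction. -/
def ftwist (s : (List F × List F) × List Unit) (x : List F × List F) : List F × List F :=
  (ptwist s x.1, ptwist s x.2)

/-- Left multiplication by `x` on elements of the algebra. -/
def xmul (s lam : List F × List F) (v : List (List F × List F)) : List (List F × List F) :=
  listElim v.reverse [] fun a t => fmul lam (fhom s a) :: t.reverse.map (fhom s)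

/-- Sum of vectors. -/
def vsum (i : List (List F × List F)) (l : List (List (List F × List F))) :
    List (List F × List F) :=
  l.foldl (fun acc v => (acc.zip v).map fun y => fadd y.1 y.2) i

/-- The product `f * e` in the algebra. -/
def amul (s lam : List F × List F) (e f : List (List F × List F)) : List (List F × List F) :=
  vsum (e.map fun _ => ([0], [1])) ((f.zip (e :: (iters (xmul s lam) f e).reverse)).map
    fun y => y.2.map (fmul y.1))

end defs

section feasible

lemma exists_fadd : ∃ c : Code, ∀ (F : Type u) [Field F],
    Computes F c (fun x : (List F × List F) × (List F × List F) => fadd x.1 x.2) := by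
  apply Exists.intro
  intro F _
  exact .pair (.comp₂ (exists_padd.choose_spec F)
      (.comp₂ (exists_pmul.choose_spec F) (.fst (.fst .id)) (.snd (.snd .id)))
      (.comp₂ (exists_pmul.choose_spec F) (.fst (.snd .id)) (.snd (.fst .id))))
    (.comp₂ (exists_pmul.choose_spec F) (.snd (.fst .id)) (.snd (.snd .id)))

lemma exists_fmul : ∃ c : Code, ∀ (F : Type u) [Field F],
    Computes F c (fun x : (List F × List F) × (List F × List F) => fmul x.1 x.2) := by
  apply Exists.intro
  intro F _
  exact .pair (.comp₂ (exists_pmul.choose_spec F) (.fst (.fst .id)) (.fst (.snd .id)))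
      (.comp₂ (exists_pmul.choose_spec F) (.snd (.fst .id)) (.snd (.snd .id)))

lemma exists_fpad : ∃ c : Code, ∀ (F : Type u) [Field F],
    Computes F c (fun x : List F × List F => fpad x) := by
  apply Exists.intro
  intro F _
  exact .pair (.append (.fst .id) (.comp (exists_zeros.choose_spec F F) (.snd .id)))
    (.append (.snd .id) (.comp (exists_zeros.choose_spec F F) (.fst .id)))

lemma exists_fhom : ∃ c : Code, ∀ (F : Type u) [Field F],
    Computes F c (fun x : (List F × List F) × (List F × List F) => fhom x.1 x.2) := by
  apply Exists.intro
  intro F _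
  exact .pair (.comp₂ (exists_phom.choose_spec F) (.fst .id) (.fst (.snd .id)))
    (.comp₂ (exists_phom.choose_spec F) (.fst .id) (.snd (.snd .id)))

lemma exists_ptwist : ∃ c : Code, ∀ (F : Type u) [Field F],
    Computes F c (fun x : ((List F × List F) × List Unit) × List F => ptwist x.1 x.2) := by
  apply Exists.intro
  intro F _
  exact .foldlDim (s := fun (x : ((List F × List F) × List Unit) × List F) p _ => phom x.1.1 p)
    (.snd (.fst .id)) (.snd .id)
    (.comp₂ (exists_phom.choose_spec F) (.fst (.fst (.fst .id))) (.fst (.snd .id)))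
    (.list .base) 0 (fun x st a _ N _ h => by simpa [dim_poly_le] using h)

lemma exists_ftwist : ∃ c : Code, ∀ (F : Type u) [Field F],
    Computes F c (fun x : ((List F × List F) × List Unit) × (List F × List F) =>
      ftwist x.1 x.2) := by
  apply Exists.intro
  intro F _
  exact .pair (.comp₂ (exists_ptwist.choose_spec F) (.fst .id) (.fst (.snd .id)))
    (.comp₂ (exists_ptwist.choose_spec F) (.fst .id) (.snd (.snd .id)))

lemma exists_xmul : ∃ c : Code, ∀ (F : Type u) [Field F],
    Computes F c (fun x : ((List F × List F) × (List F × List F)) × List (List F × List F) =>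
      xmul x.1.1 x.1.2 x.2) := by
  apply Exists.intro
  intro F _
  exact .listCase
    (g := fun (x : ((List F × List F) × (List F × List F)) × List (List F × List F)) a t =>
      fmul x.1.2 (fhom x.1.1 a) :: t.reverse.map (fhom x.1.1))
    (.reverse (.snd .id)) .nil
    (.cons (.comp₂ (exists_fmul.choose_spec F) (.snd (.fst (.fst .id)))
        (.comp₂ (exists_fhom.choose_spec F) (.fst (.fst (.fst .id))) (.fst (.snd .id))))
      (.map (.reverse (.snd (.snd .id)))
        (.comp₂ (exists_fhom.choose_spec F) (.fst (.fst (.fst (.fst .id)))) (.snd .id))))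

lemma dim_xmul_le {F : Type u} [Field F] (s lam : List F × List F) (v : List (List F × List F))
    (N : ℕ) (h : dim F v ≤ N) : dim F (xmul s lam v) ≤ N + sz F lam := by
  unfold xmul
  rw [← List.reverse_reverse v] at h
  revert h
  generalize v.reverse = l
  intro h
  simp only [sz_pair, sz_poly]
  cases l with
  | nil => simp [dim_list_le]
  | cons a t =>
    rw [listElim_cons]
    simp only [List.reverse_cons, dim_list_le, dim_pair_le, List.mem_append,
      List.length_append, List.length_cons, List.length_map, List.mem_cons, List.mem_map, dim_base,
      List.length_reverse, Nat.zero_le, implies_true, and_true, List.length_nil] at h ⊢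
    refine ⟨by omega, ?_⟩
    have h1 := h.2 a (by simp)
    rintro b (rfl | ⟨b, hb, rfl⟩)
    · have h2 := length_pmul_le lam.1 (fhom s a).1
      have h3 := length_pmul_le lam.2 (fhom s a).2
      simp only [fmul, fhom, length_phom] at *
      omega
    · have := h.2 b (by simpa using Or.inl hb)
      simp only [fhom, length_phom]
      omega

lemma length_fadd_le {F : Type u} [Field F] {x y : List F × List F} {N M : ℕ}
    (hx : dim F x ≤ N) (hy : dim F y ≤ M) : dim F (fadd x y) ≤ N + M := by
  have h1 := length_pmul_le x.1 y.2
  have h2 := length_pmul_le y.1 x.2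
  have h3 := length_pmul_le x.2 y.2
  simp only [dim_pair_le, dim_poly_le, fadd, length_padd] at *
  omega

lemma exists_vsum : ∃ c : Code, ∀ (F : Type u) [Field F],
    Computes F c (fun x : List (List F × List F) × List (List (List F × List F)) =>
      vsum x.1 x.2) := by
  apply Exists.intro
  intro F _
  refine .foldlDim (s := fun (x : List (List F × List F) × List (List (List F × List F)))
      (acc : List (List F × List F)) v => (acc.zip v).map fun y => fadd y.1 y.2)
    (.snd .id) (.fst .id) (.map (.zip (.fst (.snd .id)) (.snd (.snd .id)))
      (.comp (exists_fadd.choose_spec F) (.snd .id)))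
    (.list (.prod (.list .base) (.list .base))) X (fun x st a ha N _ h => ?_)
  have h1 : dim F a ≤ sz F x :=
    (dim_le_sz a).trans ((sz_mem ha).trans (by simp only [sz_pair]; omega))
  rw [dim_list_le] at h h1 ⊢
  simp only [List.length_map, List.length_zip, eval_X]
  refine ⟨by omega, fun y hy => ?_⟩
  obtain ⟨⟨p, q⟩, hpq, rfl⟩ := List.mem_map.1 hy
  obtain ⟨hp, hq⟩ := List.of_mem_zip hpq
  exact length_fadd_le (h.2 p hp) (h1.2 q hq)

lemma exists_amul : ∃ c : Code, ∀ (F : Type u) [Field F],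
    Computes F c (fun x : ((List F × List F) × (List F × List F)) ×
      (List (List F × List F) × List (List F × List F)) =>
      amul x.1.1 x.1.2 x.2.1 x.2.2) := by
  apply Exists.intro
  intro F _
  refine .comp₂ (exists_vsum.choose_spec F)
    (.map (.fst (.snd .id)) (.pair (.cons .zero .nil) (.cons .one .nil)))
    (.map (.zip (.snd (.snd .id)) (.cons (.fst (.snd .id)) (.reverse
      (.iters (g := fun (x : ((List F × List F) × (List F × List F)) ×
        (List (List F × List F) × List (List F × List F))) v => xmul x.1.1 x.1.2 v)
        (.snd (.snd .id)) (.fst (.snd .id))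
        (.comp₂ (g := fun (y : (List F × List F) × (List F × List F))
            (v : List (List F × List F)) => xmul y.1 y.2 v)
          (exists_xmul.choose_spec F) (.fst (.fst .id)) (.snd .id))
        (.list (.prod (.list .base) (.list .base))) X (fun x st N _ h => ?_)))))
      (.map (.snd (.snd .id)) (.comp₂ (exists_fmul.choose_spec F) (.fst (.snd (.fst .id)))
        (.snd .id))))
  refine (dim_xmul_le _ _ _ N h).trans ?_
  simp only [sz_pair, eval_X]; omega

end feasible

/-! ### The table of syndromes and the extension of sequences -/

section defs

variable {F : Type u} [Field F]

/-- The columns of a matrix with as many columns as the length of `e`. -/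
def transp (e : List (List F × List F)) (l : List (List (List F × List F))) :
    List (List (List F × List F)) :=
  l.foldr (fun v acc => (v.zip acc).map fun y => y.1 :: y.2) (e.map fun _ => [])

/-- A list of fractions, written with a common denominator. -/
def fcommon (l : List (List F × List F)) : List (List F) × List F :=
  l.foldr (fun x st => (pmul x.1 st.2 :: st.1.map (pmul x.2), pmul x.2 st.2)) ([], [1])

/-- Padding of polynomials to the same number of entries. -/
def padAll (l : List (List F)) : List (List F) := l.map fun p => padd p (zeros l.flatten)

/-- The blocks `p₀, θ p₁, θ² p₂, ...`. -/
def blocks (s : (List F × List F) × List Unit) (l : List (List F)) : List (List F) :=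
  l.foldr (fun y acc => y :: acc.map (ptwist s)) []

/-- Concatenation of polynomials, each one filled up to the length of `W`. -/
def pack (W : List Unit) (l : List (List F)) : List F :=
  l.foldr (fun y acc => padd y (zeros W ++ acc)) []

/-- The next term of a sequence with a linear recurrence. The state is a common denominator, the
numerators of the terms (the last one first) and the fractions that were already found. -/
def extStep (st : List F × List (List F) × List (List F × List F)) (G : List (List F)) :
    List F × List (List F) × List (List F × List F) :=
  listElim G st fun g gs =>
    (pmul g st.1,
      psmul (-1) (((gs.zip st.2.1).map fun y => pmul y.1 y.2).foldl padd []) ::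
        st.2.1.map (pmul g),
      (psmul (-1) (((gs.zip st.2.1).map fun y => pmul y.1 y.2).foldl padd []), pmul g st.1) ::
        st.2.2)

/-- The terms of a sequence, the last one first, given by previous terms `t.1` with denominator
`t.2` and by recurrences `G`, one for each new term. -/
def extSeq (G : List (List (List F))) (t : List (List F) × List F) : List (List F × List F) :=
  (G.foldl extStep (t.2, t.1, [])).2.2

/-- The sum `θ^(N-1) f₁ + ... + θ f_(N-1) + f_N`. -/
def twistSum (s : (List F × List F) × List Unit) (l : List (List F × List F)) :
    List F × List F :=
  l.foldl (fun acc x => fadd (ftwist s acc) (fpad x)) ([0], [1])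

end defs

lemma dim_ptwist {F : Type u} [Field F] (s : (List F × List F) × List Unit) (p : List F) :
    (ptwist s p).length = p.length := by
  unfold ptwist
  generalize s.2 = m
  induction m generalizing p with
  | nil => simp
  | cons a m ih => rw [List.foldl_cons, ih, length_phom]

lemma length_psum_le {F : Type u} [Field F] (l : List (List F)) (N : ℕ)
    (h : ∀ p ∈ l, p.length ≤ N) : (l.foldl padd []).length ≤ N := by
  have : ∀ acc : List F, acc.length ≤ N → (l.foldl padd acc).length ≤ N := by
    induction l with
    | nil => simp
    | cons p l ih =>
      intro acc hacc
      have := h p (by simp)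
      exact ih (fun q hq => h q (by simp [hq])) _ (by simp; omega)
  exact this _ (by simp)

section feasible

lemma exists_transp : ∃ c : Code, ∀ (F : Type u) [Field F],
    Computes F c (fun x : List (List F × List F) × List (List (List F × List F)) =>
      transp x.1 x.2) := by
  apply Exists.intro
  intro F _
  refine .foldrDim (s := fun (x : List (List F × List F) × List (List (List F × List F)))
      (acc : List (List (List F × List F))) v => (v.zip acc).map fun y => y.1 :: y.2)
    (.snd .id) (.map (f := fun _ _ => []) (.fst .id) .nil) (.map (.zip (.snd (.snd .id)) (.fst (.snd .id)))
      (.cons (.fst (.snd .id)) (.snd (.snd .id))))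
    (.list (.list (.prod (.list .base) (.list .base)))) 1 (fun x st a ha N hN h => ?_)
  have h1 : dim F a ≤ sz F x :=
    (dim_le_sz a).trans ((sz_mem ha).trans (by simp only [sz_pair]; omega))
  rw [dim_list_le] at h h1 ⊢
  simp only [List.length_map, List.length_zip, eval_one]
  refine ⟨by omega, fun y hy => ?_⟩
  obtain ⟨⟨p, q⟩, hpq, rfl⟩ := List.mem_map.1 hy
  obtain ⟨hp, hq⟩ := List.of_mem_zip hpq
  have h2 := h1.2 p hp
  have h3 := h.2 q hq
  rw [dim_list_le] at h3 ⊢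
  simp only [List.length_cons, List.mem_cons]
  refine ⟨by omega, ?_⟩
  rintro b (rfl | hb)
  · omega
  · have := h3.2 b hb; omega

lemma exists_fcommon : ∃ c : Code, ∀ (F : Type u) [Field F],
    Computes F c (fun x : List (List F × List F) => fcommon x) := by
  apply Exists.intro
  intro F _
  refine .foldrDim (s := fun (_ : List (List F × List F)) (st : List (List F) × List F)
      (x : List F × List F) => (pmul x.1 st.2 :: st.1.map (pmul x.2), pmul x.2 st.2))
    .id (.pair .nil (.cons .one .nil))
    (.pair (.cons (.comp₂ (exists_pmul.choose_spec F) (.fst (.snd (.snd .id)))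
        (.snd (.fst (.snd .id)))) (.map (.fst (.fst (.snd .id)))
          (.comp₂ (exists_pmul.choose_spec F) (.snd (.snd (.snd (.fst .id)))) (.snd .id))))
      (.comp₂ (exists_pmul.choose_spec F) (.snd (.snd (.snd .id)))
        (.snd (.fst (.snd .id)))))
    (.prod (.list (.list .base)) (.list .base)) (X + 1) (fun x st a ha N hN h => ?_)
  have h1 : dim F a ≤ sz F x := (dim_le_sz a).trans (sz_mem ha)
  simp only [dim_pair_le, dim_list_le, dim_base, Nat.zero_le, implies_true, and_true,
    List.length_cons, List.mem_cons, List.length_map, List.mem_map, eval_add, eval_X,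
    eval_one] at h h1 ⊢
  have h2 := length_pmul_le a.1 st.2
  have h3 := length_pmul_le a.2 st.2
  refine ⟨⟨by omega, ?_⟩, by omega⟩
  rintro b (rfl | ⟨b, hb, rfl⟩)
  · omega
  · have := h.1.2 b hb
    have := length_pmul_le a.2 b
    omega

lemma exists_padAll : ∃ c : Code, ∀ (F : Type u) [Field F],
    Computes F c (fun x : List (List F) => padAll x) := by
  apply Exists.intro
  intro F _
  exact .map .id (.comp₂ (exists_padd.choose_spec F) (.snd .id)
    (.comp (exists_zeros.choose_spec F F) (.flatten (.fst .id))))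

lemma exists_blocks : ∃ c : Code, ∀ (F : Type u) [Field F],
    Computes F c (fun x : ((List F × List F) × List Unit) × List (List F) =>
      blocks x.1 x.2) := by
  apply Exists.intro
  intro F _
  refine .foldrDim (s := fun (x : ((List F × List F) × List Unit) × List (List F))
      (acc : List (List F)) (y : List F) => y :: acc.map (ptwist x.1))
    (.snd .id) .nil
    (.cons (.snd (.snd .id)) (.map (.fst (.snd .id))
      (.comp₂ (exists_ptwist.choose_spec F) (.fst (.fst (.fst .id))) (.snd .id))))
    (.list (.list .base)) 1 (fun x st a ha N hN h => ?_)
  have h1 : dim F a ≤ sz F x :=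
    (dim_le_sz a).trans ((sz_mem ha).trans (by simp only [sz_pair]; omega))
  simp only [dim_list_le, dim_base, Nat.zero_le, implies_true, and_true,
    List.length_cons, List.mem_cons, List.length_map, List.mem_map, eval_one] at h h1 ⊢
  refine ⟨by omega, ?_⟩
  rintro b (rfl | ⟨b, hb, rfl⟩)
  · omega
  · have := h.2 b hb
    rw [dim_ptwist]; omega

lemma exists_pack : ∃ c : Code, ∀ (F : Type u) [Field F],
    Computes F c (fun x : List Unit × List (List F) => pack x.1 x.2) := by
  apply Exists.intro
  intro F _
  refine .foldrDim (s := fun (x : List Unit × List (List F)) (acc y : List F) =>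
      padd y (zeros x.1 ++ acc)) (.snd .id) .nil
    (.comp₂ (exists_padd.choose_spec F) (.snd (.snd .id))
      (.append (.comp (exists_zeros.choose_spec F Unit) (.fst (.fst .id))) (.fst (.snd .id))))
    (.list .base) X (fun x st a ha N hN h => ?_)
  have h1 : dim F a ≤ sz F x :=
    (dim_le_sz a).trans ((sz_mem ha).trans (by simp only [sz_pair]; omega))
  have h2 := length_lt_sz (F := F) x.1
  simp only [dim_poly_le, length_padd, List.length_append, length_zeros, eval_X,
    sz_pair] at h h1 ⊢
  omega

lemma exists_extStep : ∃ c : Code, ∀ (F : Type u) [Field F],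
    Computes F c (fun x : (List F × List (List F) × List (List F × List F)) × List (List F) =>
      extStep x.1 x.2) := by
  have hsum : ∃ c : Code, ∀ (F : Type u) [Field F], Computes F c
      (fun x : List (List F) => x.foldl padd []) := by
    apply Exists.intro
    intro F _
    exact .foldlAdd (s := fun _ acc p => padd acc p) .id .nil
      (.comp₂ (exists_padd.choose_spec F) (.fst (.snd .id)) (.snd (.snd .id))) X
      (fun x st a ha => by
        have := sz_mem (F := F) ha
        simp only [sz_poly, length_padd, eval_X] at *; omega)
  have hnew : ∃ c : Code, ∀ (F : Type u) [Field F], Computes F c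
      (fun x : List (List F) × List (List F) =>
        psmul (-1) (((x.1.zip x.2).map fun y => pmul y.1 y.2).foldl padd [])) := by
    apply Exists.intro
    intro F _
    exact .comp₂ (exists_psmul.choose_spec F) (.comp (g := fun x : F => -x) .negF .one)
      (.comp (hsum.choose_spec F) (.map (.zip (.fst .id) (.snd .id))
        (.comp (exists_pmul.choose_spec F) (.snd .id))))
  have hnew' : ∀ (F : Type u) [Field F] (α : Type u) [Enc F α] {c d : Code}
      {f g : α → List (List F)}, Computes F c f → Computes F d g →
      Computes F (hnew.choose.comp (c.pair d)) (fun x =>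
        psmul (-1) ((((f x).zip (g x)).map fun y => pmul y.1 y.2).foldl padd [])) :=
    fun F _ α _ {c d f g} hf hg => .comp₂ (g := fun gs ys : List (List F) =>
      psmul (-1) (((gs.zip ys).map fun y => pmul y.1 y.2).foldl padd []))
      (hnew.choose_spec F) hf hg
  apply Exists.intro
  intro F _
  have := Computes.listCase (F := F)
    (l := fun x : (List F × List (List F) × List (List F × List F)) × List (List F) => x.2)
    (f := fun x => x.1)
    (g := fun x g gs => (pmul g x.1.1,
      psmul (-1) (((gs.zip x.1.2.1).map fun y => pmul y.1 y.2).foldl padd []) ::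
        x.1.2.1.map (pmul g),
      (psmul (-1) (((gs.zip x.1.2.1).map fun y => pmul y.1 y.2).foldl padd []),
        pmul g x.1.1) :: x.1.2.2))
    (.snd .id) (.fst .id)
    (.pair (.comp₂ (exists_pmul.choose_spec F) (.fst (.snd .id)) (.fst (.fst (.fst .id))))
      (.pair (.cons (hnew' F _ (.snd (.snd .id)) (.fst (.snd (.fst (.fst .id)))))
          (.map (.fst (.snd (.fst (.fst .id))))
            (.comp₂ (exists_pmul.choose_spec F) (.fst (.snd (.fst .id))) (.snd .id))))
        (.cons (.pair (hnew' F _ (.snd (.snd .id)) (.fst (.snd (.fst (.fst .id)))))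
          (.comp₂ (exists_pmul.choose_spec F) (.fst (.snd .id)) (.fst (.fst (.fst .id)))))
          (.snd (.snd (.fst (.fst .id)))))))
  exact this

lemma exists_extSeq : ∃ c : Code, ∀ (F : Type u) [Field F],
    Computes F c (fun x : List (List (List F)) × (List (List F) × List F) =>
      extSeq x.1 x.2) := by
  apply Exists.intro
  intro F _
  refine .snd (.snd (.foldlDim (s := fun (_ : List (List (List F)) × (List (List F) × List F))
      (st : List F × List (List F) × List (List F × List F)) (G : List (List F)) => extStep st G)
    (.fst .id) (.pair (.snd (.snd .id)) (.pair (.fst (.snd .id)) .nil))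
    (.comp₂ (exists_extStep.choose_spec F) (.fst (.snd .id)) (.snd (.snd .id)))
    (.prod (.list .base) (.prod (.list (.list .base)) (.list (.prod (.list .base) (.list .base)))))
    (X + 1) (fun x st a ha N hN h => ?_)))
  have h1 : dim F a ≤ sz F x :=
    (dim_le_sz a).trans ((sz_mem ha).trans (by simp only [sz_pair]; omega))
  cases a with
  | nil => simp only [extStep, listElim_nil]; omega
  | cons g gs =>
    simp only [dim_pair_le, dim_list_le, dim_base, Nat.zero_le, implies_true, and_true,
      List.length_cons, List.mem_cons, List.length_map, List.mem_map, eval_add, eval_X,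
      eval_one, extStep, listElim_cons] at h h1 ⊢
    have h2 := length_pmul_le g st.1
    have h3 := h1.2 g (by simp)
    have h4 := length_psum_le (((gs.zip st.2.1).map fun y => pmul y.1 y.2)) (N + sz F x)
      (fun p hp => by
        obtain ⟨y, hy, rfl⟩ := List.mem_map.1 hp
        obtain ⟨hp, hq⟩ := List.of_mem_zip hy
        have := length_pmul_le y.1 y.2
        have := h1.2 _ (Or.inr hp)
        have := h.2.1.2 _ hq
        omega)
    refine ⟨by omega, ⟨by omega, ?_⟩, by omega, ?_⟩
    · rintro b (rfl | ⟨b, hb, rfl⟩)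
      · simp only [length_psmul]; omega
      · have := h.2.1.2 b hb
        have := length_pmul_le g b
        omega
    · rintro b (rfl | hb)
      · simp only [length_psmul]; omega
      · have := h.2.2.2 b hb; omega

lemma exists_twistSum : ∃ c : Code, ∀ (F : Type u) [Field F],
    Computes F c (fun x : ((List F × List F) × List Unit) × List (List F × List F) =>
      twistSum x.1 x.2) := by
  apply Exists.intro
  intro F _
  refine .foldlDim (s := fun (x : ((List F × List F) × List Unit) × List (List F × List F))
      (acc y : List F × List F) => fadd (ftwist x.1 acc) (fpad y)) (.snd .id)
    (.pair (.cons .zero .nil) (.cons .one .nil))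
    (.comp₂ (exists_fadd.choose_spec F)
      (.comp₂ (exists_ftwist.choose_spec F) (.fst (.fst .id)) (.fst (.snd .id)))
      (.comp (exists_fpad.choose_spec F) (.snd (.snd .id))))
    (.prod (.list .base) (.list .base)) X (fun x st a ha N hN h => ?_)
  have h1 : sz F a ≤ sz F x := ((sz_mem ha).trans (by simp only [sz_pair]; omega))
  rw [eval_X]
  refine length_fadd_le ?_ ?_
  · simpa only [dim_pair_le, dim_poly_le, ftwist, dim_ptwist] using h
  · simp only [dim_pair_le, dim_poly_le, fpad, List.length_append, length_zeros, sz_pair,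
      sz_poly] at *
    omega

end feasible

/-! ### Linear relations between polynomials -/

section defs

variable {F : Type u} [Field F]

open Classical in
/-- A nonzero constant if the polynomial is nonzero, and zero otherwise. -/
def pflag (p : List F) : F := p.foldl (fun acc a => if a = 0 then acc else 1) 0

open Classical in
/-- A member of a list of polynomials with nonzero constant coefficient, if there is one. -/
def pivot (B : List (List F)) : List F :=
  B.foldl (fun acc q => if q.headD 0 = 0 then acc else q) []

open Classical in
/-- A nonzero member of a list of polynomials, if there is one. -/
def pick (B : List (List F)) : List F :=
  B.foldl (fun acc q => if pflag q = 0 then acc else q) []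

/-- One step of Gaussian elimination: from generators of a space `V` of polynomials, generators
of the space of all `p` with `t p ∈ V`. -/
def elimStep (B : List (List F)) : List (List F) :=
  B.map fun q => (padd q (psmul (-(q.headD 0) * ((pivot B).headD 0)⁻¹) (pivot B))).tail

/-- The polynomials `C + t ^ (Z + j D)`, multiplied by all `t ^ i` with `i < D`; the numbers are
the lengths of the lists `Z`, `j`, `D`. -/
def shifts (Z D j : List Unit) (C : List F) : List (List F) :=
  (upto D).map fun i => zeros i ++
    padd C (zeros (Z ++ (j.map fun _ => D).flatten) ++ [1])

/-- The `j`-th block of coefficients, each of the length of `D`. -/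
def chunk (D j : List Unit) (p : List F) : List F :=
  (D.zip (p.drop (j.map fun _ => D).flatten.length ++ zeros D)).map Prod.snd

/-- Coefficients `Γ₀, Γ₁, ...`, each with as many entries as `D`, of a linear relation between
the polynomials `C`. -/
def relation (D : List Unit) (C : List (List F)) : List (List F) :=
  (upto C).map fun j => chunk D j (pick ((D ++ unary C.flatten).foldl (fun B _ => elimStep B)
    (((upto C).zip C).map fun y => shifts (D ++ unary C.flatten) D y.1 y.2).flatten))

/-! ### The decoder -/

/-- The numerators and the denominators of the coordinates of the syndromes. -/
def syndromes (s : (List F × List F) × List Unit) (lam : List F × List F) (k : List Unit)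
    (e r : List (List F × List F)) : List (List (List F) × List F) :=
  (transp e (((k.tail.zip (iters (List.map (ftwist s)) (udiv (unary r) s.2) r)).map
    fun y => y.2).map fun f => amul s.1 lam e f)).map fun l =>
      (padAll (fcommon l).1, (fcommon l).2)

/-- The `j`-th column of the linear system for the coefficients of the recurrence, packed into
a single polynomial. -/
def column (s : (List F × List F) × List Unit) (W cnt : List Unit)
    (T : List (List (List F) × List F)) (j : List Unit) : List F :=
  pack W (T.map fun t => blocks s ((cnt.zip (t.1.drop j.length)).map Prod.snd)).flatten

/-- The total number of coefficients in a table of polynomials. -/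
def tableSize (T : List (List (List F) × List F)) : List Unit :=
  unary ((T.map fun t => t.1.flatten).flatten)

/-- The coefficients of the recurrence. The list `tau` has as many entries as errors can be
corrected. -/
def recurrence (s : (List F × List F) × List Unit) (k tau : List Unit)
    (T : List (List (List F) × List F)) : List (List F) :=
  relation (() :: ((() :: tau).map fun _ => tableSize T).flatten)
    ((upto (() :: tau)).map (column s
      ((() :: ((() :: tau).map fun _ => tableSize T).flatten) ++ tableSize T)
      (k.tail.drop tau.length) T))

open Classical in
/-- Remove leading zeros from the coefficients of a recurrence. -/
def trim (s : (List F × List F) × List Unit) (G : List (List F)) : List (List F) :=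
  G.foldl (fun G _ => listElim G [] fun g gs =>
    if pflag g = 0 then gs.map (ptwist s) else G) G

/-- The error, given the syndromes `T` and the recurrence `G`. -/
def errors (s : (List F × List F) × List Unit) (r : List Unit) (G : List (List F))
    (T : List (List (List F) × List F)) : List (List F × List F) :=
  T.map fun t => twistSum s (extSeq (iters (List.map (ptwist s)) r G).reverse t).reverse

/-- The decoder, apart from the normalisation of its input. -/
def decodeAux (s : (List F × List F) × List Unit) (lam : List F × List F) (k : List Unit)
    (e r : List (List F × List F)) : List (List F × List F) :=
  (r.zip (errors s (udiv (unary r) s.2)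
    (trim s (recurrence s k (udiv k.tail [(), ()]) (syndromes s lam k e r)))
    (syndromes s lam k e r))).map fun y => fadd y.1 (fmul ([-1], [1]) y.2)

/-- The decoder. -/
def decode (x : (List F × List F) × (List F × List F) × List Unit × List Unit ×
    List (List F × List F) × List (List F × List F) × Unit) : List (List F × List F) :=
  decodeAux (x.1, x.2.2.1) (fpad x.2.1) x.2.2.2.1 (x.2.2.2.2.1.map fpad)
    (x.2.2.2.2.2.1.map fpad)

end defs

section feasible

lemma exists_pflag : ∃ c : Code, ∀ (F : Type u) [Field F],
    Computes F c (fun x : List F => pflag x) := by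
  classical
  apply Exists.intro
  intro F _
  refine .foldlAdd (s := fun (_ : List F) (acc : F) a => if a = 0 then acc else 1) .id .zero
    (.iteZero (.snd (.snd .id)) (.fst (.snd .id)) .one) 0 (fun x st a ha => ?_)
  simp

lemma exists_pivot : ∃ c : Code, ∀ (F : Type u) [Field F],
    Computes F c (fun x : List (List F) => pivot x) := by
  classical
  apply Exists.intro
  intro F _
  refine .foldlAdd (s := fun (_ : List (List F)) (acc q : List F) =>
      if q.headD 0 = 0 then acc else q) .id .nil
    (.iteZero (.comp (exists_head.choose_spec F) (.snd (.snd .id))) (.fst (.snd .id))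
      (.snd (.snd .id))) X (fun x st a ha => ?_)
  have := sz_mem (F := F) ha
  simp only [eval_X]
  split <;> omega

lemma exists_pick : ∃ c : Code, ∀ (F : Type u) [Field F],
    Computes F c (fun x : List (List F) => pick x) := by
  classical
  apply Exists.intro
  intro F _
  refine .foldlAdd (s := fun (_ : List (List F)) (acc q : List F) =>
      if pflag q = 0 then acc else q) .id .nil
    (.iteZero (.comp (exists_pflag.choose_spec F) (.snd (.snd .id))) (.fst (.snd .id))
      (.snd (.snd .id))) X (fun x st a ha => ?_)
  have := sz_mem (F := F) ha
  simp only [eval_X]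
  split <;> omega

lemma exists_elimStep : ∃ c : Code, ∀ (F : Type u) [Field F],
    Computes F c (fun x : List (List F) => elimStep x) := by
  apply Exists.intro
  intro F _
  exact .map .id (.tail (.comp₂ (exists_padd.choose_spec F) (.snd .id)
    (.comp₂ (exists_psmul.choose_spec F)
      (.comp₂ (g := fun a b : F => a * b) .mulF
        (.comp (g := fun a : F => -a) .negF (.comp (exists_head.choose_spec F) (.snd .id)))
        (.comp (g := fun a : F => a⁻¹) .invF (.comp (exists_head.choose_spec F)
          (.comp (exists_pivot.choose_spec F) (.fst .id)))))
      (.comp (exists_pivot.choose_spec F) (.fst .id)))))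

lemma length_pivot_le {F : Type u} [Field F] (B : List (List F)) (N : ℕ)
    (h : ∀ q ∈ B, q.length ≤ N) : (pivot B).length ≤ N := by
  classical
  have : ∀ acc : List F, acc.length ≤ N →
      (B.foldl (fun acc q => if q.headD 0 = 0 then acc else q) acc).length ≤ N := by
    induction B with
    | nil => simp
    | cons q B ih =>
      intro acc hacc
      have := h q (by simp)
      refine ih (fun q hq => h q (by simp [hq])) _ ?_
      dsimp only
      split <;> assumption
  exact this [] (by simp)

lemma exists_elim : ∃ c : Code, ∀ (F : Type u) [Field F],
    Computes F c (fun x : List Unit × List (List F) =>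
      x.1.foldl (fun B _ => elimStep B) x.2) := by
  apply Exists.intro
  intro F _
  refine .foldlDim (s := fun (_ : List Unit × List (List F)) B _ => elimStep B) (.fst .id)
    (.snd .id) (.comp (exists_elimStep.choose_spec F) (.fst (.snd .id)))
    (.list (.list .base)) 0 (fun x st a ha N hN h => ?_)
  simp only [dim_list_le, dim_base, Nat.zero_le, implies_true, and_true, elimStep,
    List.length_map, List.mem_map, eval_zero, add_zero] at h ⊢
  refine ⟨h.1, ?_⟩
  rintro _ ⟨q, hq, rfl⟩
  have h1 := length_pivot_le st N h.2
  have h2 := h.2 q hq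
  simp only [List.length_tail, length_padd, length_psmul]
  omega

lemma exists_shifts : ∃ c : Code, ∀ (F : Type u) [Field F],
    Computes F c (fun x : (List Unit × List Unit) × List Unit × List F =>
      shifts x.1.1 x.1.2 x.2.1 x.2.2) := by
  apply Exists.intro
  intro F _
  exact .map (.comp (exists_upto.choose_spec F) (.snd (.fst .id)))
    (.append (.comp (exists_zeros.choose_spec F Unit) (.snd .id))
      (.comp₂ (exists_padd.choose_spec F) (.snd (.snd (.fst .id)))
        (.append (.comp (exists_zeros.choose_spec F Unit) (.append (.fst (.fst (.fst .id)))
          (.flatten (.map (.fst (.snd (.fst .id))) (.snd (.fst (.fst (.fst .id))))))))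
          (.cons .one .nil))))

lemma exists_chunk : ∃ c : Code, ∀ (F : Type u) [Field F],
    Computes F c (fun x : (List Unit × List Unit) × List F => chunk x.1.1 x.1.2 x.2) := by
  apply Exists.intro
  intro F _
  exact .map (.zip (.fst (.fst .id)) (.append (.drop (.flatten (.map (.snd (.fst .id))
      (.fst (.fst (.fst .id))))) (.snd .id))
    (.comp (exists_zeros.choose_spec F Unit) (.fst (.fst .id))))) (.snd (.snd .id))

lemma exists_relation : ∃ c : Code, ∀ (F : Type u) [Field F],
    Computes F c (fun x : List Unit × List (List F) => relation x.1 x.2) := by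
  have h1 : ∃ c : Code, ∀ (F : Type u) [Field F], Computes F c
      (fun x : List Unit × List (List F) => x.1 ++ unary x.2.flatten) := by
    apply Exists.intro
    intro F _
    exact .append (.fst .id) (.comp (exists_unary.choose_spec F F) (.flatten (.snd .id)))
  have h2 : ∃ c : Code, ∀ (F : Type u) [Field F], Computes F c
      (fun l : List (List F) => upto l) := by
    apply Exists.intro
    intro F _
    have := Computes.comp (exists_upto.choose_spec F) (exists_unary.choose_spec F (List F))
    simp only [upto_eq, unary, List.length_map] at this ⊢
    exact this
  apply Exists.intro
  intro F _
  exact .map (.comp (h2.choose_spec F) (.snd .id))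
    (.comp (g := fun y : (List Unit × List Unit) × List F => chunk y.1.1 y.1.2 y.2)
      (exists_chunk.choose_spec F) (.pair (.pair (.fst (.fst .id)) (.snd .id))
      (.comp (exists_pick.choose_spec F) (.comp (g := fun x : List Unit × List (List F) =>
          x.1.foldl (fun B _ => elimStep B) x.2) (exists_elim.choose_spec F) (.pair
        (.comp (h1.choose_spec F) (.fst .id))
        (.flatten (.map (.zip (.comp (h2.choose_spec F) (.snd (.fst .id))) (.snd (.fst .id)))
          (.comp (g := fun x : (List Unit × List Unit) × List Unit × List F =>
            shifts x.1.1 x.1.2 x.2.1 x.2.2) (exists_shifts.choose_spec F)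
            (.pair (.pair (.comp (h1.choose_spec F) (.fst (.fst .id)))
              (.fst (.fst (.fst .id)))) (.snd .id))))))))))

lemma exists_twists : ∃ c : Code, ∀ (F : Type u) [Field F], Computes F c
    (fun x : ((List F × List F) × List Unit) × List (List F × List F) =>
      iters (List.map (ftwist x.1)) (udiv (unary x.2) x.1.2) x.2) := by
  apply Exists.intro
  intro F _
  refine .iters (g := fun (x : ((List F × List F) × List Unit) × List (List F × List F))
      (v : List (List F × List F)) => v.map (ftwist x.1))
    (.comp₂ (g := udiv) (exists_udiv.choose_spec F)
      (.comp (exists_unary.choose_spec F (List F × List F)) (.snd .id)) (.snd (.fst .id)))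
    (.snd .id) (.map (.snd .id) (.comp₂ (exists_ftwist.choose_spec F)
      (.fst (.fst (.fst .id))) (.snd .id)))
    (.list (.prod (.list .base) (.list .base))) 0 (fun x st N hN h => ?_)
  simp only [dim_list_le, dim_pair_le, dim_base, Nat.zero_le, implies_true, and_true,
    List.length_map, List.mem_map, eval_zero, add_zero] at h ⊢
  refine ⟨h.1, ?_⟩
  rintro _ ⟨q, hq, rfl⟩
  simpa only [ftwist, dim_ptwist] using h.2 q hq

lemma exists_amuls : ∃ c : Code, ∀ (F : Type u) [Field F], Computes F c
    (fun x : ((List F × List F) × (List F × List F)) × List (List F × List F) ×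
      List (List (List F × List F)) => x.2.2.map fun f => amul x.1.1 x.1.2 x.2.1 f) := by
  apply Exists.intro
  intro F _
  exact .map (.snd (.snd .id)) (.comp (g := fun x : ((List F × List F) × (List F × List F)) ×
      (List (List F × List F) × List (List F × List F)) => amul x.1.1 x.1.2 x.2.1 x.2.2)
    (exists_amul.choose_spec F)
    (.pair (.fst (.fst .id)) (.pair (.fst (.snd (.fst .id))) (.snd .id))))

lemma exists_syndromes : ∃ c : Code, ∀ (F : Type u) [Field F],
    Computes F c (fun x : ((List F × List F) × List Unit) × (List F × List F) × List Unit ×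
      List (List F × List F) × List (List F × List F) =>
      syndromes x.1 x.2.1 x.2.2.1 x.2.2.2.1 x.2.2.2.2) := by
  apply Exists.intro
  intro F _
  exact .map (.comp₂ (g := transp) (exists_transp.choose_spec F) (.fst (.snd (.snd (.snd .id))))
    (.comp (g := fun x : ((List F × List F) × (List F × List F)) × List (List F × List F) ×
        List (List (List F × List F)) => x.2.2.map fun f => amul x.1.1 x.1.2 x.2.1 f)
      (exists_amuls.choose_spec F)
      (.pair (.pair (.fst (.fst .id)) (.fst (.snd .id))) (.pair (.fst (.snd (.snd (.snd .id))))
        (.map (f := fun _ y => y.2) (.zip (.tail (.fst (.snd (.snd .id))))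
          (.comp (g := fun x : ((List F × List F) × List Unit) × List (List F × List F) =>
            iters (List.map (ftwist x.1)) (udiv (unary x.2) x.1.2) x.2) (exists_twists.choose_spec F)
            (.pair (.fst .id) (.snd (.snd (.snd (.snd .id))))))) (.snd (.snd .id)))))))
    (.pair (.comp (g := padAll) (exists_padAll.choose_spec F)
        (.fst (.comp (exists_fcommon.choose_spec F) (.snd .id))))
      (.snd (.comp (exists_fcommon.choose_spec F) (.snd .id))))

lemma exists_column : ∃ c : Code, ∀ (F : Type u) [Field F],
    Computes F c (fun x : (((List F × List F) × List Unit) × List Unit × List Unit ×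
      List (List (List F) × List F)) × List Unit =>
      column x.1.1 x.1.2.1 x.1.2.2.1 x.1.2.2.2 x.2) := by
  apply Exists.intro
  intro F _
  exact .comp₂ (exists_pack.choose_spec F) (.fst (.snd (.fst .id)))
    (.flatten (.map (.snd (.snd (.snd (.fst .id))))
      (.comp₂ (exists_blocks.choose_spec F) (.fst (.fst (.fst .id)))
        (.map (.zip (.fst (.snd (.snd (.fst (.fst .id)))))
          (.drop (.snd (.fst .id)) (.fst (.snd .id)))) (.snd (.snd .id))))))

lemma exists_tableSize : ∃ c : Code, ∀ (F : Type u) [Field F],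
    Computes F c (fun x : List (List (List F) × List F) => tableSize x) := by
  apply Exists.intro
  intro F _
  exact .comp (g := fun l : List F => unary l) (exists_unary.choose_spec F F)
    (.flatten (.map .id (.flatten (.fst (.snd .id)))))

lemma exists_recurrence : ∃ c : Code, ∀ (F : Type u) [Field F],
    Computes F c (fun x : ((List F × List F) × List Unit) × List Unit × List Unit ×
      List (List (List F) × List F) => recurrence x.1 x.2.1 x.2.2.1 x.2.2.2) := by
  have h1 : ∃ c : Code, ∀ (F : Type u) [Field F], Computes F c
      (fun x : ((List F × List F) × List Unit) × List Unit × List Unit ×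
        List (List (List F) × List F) =>
        () :: ((() :: x.2.2.1).map fun _ => tableSize x.2.2.2).flatten) := by
    apply Exists.intro
    intro F _
    exact .cons .unit (.flatten (.map (.cons .unit (.fst (.snd (.snd .id))))
      (.comp (exists_tableSize.choose_spec F) (.snd (.snd (.snd (.fst .id)))))))
  apply Exists.intro
  intro F _
  exact .comp₂ (exists_relation.choose_spec F) (h1.choose_spec F)
    (.map (.comp (exists_upto.choose_spec F) (.cons .unit (.fst (.snd (.snd .id)))))
      (.comp (g := fun x : (((List F × List F) × List Unit) × List Unit × List Unit ×
          List (List (List F) × List F)) × List Unit =>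
          column x.1.1 x.1.2.1 x.1.2.2.1 x.1.2.2.2 x.2) (exists_column.choose_spec F)
        (.pair (.pair (.fst (.fst .id)) (.pair
          (.append (.comp (h1.choose_spec F) (.fst .id))
            (.comp (exists_tableSize.choose_spec F) (.snd (.snd (.snd (.fst .id))))))
          (.pair (.drop (.fst (.snd (.snd (.fst .id)))) (.tail (.fst (.snd (.fst .id)))))
            (.snd (.snd (.snd (.fst .id))))))) (.snd .id))))

lemma exists_trim : ∃ c : Code, ∀ (F : Type u) [Field F],
    Computes F c (fun x : ((List F × List F) × List Unit) × List (List F) =>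
      trim x.1 x.2) := by
  classical
  apply Exists.intro
  intro F _
  refine .foldlDim (s := fun (x : ((List F × List F) × List Unit) × List (List F)) G _ =>
      listElim G [] fun g gs => if pflag g = 0 then gs.map (ptwist x.1) else G)
    (.snd .id) (.snd .id)
    (.listCase (γ := List F) (.fst (.snd .id)) .nil
      (.iteZero (.comp (exists_pflag.choose_spec F) (.fst (.snd .id)))
        (.map (.snd (.snd .id)) (.comp₂ (exists_ptwist.choose_spec F)
          (.fst (.fst (.fst (.fst .id)))) (.snd .id)))
        (.fst (.snd (.fst .id)))))
    (.list (.list .base)) 0 (fun x st a ha N hN h => ?_)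
  cases st with
  | nil => simp [dim_list_le]
  | cons g gs =>
    rw [listElim_cons]
    split
    · simp only [dim_list_le, dim_base, Nat.zero_le, implies_true, and_true,
        List.length_map, List.mem_map, List.length_cons, List.mem_cons, eval_zero, add_zero] at h ⊢
      refine ⟨by omega, ?_⟩
      rintro _ ⟨q, hq, rfl⟩
      simpa only [dim_ptwist] using h.2 q (Or.inr hq)
    · simpa using h

lemma exists_errors : ∃ c : Code, ∀ (F : Type u) [Field F],
    Computes F c (fun x : ((List F × List F) × List Unit) × List Unit × List (List F) ×
      List (List (List F) × List F) => errors x.1 x.2.1 x.2.2.1 x.2.2.2) := by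
  have h1 : ∃ c : Code, ∀ (F : Type u) [Field F], Computes F c
      (fun x : ((List F × List F) × List Unit) × List Unit × List (List F) ×
        List (List (List F) × List F) => iters (List.map (ptwist x.1)) x.2.1 x.2.2.1) := by
    apply Exists.intro
    intro F _
    refine .iters (g := fun (x : ((List F × List F) × List Unit) × List Unit × List (List F) ×
        List (List (List F) × List F)) (v : List (List F)) => v.map (ptwist x.1))
      (.fst (.snd .id)) (.fst (.snd (.snd .id)))
      (.map (.snd .id) (.comp₂ (exists_ptwist.choose_spec F)
        (.fst (.fst (.fst .id))) (.snd .id)))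
      (.list (.list .base)) 0 (fun x st N hN h => ?_)
    simp only [dim_list_le, dim_base, Nat.zero_le, implies_true, and_true,
      List.length_map, List.mem_map, eval_zero, add_zero] at h ⊢
    refine ⟨h.1, ?_⟩
    rintro _ ⟨q, hq, rfl⟩
    simpa only [dim_ptwist] using h.2 q hq
  apply Exists.intro
  intro F _
  exact .map (.snd (.snd (.snd .id))) (.comp₂ (exists_twistSum.choose_spec F)
    (.fst (.fst .id)) (.reverse (.comp₂ (exists_extSeq.choose_spec F)
      (.reverse (.comp (g := fun x : ((List F × List F) × List Unit) × List Unit ×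
        List (List F) × List (List (List F) × List F) => iters (List.map (ptwist x.1)) x.2.1 x.2.2.1)
      (h1.choose_spec F) (.fst .id))) (.snd .id))))

lemma exists_errors_table : ∃ c : Code, ∀ (F : Type u) [Field F], Computes F c
    (fun x : (((List F × List F) × List Unit) × List Unit × List (List F × List F)) ×
        List (List (List F) × List F) =>
      errors x.1.1 (udiv (unary x.1.2.2) x.1.1.2)
        (trim x.1.1 (recurrence x.1.1 x.1.2.1 (udiv x.1.2.1.tail [(), ()]) x.2)) x.2) := by
  have h1 : ∃ c : Code, ∀ (F : Type u) [Field F], Computes F c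
      (fun x : (((List F × List F) × List Unit) × List Unit) × List (List (List F) × List F) =>
        trim x.1.1 (recurrence x.1.1 x.1.2 (udiv x.1.2.tail [(), ()]) x.2)) := by
    apply Exists.intro
    intro F _
    exact .comp₂ (g := trim) (exists_trim.choose_spec F) (.fst (.fst .id))
      (.comp (g := fun x : ((List F × List F) × List Unit) × List Unit × List Unit ×
          List (List (List F) × List F) => recurrence x.1 x.2.1 x.2.2.1 x.2.2.2)
        (exists_recurrence.choose_spec F)
        (.pair (.fst (.fst .id)) (.pair (.snd (.fst .id)) (.pair
          (.comp₂ (g := udiv) (exists_udiv.choose_spec F) (.tail (.snd (.fst .id)))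
            (.cons .unit (.cons .unit .nil)))
          (.snd .id)))))
  apply Exists.intro
  intro F _
  have h2 := Computes.comp (α := (((List F × List F) × List Unit) × List Unit ×
      List (List F × List F)) × List (List (List F) × List F)) (h1.choose_spec F)
    (.pair (.pair (.fst (.fst .id)) (.fst (.snd (.fst .id)))) (.snd .id))
  have h3 : Computes F _ (fun x : (((List F × List F) × List Unit) × List Unit ×
      List (List F × List F)) × List (List (List F) × List F) =>
      udiv (unary x.1.2.2) x.1.1.2) := .comp₂ (g := udiv) (exists_udiv.choose_spec F)
    (.comp (g := fun l : List (List F × List F) => unary l)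
      (exists_unary.choose_spec F (List F × List F)) (.snd (.snd (.fst .id))))
    (.snd (.fst (.fst .id)))
  have h4 := Computes.comp (exists_errors.choose_spec F)
    (.pair (.fst (.fst .id)) (.pair h3 (.pair h2 (.snd .id))))
  exact h4

/-- The corrected word, as a function of the received word and the errors. -/
lemma exists_correction : ∃ c : Code, ∀ (F : Type u) [Field F], Computes F c
    (fun x : List (List F × List F) × List (List F × List F) =>
      (x.1.zip x.2).map fun y => fadd y.1 (fmul ([-1], [1]) y.2)) := by
  apply Exists.intro
  intro F _
  exact .map (.zip (.fst .id) (.snd .id))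
    (.comp₂ (g := fadd) (exists_fadd.choose_spec F) (.fst (.snd .id))
      (.comp₂ (g := fmul) (exists_fmul.choose_spec F)
        (.pair (.cons (.comp (g := fun a : F => -a) .negF .one) .nil) (.cons .one .nil))
        (.snd (.snd .id))))

lemma exists_decodeAux : ∃ c : Code, ∀ (F : Type u) [Field F],
    Computes F c (fun x : ((List F × List F) × List Unit) × (List F × List F) × List Unit ×
      List (List F × List F) × List (List F × List F) =>
      decodeAux x.1 x.2.1 x.2.2.1 x.2.2.2.1 x.2.2.2.2) := by
  apply Exists.intro
  intro F _
  have h := Computes.comp (exists_errors_table.choose_spec F)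
    (.pair (.pair (.fst .id) (.pair (.fst (.snd (.snd .id)))
      (.snd (.snd (.snd (.snd .id)))))) (exists_syndromes.choose_spec F))
  have h2 := Computes.comp (exists_correction.choose_spec F)
    (.pair (.snd (.snd (.snd (.snd .id)))) h)
  exact h2

lemma exists_decode : ∃ c : Code, ∀ (F : Type u) [Field F],
    Computes F c (fun x : (List F × List F) × (List F × List F) × List Unit × List Unit ×
      List (List F × List F) × List (List F × List F) × Unit => decode x) := by
  apply Exists.intro
  intro F _
  exact .comp (g := fun x : ((List F × List F) × List Unit) × (List F × List F) × List Unit ×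
      List (List F × List F) × List (List F × List F) =>
      decodeAux x.1 x.2.1 x.2.2.1 x.2.2.2.1 x.2.2.2.2) (exists_decodeAux.choose_spec F)
    (.pair (.pair (.fst .id) (.fst (.snd (.snd .id)))) (.pair
      (.comp (exists_fpad.choose_spec F) (.fst (.snd .id)))
      (.pair (.fst (.snd (.snd (.snd .id))))
        (.pair (.map (.fst (.snd (.snd (.snd (.snd .id)))))
            (.comp (exists_fpad.choose_spec F) (.snd .id)))
          (.map (.fst (.snd (.snd (.snd (.snd (.snd .id))))))
            (.comp (exists_fpad.choose_spec F) (.snd .id)))))))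

end feasible

/-! ### Coefficients of elements of the algebra -/

/-- The conditions under which `K[x; σ] / (x ^ n - lam)` is a cyclic algebra. -/
structure IsCyclicDatum {K : Type u} [Field K] (σ : RingAut K) (n : ℕ) (lam : K) : Prop where
  pos : 0 < n
  order : orderOf σ = n
  fix : σ lam = lam
  ne_zero : lam ≠ 0

section algebra

variable {K : Type u} [Field K] {σ : RingAut K} {n : ℕ} {lam : K}

lemma IsCyclicDatum.pow_eq_one (h : IsCyclicDatum σ n lam) : σ ^ n = 1 := by
  rw [← h.order]; exact pow_orderOf_eq_one σ

variable (σ n lam) in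
/-- The quotient map onto the algebra. -/
def toAlg : SkewPoly σ →+* Alg σ n lam :=
  (TwoSidedIdeal.span {mono σ n 1 - mono σ 0 lam}).ringCon.mk'

variable (σ n lam) in
/-- Constants, as elements of the algebra. -/
def cst : K →+* Alg σ n lam where
  toFun a := toAlg σ n lam (mono σ 0 a)
  map_one' := by
    rw [show mono σ 0 (1 : K) = 1 from rfl, map_one]
  map_mul' a b := by
    rw [← map_mul, mono_mul_mono, pow_zero, RingAut.one_apply]
  map_zero' := by
    rw [show mono σ 0 (0 : K) = 0 from map_zero (SkewPolynomial.monomial (R := Twist σ) 0),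
      map_zero]
  map_add' a b := by rw [mono_add, map_add]

variable (σ n lam) in
/-- The class of the variable. -/
def gen : Alg σ n lam := toAlg σ n lam (mono σ 1 1)

lemma gen_mul_cst (a : K) : gen σ n lam * cst σ n lam a = cst σ n lam (σ a) * gen σ n lam := by
  change toAlg _ _ _ _ * toAlg _ _ _ _ = toAlg _ _ _ _ * toAlg _ _ _ _
  rw [← map_mul, ← map_mul, mono_mul_mono, mono_mul_mono]
  simp

lemma gen_pow_mul_cst (j : ℕ) (a : K) :
    gen σ n lam ^ j * cst σ n lam a = cst σ n lam ((σ ^ j) a) * gen σ n lam ^ j := by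
  induction j generalizing a with
  | zero => simp
  | succ j ih => rw [pow_succ, mul_assoc, gen_mul_cst, ← mul_assoc, ih, mul_assoc]; rfl

lemma toAlg_mono (i : ℕ) (a : K) :
    toAlg σ n lam (mono σ i a) = cst σ n lam a * gen σ n lam ^ i := by
  have h : ∀ i, toAlg σ n lam (mono σ i 1) = gen σ n lam ^ i := by
    intro i
    induction i with
    | zero => rw [show mono σ 0 (1 : K) = 1 from rfl, map_one, pow_zero]
    | succ i ih =>
      rw [pow_succ, ← ih, gen, ← map_mul, mono_mul_mono]; simp
  rw [← h]
  change _ = toAlg _ _ _ _ * _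
  rw [← map_mul, mono_mul_mono]; simp

lemma gen_pow_eq : gen σ n lam ^ n = cst σ n lam lam := by
  have h : toAlg σ n lam (mono σ n 1) = toAlg σ n lam (mono σ 0 lam) := by
    refine Quotient.sound' ?_
    change (TwoSidedIdeal.span {mono σ n 1 - mono σ 0 lam}).ringCon _ _
    rw [TwoSidedIdeal.rel_iff]
    exact TwoSidedIdeal.subset_span rfl
  rw [toAlg_mono, map_one, one_mul] at h
  exact h

lemma ofCoeffs_eq (a : Fin n → K) :
    ofCoeffs σ lam a = ∑ i : Fin n, cst σ n lam (a i) * gen σ n lam ^ (i : ℕ) := by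
  simp only [← toAlg_mono, ← map_sum]
  rfl

lemma ofCoeffs_add (a b : Fin n → K) :
    ofCoeffs σ lam (a + b) = ofCoeffs σ lam a + ofCoeffs σ lam b := by
  simp only [ofCoeffs_eq, Pi.add_apply, map_add, add_mul, Finset.sum_add_distrib]

lemma ofCoeffs_cst_mul (c : K) (a : Fin n → K) :
    ofCoeffs σ lam (fun i => c * a i) = cst σ n lam c * ofCoeffs σ lam a := by
  simp only [ofCoeffs_eq, map_mul, Finset.mul_sum, mul_assoc]

namespace IsCyclicDatum

variable (h : IsCyclicDatum σ n lam)
include h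

lemma coords_ofCoeffs (a : Fin n → K) : coords (ofCoeffs σ lam a) = a :=
  SkewConstacyclic.coords_ofCoeffs h.pos h.pow_eq_one h.fix h.ne_zero a

lemma ofCoeffs_coords (f : Alg σ n lam) : ofCoeffs σ lam (coords f) = f :=
  SkewConstacyclic.ofCoeffs_coords h.pos h.pow_eq_one h.fix h.ne_zero f

lemma coords_eq {f : Alg σ n lam} {a : Fin n → K} (e : f = ofCoeffs σ lam a) : coords f = a := by
  rw [e, h.coords_ofCoeffs]

lemma coords_add (f g : Alg σ n lam) : coords (f + g) = coords f + coords g :=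
  h.coords_eq (by rw [ofCoeffs_add, h.ofCoeffs_coords, h.ofCoeffs_coords])

/-- The coefficients, as a homomorphism of groups. -/
def coordsHom : Alg σ n lam ≃+ (Fin n → K) where
  toFun := coords
  invFun := ofCoeffs σ lam
  left_inv := h.ofCoeffs_coords
  right_inv := h.coords_ofCoeffs
  map_add' := h.coords_add

lemma coords_zero : coords (0 : Alg σ n lam) = 0 := map_zero h.coordsHom

lemma coords_sub (f g : Alg σ n lam) : coords (f - g) = coords f - coords g :=
  map_sub h.coordsHom f g

lemma coords_sum {ι : Type v} (s : Finset ι) (f : ι → Alg σ n lam) :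
    coords (∑ i ∈ s, f i) = ∑ i ∈ s, coords (f i) :=
  map_sum h.coordsHom f s

lemma coords_injective : Function.Injective (coords : Alg σ n lam → Fin n → K) :=
  h.coordsHom.injective

lemma coords_cst_mul (c : K) (f : Alg σ n lam) (i : Fin n) :
    coords (cst σ n lam c * f) i = c * coords f i := by
  rw [h.coords_eq (a := fun i => c * coords f i)]
  rw [ofCoeffs_cst_mul, h.ofCoeffs_coords]

lemma coords_gen_pow (i j : Fin n) :
    coords (gen σ n lam ^ (i : ℕ)) j = if j = i then 1 else 0 := by
  have : gen σ n lam ^ (i : ℕ) = ofCoeffs σ lam (Pi.single i 1) := by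
    rw [ofCoeffs_eq, Finset.sum_eq_single i]
    · simp
    · intro b _ hb; simp [Pi.single_eq_of_ne hb]
    · simp
  rw [h.coords_eq this, Pi.single_apply]

/-- Multiplication by the variable: the coefficients move one place up. -/
lemma coords_gen_mul (f : Alg σ n lam) (i : Fin n) :
    coords (gen σ n lam * f) i =
      if (i : ℕ) = 0 then lam * σ (coords f ⟨n - 1, Nat.sub_lt h.pos one_pos⟩)
      else σ (coords f ⟨i - 1, (Nat.sub_le _ _).trans_lt i.2⟩) := by
  obtain ⟨N, rfl⟩ : ∃ N, n = N + 1 := ⟨n - 1, by have := h.pos; omega⟩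
  have key : gen σ (N + 1) lam * f = ofCoeffs σ lam
      (Fin.cons (lam * σ (coords f (Fin.last N))) fun j => σ (coords f j.castSucc)) := by
    conv_lhs => rw [← h.ofCoeffs_coords f]
    rw [ofCoeffs_eq, ofCoeffs_eq, Fin.sum_univ_castSucc, Fin.sum_univ_succ, mul_add,
      add_comm (gen σ (N + 1) lam * _), Finset.mul_sum]
    refine congrArg₂ (· + ·) ?_ ?_
    · rw [Fin.val_last, Fin.val_zero, pow_zero, mul_one, Fin.cons_zero,
        ← mul_assoc, gen_mul_cst, mul_assoc, ← pow_succ' (gen σ (N + 1) lam) N, gen_pow_eq,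
        mul_comm lam, map_mul]
    · refine Finset.sum_congr rfl fun j _ => ?_
      rw [← mul_assoc, gen_mul_cst, mul_assoc, ← pow_succ' (gen σ (N + 1) lam), Fin.val_succ,
        Fin.cons_succ, Fin.val_castSucc]
  rw [h.coords_eq key]
  cases i using Fin.cases with
  | zero => rw [Fin.cons_zero]; exact (if_pos rfl).symm
  | succ j => rw [Fin.cons_succ]; exact (if_neg (Nat.succ_ne_zero _)).symm

/-- The variable, as a unit of the algebra. -/
def unit : (Alg σ n lam)ˣ :=
  Units.ofPow (((Units.mk0 lam h.ne_zero).map (cst σ n lam).toMonoidHom)) (gen σ n lam)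
    h.pos.ne' gen_pow_eq

/-- The automorphism that acts on coefficients by `σ`: conjugation by the variable. -/
def conj : RingAut (Alg σ n lam) :=
  MulSemiringAction.toRingAut (ConjAct (Alg σ n lam)ˣ) (Alg σ n lam) (ConjAct.toConjAct h.unit)

lemma conj_apply (f : Alg σ n lam) : h.conj f * gen σ n lam = gen σ n lam * f := by
  change (gen σ n lam * f * (h.unit⁻¹ : (Alg σ n lam)ˣ)) * (h.unit : Alg σ n lam) = _
  rw [mul_assoc, Units.inv_mul, mul_one]

lemma conj_eq (f : Alg σ n lam) : h.conj f = ofCoeffs σ lam fun i => σ (coords f i) := by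
  have h1 : IsUnit (gen σ n lam) := h.unit.isUnit
  rw [← h1.mul_left_inj, h.conj_apply]
  conv_lhs => rw [← h.ofCoeffs_coords f]
  rw [ofCoeffs_eq, ofCoeffs_eq, Finset.mul_sum, Finset.sum_mul]
  refine Finset.sum_congr rfl fun i _ => ?_
  rw [← mul_assoc, gen_mul_cst, mul_assoc, mul_assoc, ← pow_succ, ← pow_succ']

lemma coords_conj (f : Alg σ n lam) (i : Fin n) : coords (h.conj f) i = σ (coords f i) := by
  rw [conj_eq, coords_ofCoeffs h]

lemma coords_conj_zpow (z : ℤ) (f : Alg σ n lam) (i : Fin n) :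
    coords ((h.conj ^ z) f) i = (σ ^ z) (coords f i) := by
  induction z using Int.induction_on generalizing f with
  | zero => simp
  | succ j ih => rw [zpow_add_one, zpow_add_one, RingAut.mul_apply, RingAut.mul_apply, ih,
      h.coords_conj]
  | pred j ih =>
    rw [zpow_sub_one, zpow_sub_one, RingAut.mul_apply, RingAut.mul_apply, ih]
    congr 1
    apply σ.injective
    rw [← h.coords_conj, ← RingAut.mul_apply, ← RingAut.mul_apply]
    simp

lemma coeffAut_eq (j : ℕ) (f : Alg σ n lam) : coeffAut j f = (h.conj ^ j) f := by
  apply h.coords_injective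
  funext i
  rw [coeffAut, h.coords_ofCoeffs, ← zpow_natCast, ← zpow_natCast, h.coords_conj_zpow]

lemma conj_pow_eq_one : h.conj ^ n = 1 := by
  ext f
  rw [← h.coeffAut_eq, coeffAut, h.pow_eq_one]
  exact h.ofCoeffs_coords f

end IsCyclicDatum

end algebra

/-! ### The index and orthogonal idempotents -/

section index

/-- The rows `v i` with `v i * e i = v i` are linearly independent. -/
lemma card_le_of_orthogonalIdempotents {D : Type u} [DivisionRing D] {r : ℕ} {ι : Type v}
    [Fintype ι] {e : ι → Matrix (Fin r) (Fin r) D} (he : OrthogonalIdempotents e)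
    (h0 : ∀ i, e i ≠ 0) : Fintype.card ι ≤ r := by
  classical
  have h1 : ∀ i, ∃ v : Fin r → D, v ≠ 0 ∧ ∀ j, Matrix.vecMul v (e j) = if i = j then v else 0 := by
    intro i
    obtain ⟨a, ha⟩ : ∃ a, e i a ≠ 0 := by
      by_contra! h
      exact h0 i (by ext a b; exact congrFun (h a) b)
    refine ⟨e i a, ha, fun j => ?_⟩
    have h2 : Matrix.vecMul (e i a) (e j) = (e i * e j) a := rfl
    rw [h2, he.mul_eq]
    split <;> rfl
  choose v hv hve using h1
  have : LinearIndependent D v := by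
    rw [Fintype.linearIndependent_iff]
    intro g hg j
    have h2 := congrArg (fun w => Matrix.vecMul w (e j)) hg
    simp only [Matrix.sum_vecMul, Matrix.smul_vecMul, hve, Matrix.zero_vecMul, smul_ite,
      smul_zero, Finset.sum_ite_eq', Finset.mem_univ, if_true] at h2
    exact (smul_eq_zero.1 h2).resolve_right (hv j)
  simpa using this.fintype_card_le_finrank

lemma sum_eq_one_of_orthogonalIdempotents {A : Type w} [Ring A] {D : Type u} [DivisionRing D]
    {r : ℕ} (φ : A ≃+* Matrix (Fin r) (Fin r) D) {e : Fin r → A} (he : OrthogonalIdempotents e)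
    (h0 : ∀ i, e i ≠ 0) : ∑ i, e i = 1 := by
  by_contra h
  have h1 := (he.isIdempotentElem_sum (s := Finset.univ)).one_sub
  have h2 := he.option (1 - ∑ i, e i) h1
    (by rw [sub_mul, one_mul, he.isIdempotentElem_sum.eq, sub_self])
    (by rw [mul_sub, mul_one, he.isIdempotentElem_sum.eq, sub_self])
  have h3 := card_le_of_orthogonalIdempotents (h2.map φ.toRingHom) (fun i => by
    refine (map_ne_zero_iff φ φ.injective).2 ?_
    cases i with
    | none => exact fun h4 => h (sub_eq_zero.1 h4).symm
    | some i => exact h0 i)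
  simp at h3

lemma finrank_center_matrix (D : Type u) [DivisionRing D] (r : ℕ) (hr : 0 < r) :
    Module.finrank (Subring.center (Matrix (Fin r) (Fin r) D)) (Matrix (Fin r) (Fin r) D) =
      r * r * Module.finrank (Subring.center D) D := by
  have h1 := Module.finrank_matrix (Subring.center D) D (Fin r) (Fin r)
  rw [Fintype.card_fin] at h1
  rw [← h1]
  have : Nonempty (Fin r) := ⟨⟨0, hr⟩⟩
  symm
  refine congrArg Cardinal.toNat (rank_eq_of_equiv_equiv (fun z => ⟨Matrix.scalar (Fin r) z.1, ?_⟩)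
    (AddEquiv.refl _) ⟨fun a b hab => ?_, fun y => ?_⟩ fun z M => ?_)
  · rw [Matrix.subringCenter_eq_scalar_map]
    exact ⟨z.1, z.2, rfl⟩
  · exact Subtype.ext (Matrix.scalar_inj.1 (Subtype.ext_iff.1 hab))
  · obtain ⟨y, hy⟩ := y
    have hy' := hy
    rw [Matrix.subringCenter_eq_scalar_map] at hy'
    obtain ⟨z, hz, rfl⟩ := hy'
    exact ⟨⟨z, hz⟩, rfl⟩
  · ext i j
    change z.1 * M i j = (Matrix.scalar (Fin r) z.1 * M) i j
    rw [Matrix.scalar_apply, Matrix.diagonal_mul]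

variable {K : Type u} [Field K] {σ : RingAut K} {n : ℕ} {lam : K}

namespace IsCyclicDatum

variable (h : IsCyclicDatum σ n lam)
include h

lemma coords_mul_cst (f : Alg σ n lam) (a : K) (i : Fin n) :
    coords (f * cst σ n lam a) i = coords f i * (σ ^ (i : ℕ)) a := by
  rw [h.coords_eq (a := fun i => coords f i * (σ ^ (i : ℕ)) a)]
  conv_lhs => rw [← h.ofCoeffs_coords f]
  rw [ofCoeffs_eq, ofCoeffs_eq, Finset.sum_mul]
  refine Finset.sum_congr rfl fun j _ => ?_
  rw [mul_assoc, gen_pow_mul_cst, ← mul_assoc, map_mul]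

lemma mem_center_iff (f : Alg σ n lam) :
    f ∈ Subring.center (Alg σ n lam) ↔ ∃ a : K, σ a = a ∧ f = cst σ n lam a := by
  rw [Subring.mem_center_iff]
  constructor
  · intro hf
    have hcst : ∀ c : K, coords (cst σ n lam c) =
        fun i => if i = (⟨0, h.pos⟩ : Fin n) then c else 0 := by
      intro c
      funext i
      have h1 := h.coords_cst_mul c (gen σ n lam ^ ((⟨0, h.pos⟩ : Fin n) : ℕ)) i
      rw [h.coords_gen_pow] at h1
      simpa using h1
    have h0 : ∀ i : Fin n, (i : ℕ) ≠ 0 → coords f i = 0 := by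
      intro i hi
      by_contra hfi
      have h2 : σ ^ (i : ℕ) ≠ 1 := by
        intro h3
        have := orderOf_dvd_of_pow_eq_one h3
        rw [h.order] at this
        have := Nat.le_of_dvd (Nat.pos_of_ne_zero hi) this
        omega
      refine h2 (RingEquiv.ext fun a => ?_)
      have h3 := congrFun (congrArg coords (hf (cst σ n lam a))) i
      rw [h.coords_cst_mul, h.coords_mul_cst, mul_comm] at h3
      exact (mul_left_cancel₀ hfi h3).symm
    have h1 : f = cst σ n lam (coords f ⟨0, h.pos⟩) := by
      apply h.coords_injective
      rw [hcst]
      funext i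
      split
      · congr
      · exact h0 i (by rintro h2; exact ‹¬ _› (Fin.ext h2))
    refine ⟨_, ?_, h1⟩
    rw [← h.coords_conj]
    have h2 : h.conj f = f := by
      have h1 : IsUnit (gen σ n lam) := h.unit.isUnit
      rw [← h1.mul_left_inj, h.conj_apply, hf]
    rw [h2]
  · rintro ⟨a, ha, rfl⟩ g
    apply h.coords_injective
    funext i
    rw [h.coords_cst_mul, h.coords_mul_cst, mul_comm]
    congr 1
    induction (i : ℕ) with
    | zero => rfl
    | succ j ih => rw [pow_succ, RingAut.mul_apply, ha, ih]

lemma finrank_center : Module.finrank (Subring.center (Alg σ n lam)) (Alg σ n lam) = n * n := by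
  have hfin : Finite (Subgroup.zpowers σ) := by
    have := orderOf_pos_iff.1 (h.order.symm ▸ h.pos)
    exact (this.finite_zpowers).to_subtype
  have hft : Fintype (Subgroup.zpowers σ) := Fintype.ofFinite _
  have hK : Module.finrank (FixedPoints.subfield (Subgroup.zpowers σ) K) K = n := by
    rw [FixedPoints.finrank_eq_card, ← Nat.card_eq_fintype_card, Nat.card_zpowers, h.order]
  have hV : Module.finrank (FixedPoints.subfield (Subgroup.zpowers σ) K) (Fin n → K) = n * n := by
    rw [Module.finrank_pi_fintype, Finset.sum_const, Finset.card_univ, Fintype.card_fin, hK,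
      smul_eq_mul]
  rw [← hV]
  symm
  have hfix : ∀ x : K, x ∈ FixedPoints.subfield (Subgroup.zpowers σ) K ↔ σ x = x := by
    intro x
    constructor
    · intro hx
      exact hx ⟨σ, Subgroup.mem_zpowers σ⟩
    · rintro hx ⟨_, z, rfl⟩
      change (σ ^ z) x = x
      have : σ ∈ MulAction.stabilizer (RingAut K) x := hx
      exact Subgroup.zpow_mem _ this z
  refine congrArg Cardinal.toNat (rank_eq_of_equiv_equiv
    (fun z => ⟨cst σ n lam z.1, ?_⟩) h.coordsHom.symm ⟨fun a b hab => ?_, fun y => ?_⟩ fun z v => ?_)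
  · exact (h.mem_center_iff _).2 ⟨z.1, (hfix _).1 z.2, rfl⟩
  · have : Nontrivial (Alg σ n lam) := by
      refine ⟨⟨0, 1, fun h1 => ?_⟩⟩
      have h2 := h.coords_gen_pow ⟨0, h.pos⟩ ⟨0, h.pos⟩
      rw [pow_zero, ← h1, h.coords_zero] at h2
      simp at h2
    exact Subtype.ext ((cst σ n lam).injective (Subtype.ext_iff.1 hab))
  · obtain ⟨a, ha, hy⟩ := (h.mem_center_iff _).1 y.2
    exact ⟨⟨a, (hfix a).2 ha⟩, Subtype.ext hy.symm⟩
  · exact ofCoeffs_cst_mul _ _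

/-- The index divides `n`, and `n / m` nonzero orthogonal idempotents have sum `1`. -/
lemma index {m : ℕ} (hm : HasIndex (Alg σ n lam) m) : m * (n / m) = n ∧
    ∀ e : Fin (n / m) → Alg σ n lam, OrthogonalIdempotents e → (∀ i, e i ≠ 0) → ∑ i, e i = 1 := by
  obtain ⟨D, _, r, hr, ⟨φ⟩, hm0, hD⟩ := hm
  have h1 : Module.finrank (Subring.center (Alg σ n lam)) (Alg σ n lam) =
      Module.finrank (Subring.center (Matrix (Fin r) (Fin r) D)) (Matrix (Fin r) (Fin r) D) :=
    congrArg Cardinal.toNat (rank_eq_of_equiv_equiv (Subring.centerCongr φ) φ.toAddEquiv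
      (Subring.centerCongr φ).bijective fun z a => map_mul φ _ _)
  rw [h.finrank_center, finrank_center_matrix D r hr, hD] at h1
  have h2 : n = m * r := by
    have : n ^ 2 = (m * r) ^ 2 := by rw [pow_two, h1]; ring
    exact Nat.pow_left_injective two_ne_zero this
  have h3 : n / m = r := by rw [h2, Nat.mul_div_cancel_left _ hm0]
  rw [h3]
  exact ⟨h2.symm, fun e he h0 => sum_eq_one_of_orthogonalIdempotents φ he h0⟩

end IsCyclicDatum

end index

/-! ### Errors of small weight -/

namespace IsCyclicDatum

variable {K : Type u} [Field K] {σ : RingAut K} {n : ℕ} {lam : K} (h : IsCyclicDatum σ n lam)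
  {T : RingAut (Alg σ n lam)} {θ : RingAut K} {e : Alg σ n lam} {N : ℕ}
include h

/-- An element with at most `s` nonzero coefficients vanishes if it is annihilated by `s`
consecutive idempotents. Normalising a coefficient `1`, the difference of `f` and `T f` has fewer
coefficients and is annihilated by `s - 1` of them; so `T f = f`, and `f` is annihilated by all
of the idempotents, which have sum `1`. -/
lemma eq_zero_of_mul_eq_zero (hT : ∀ f i, coords (T f) i = θ (coords f i))
    (he : ∑ b ∈ Finset.range N, (T ^ (b : ℤ)) e = 1) (s : ℕ) (c : ℤ) (f : Alg σ n lam)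
    (S : Finset (Fin n)) (hS : S.card ≤ s) (hf : ∀ i ∉ S, coords f i = 0)
    (hc : ∀ b : ℤ, c ≤ b → b < c + s → f * (T ^ b) e = 0) : f = 0 := by
  classical
  induction s generalizing c f S with
  | zero =>
    have : S = ∅ := Finset.card_eq_zero.1 (Nat.le_zero.1 hS)
    subst this
    apply h.coords_injective
    rw [h.coords_zero]
    exact funext fun i => hf i (Finset.notMem_empty i)
  | succ s ih =>
    by_contra hf0
    obtain ⟨i, hi⟩ : ∃ i, coords f i ≠ 0 := by
      by_contra! h0
      exact hf0 (h.coords_injective (by rw [h.coords_zero]; exact funext h0))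
    obtain ⟨g, hg⟩ : ∃ g, g = cst σ n lam (coords f i)⁻¹ * f := ⟨_, rfl⟩
    have hgi : coords g i = 1 := by rw [hg, h.coords_cst_mul, inv_mul_cancel₀ hi]
    have hgS : ∀ j ∉ S, coords g j = 0 := fun j hj => by
      rw [hg, h.coords_cst_mul, hf j hj, mul_zero]
    have hgc : ∀ b : ℤ, c ≤ b → b < c + (s + 1 : ℕ) → g * (T ^ b) e = 0 := fun b h1 h2 => by
      rw [hg, mul_assoc, hc b h1 h2, mul_zero]
    have hiS : i ∈ S := by by_contra h1; exact hi (hf i h1)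
    have hTg : T g = g := by
      symm
      rw [← sub_eq_zero]
      refine ih (c + 1) (g - T g) (S.erase i) ?_ (fun j hj => ?_) (fun b h1 h2 => ?_)
      · rw [Finset.card_erase_of_mem hiS]; omega
      · rw [h.coords_sub, Pi.sub_apply, hT]
        by_cases hji : j = i
        · rw [hji, hgi, map_one, sub_self]
        · rw [hgS j (fun h1 => hj (Finset.mem_erase.2 ⟨hji, h1⟩)), map_zero, sub_zero]
      · have h3 : T g * (T ^ b) e = T (g * (T ^ (b - 1)) e) := by
          rw [map_mul, ← RingAut.mul_apply T, ← zpow_one_add, add_sub_cancel]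
        rw [sub_mul, h3, hgc b (by omega) (by push_cast; omega),
          hgc (b - 1) (by omega) (by push_cast; omega), map_zero, sub_zero]
    have hTz : ∀ z : ℤ, (T ^ z) g = g := fun z =>
      Subgroup.zpow_mem (MulAction.stabilizer (RingAut (Alg σ n lam)) g) (x := T) hTg z
    have hall : ∀ b : ℤ, g * (T ^ b) e = 0 := by
      intro b
      have h1 := congrArg (T ^ (b - c)) (hgc c le_rfl (by push_cast; omega))
      rwa [map_mul, hTz, ← RingAut.mul_apply, ← zpow_add, sub_add_cancel, map_zero] at h1
    have hg0 : g = 0 := by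
      rw [← mul_one g, ← he, Finset.mul_sum]
      exact Finset.sum_eq_zero fun b _ => hall b
    rw [hg0, h.coords_zero] at hgi
    exact zero_ne_one hgi

omit h in
/-- The coefficients of an error with few coefficients satisfy a common linear relation. -/
lemma exists_annihilator (f : Alg σ n lam) (tau : ℕ) (S : Finset (Fin n)) (hS : S.card ≤ tau)
    (hf : ∀ i ∉ S, coords f i = 0) : ∃ G : Fin (tau + 1) → K, G ≠ 0 ∧
      ∀ i, ∑ l, G l * (θ ^ (-(l : ℤ))) (coords f i) = 0 := by
  have h1 : LinearMap.ker (Matrix.mulVecLin (Matrix.of fun (i : S) (l : Fin (tau + 1)) =>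
      (θ ^ (-(l : ℤ))) (coords f i))) ≠ ⊥ := by
    apply LinearMap.ker_ne_bot_of_finrank_lt
    simpa using Nat.lt_succ_of_le hS
  obtain ⟨G, hG, hG0⟩ := Submodule.exists_mem_ne_zero_of_ne_bot h1
  refine ⟨G, hG0, fun i => ?_⟩
  by_cases hi : i ∈ S
  · have h2 := congrFun (LinearMap.mem_ker.1 hG) ⟨i, hi⟩
    refine Eq.trans ?_ h2
    exact Finset.sum_congr rfl fun l _ => mul_comm _ _
  · simp [hf i hi]

omit h in
lemma zpow_mul_zpow_neg (a b : ℤ) (f : Alg σ n lam) :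
    (T ^ b) ((T ^ (-(b + a))) f * e) = (T ^ (-a)) f * (T ^ b) e := by
  rw [map_mul, ← RingAut.mul_apply, ← zpow_add]
  congr 3
  ring

omit h in
lemma coords_zpow (hT : ∀ f i, coords (T f) i = θ (coords f i)) (z : ℤ) (f : Alg σ n lam)
    (i : Fin n) : coords ((T ^ z) f) i = (θ ^ z) (coords f i) := by
  induction z using Int.induction_on generalizing f with
  | zero => simp
  | succ j ih => rw [zpow_add_one, zpow_add_one, RingAut.mul_apply, RingAut.mul_apply, ih, hT]
  | pred j ih =>
    rw [zpow_sub_one, zpow_sub_one, RingAut.mul_apply, RingAut.mul_apply, ih]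
    congr 1
    apply θ.injective
    rw [← hT, ← RingAut.mul_apply, ← RingAut.mul_apply]
    simp

/-- A relation between the coefficients of the error is one between the syndromes
`T ^ (-b) f * e`, for all shifts. -/
lemma syndrome_relation (hT : ∀ f i, coords (T f) i = θ (coords f i)) {L : ℕ} {G : Fin L → K}
    {f : Alg σ n lam} (hG : ∀ i, ∑ l, G l * (θ ^ (-(l : ℤ))) (coords f i) = 0)
    (b : ℤ) (i : Fin n) :
    ∑ l, G l * (θ ^ b) (coords ((T ^ (-(b + l))) f * e) i) = 0 := by
  have h1 : ∑ l, cst σ n lam (G l) * (T ^ (-(l : ℤ))) f = 0 := by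
    apply h.coords_injective
    funext i
    rw [h.coords_sum, h.coords_zero, Finset.sum_apply]
    simp only [h.coords_cst_mul, coords_zpow hT]
    exact hG i
  have h2 := congrArg (fun g => coords (g * (T ^ b) e) i) h1
  simp only [Finset.sum_mul, h.coords_sum, Finset.sum_apply, zero_mul, h.coords_zero,
    Pi.zero_apply, mul_assoc, h.coords_cst_mul, ← zpow_mul_zpow_neg] at h2
  simpa only [coords_zpow hT] using h2

/-- A relation between sufficiently many consecutive syndromes is one between the coefficients
of the error. -/
lemma annihilator_of_syndrome_relation (hT : ∀ f i, coords (T f) i = θ (coords f i))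
    (he : ∑ b ∈ Finset.range N, (T ^ (b : ℤ)) e = 1) {L : ℕ} {G : Fin L → K}
    {f : Alg σ n lam} {s : ℕ} (S : Finset (Fin n)) (hS : S.card ≤ s) (hf : ∀ i ∉ S, coords f i = 0)
    (hG : ∀ b < s, ∀ i,
      ∑ l, G l * (θ ^ (b : ℤ)) (coords ((T ^ (-((b : ℤ) + l))) f * e) i) = 0)
    (i : Fin n) : ∑ l, G l * (θ ^ (-(l : ℤ))) (coords f i) = 0 := by
  have h1 : ∀ i, coords (∑ l, cst σ n lam (G l) * (T ^ (-(l : ℤ))) f) i =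
      ∑ l, G l * (θ ^ (-(l : ℤ))) (coords f i) := by
    intro i
    rw [h.coords_sum, Finset.sum_apply]
    simp only [h.coords_cst_mul, coords_zpow hT]
  have h2 : ∑ l, cst σ n lam (G l) * (T ^ (-(l : ℤ))) f = 0 := by
    refine h.eq_zero_of_mul_eq_zero hT he s 0 _ S hS (fun i hi => ?_) fun b hb0 hb => ?_
    · rw [h1, hf i hi]; simp
    · lift b to ℕ using hb0
      apply h.coords_injective
      funext i
      rw [h.coords_zero, Finset.sum_mul, h.coords_sum, Finset.sum_apply]
      simp only [mul_assoc, h.coords_cst_mul, ← zpow_mul_zpow_neg]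
      simp only [coords_zpow hT]
      exact hG b (by omega) i
  rw [← h1, h2, h.coords_zero]
  rfl

/-- The error, in terms of the syndromes with negative index. -/
lemma eq_sum_syndromes (hT : ∀ f i, coords (T f) i = θ (coords f i))
    (he : ∑ b ∈ Finset.range N, (T ^ (b : ℤ)) e = 1) (hN : T ^ N = 1) (f : Alg σ n lam)
    (i : Fin n) : coords f i =
      ∑ b ∈ Finset.range N, (θ ^ (b : ℤ)) (coords ((T ^ ((N : ℤ) - b)) f * e) i) := by
  have h1 : f = ∑ b ∈ Finset.range N, (T ^ (b : ℤ)) ((T ^ ((N : ℤ) - b)) f * e) := by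
    conv_lhs => rw [← mul_one f, ← he, Finset.mul_sum]
    refine Finset.sum_congr rfl fun b _ => ?_
    rw [map_mul, ← RingAut.mul_apply, ← zpow_add, add_sub_cancel, zpow_natCast T N, hN]
    rfl
  conv_lhs => rw [h1]
  rw [h.coords_sum, Finset.sum_apply]
  simp only [coords_zpow hT]

end IsCyclicDatum

/-! ### Correctness of the elimination -/

section elimination

variable {F : Type u} [Field F]

lemma pflag_eq_zero (p : List F) : pflag p = 0 ↔ polyOf p = 0 := by
  classical
  have key : ∀ (p : List F) (acc : F), p.foldl (fun acc a => if a = 0 then acc else 1) acc = 0 ↔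
      acc = 0 ∧ polyOf p = 0 := by
    intro p
    induction p with
    | nil => simp [polyOf]
    | cons a p ih =>
      intro acc
      have h1 : polyOf (a :: p) = 0 ↔ a = 0 ∧ polyOf p = 0 := by
        constructor
        · intro h
          have h2 : a = 0 := by simpa [polyOf] using congrArg (fun q => q.coeff 0) h
          refine ⟨h2, ?_⟩
          simpa [polyOf, h2] using h
        · rintro ⟨rfl, h⟩
          simp [polyOf, h]
      rw [List.foldl_cons, ih, h1]
      split <;> simp_all
  rw [pflag, key]; simp

/-- The vector space spanned by a list of polynomials. -/
def pspan (B : List (List F)) : Submodule F F[X] := Submodule.span F (polyOf '' {q | q ∈ B})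

lemma mem_pspan {B : List (List F)} {q : List F} (h : q ∈ B) : polyOf q ∈ pspan B :=
  Submodule.subset_span ⟨q, h, rfl⟩

lemma coeff_zero_polyOf (q : List F) : (polyOf q).coeff 0 = q.headD 0 := by
  cases q <;> simp [polyOf]

lemma pivot_spec (B : List (List F)) : polyOf (pivot B) ∈ pspan B ∧
    ((polyOf (pivot B)).coeff 0 = 0 → ∀ q ∈ B, (polyOf q).coeff 0 = 0) := by
  classical
  have key : ∀ (B : List (List F)) (acc : List F),
      (B.foldl (fun acc q => if q.headD 0 = 0 then acc else q) acc = acc ∨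
        B.foldl (fun acc q => if q.headD 0 = 0 then acc else q) acc ∈ B) ∧
      ((B.foldl (fun acc q => if q.headD 0 = 0 then acc else q) acc).headD 0 = 0 →
        acc.headD 0 = 0 ∧ ∀ q ∈ B, q.headD 0 = 0) := by
    intro B
    induction B with
    | nil => simp
    | cons q B ih =>
      intro acc
      rw [List.foldl_cons]
      obtain ⟨h1, h2⟩ := ih (if q.headD 0 = 0 then acc else q)
      split at h1 <;> rename_i hq <;> simp only [hq, if_true, if_false, List.mem_cons] at h2 ⊢
      · exact ⟨h1.imp id Or.inr, fun h => ⟨(h2 h).1, by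
          rintro r (rfl | hr); exacts [hq, (h2 h).2 r hr]⟩⟩
      · exact ⟨Or.inr h1, fun h => (h2 h).1.elim⟩
  obtain ⟨h1, h2⟩ := key B []
  refine ⟨?_, fun h q hq => ?_⟩
  · rcases h1 with h1 | h1
    · rw [pivot, h1]; exact zero_mem _
    · exact mem_pspan h1
  · rw [coeff_zero_polyOf] at h ⊢
    exact (h2 h).2 q hq

lemma pick_spec (B : List (List F)) : polyOf (pick B) ∈ pspan B ∧
    (polyOf (pick B) = 0 → pspan B = ⊥) := by
  classical
  have key : ∀ (B : List (List F)) (acc : List F),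
      (B.foldl (fun acc q => if pflag q = 0 then acc else q) acc = acc ∨
        B.foldl (fun acc q => if pflag q = 0 then acc else q) acc ∈ B) ∧
      (pflag (B.foldl (fun acc q => if pflag q = 0 then acc else q) acc) = 0 →
        pflag acc = 0 ∧ ∀ q ∈ B, pflag q = 0) := by
    intro B
    induction B with
    | nil => simp
    | cons q B ih =>
      intro acc
      rw [List.foldl_cons]
      obtain ⟨h1, h2⟩ := ih (if pflag q = 0 then acc else q)
      split at h1 <;> rename_i hq <;> simp only [hq, if_true, if_false, List.mem_cons] at h2 ⊢
      · exact ⟨h1.imp id Or.inr, fun h => ⟨(h2 h).1, by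
          rintro r (rfl | hr); exacts [hq, (h2 h).2 r hr]⟩⟩
      · exact ⟨Or.inr h1, fun h => (h2 h).1.elim⟩
  obtain ⟨h1, h2⟩ := key B []
  refine ⟨?_, fun h => ?_⟩
  · rcases h1 with h1 | h1
    · rw [pick, h1]; exact zero_mem _
    · exact mem_pspan h1
  · rw [← pflag_eq_zero] at h
    rw [pspan, Submodule.span_eq_bot]
    rintro _ ⟨q, hq, rfl⟩
    exact (pflag_eq_zero q).1 ((h2 h).2 q hq)

/-- The reduction modulo a polynomial `g` with nonzero constant coefficient (or modulo `0`),
divided by the variable. -/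
def elimMap (g : F[X]) : F[X] →ₗ[F] F[X] where
  toFun p := divX (p - C (p.coeff 0 * (g.coeff 0)⁻¹) * g)
  map_add' p q := by
    rw [← divX_add]; congr 1; simp only [coeff_add, add_mul, C_add]; ring
  map_smul' c p := by
    ext i
    simp only [coeff_divX, coeff_smul, coeff_sub, smul_eq_mul, coeff_C_mul, RingHom.id_apply]
    ring

lemma polyOf_tail (q : List F) : polyOf q.tail = divX (polyOf q) := by
  cases q with
  | nil => simp [polyOf]
  | cons a q => ext i; simp [polyOf, coeff_divX]

lemma pspan_elimStep (B : List (List F)) (p : F[X]) :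
    p ∈ pspan (elimStep B) ↔ X * p ∈ pspan B := by
  obtain ⟨h1, h2⟩ := pivot_spec B
  have h3 : pspan (elimStep B) = (pspan B).map (elimMap (polyOf (pivot B))) := by
    rw [pspan, pspan, Submodule.map_span, ← Set.image_comp]
    congr 1
    ext r
    simp only [elimStep, Set.mem_image, Set.mem_ofPred_eq, List.mem_map, Function.comp_apply,
      exists_exists_and_eq_and]
    refine exists_congr fun q => and_congr_right fun _ => ?_
    rw [polyOf_tail, polyOf_padd, polyOf_psmul]
    simp only [elimMap, LinearMap.coe_mk, AddHom.coe_mk, coeff_zero_polyOf]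
    rw [neg_mul, C_neg, neg_mul, ← sub_eq_add_neg]
  have h4 : ∀ q ∈ pspan B, X * elimMap (polyOf (pivot B)) q =
      q - C (q.coeff 0 * ((polyOf (pivot B)).coeff 0)⁻¹) * polyOf (pivot B) := by
    intro q hq
    have h5 : (q - C (q.coeff 0 * ((polyOf (pivot B)).coeff 0)⁻¹) *
        polyOf (pivot B)).coeff 0 = 0 := by
      rw [coeff_sub, coeff_C_mul]
      by_cases h0 : (polyOf (pivot B)).coeff 0 = 0
      · have : q.coeff 0 = 0 := by
          induction hq using Submodule.span_induction with
          | mem q hq => obtain ⟨q, hq, rfl⟩ := hq; exact h2 h0 q hq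
          | zero => simp
          | add p q _ _ hp hq => simp [hp, hq]
          | smul c p _ hp => simp [hp]
        simp [this]
      · field_simp; ring
    have h6 := X_mul_divX_add (q - C (q.coeff 0 * ((polyOf (pivot B)).coeff 0)⁻¹) *
      polyOf (pivot B))
    rw [h5, C_0, add_zero] at h6
    exact h6
  rw [h3, Submodule.mem_map]
  constructor
  · rintro ⟨q, hq, rfl⟩
    rw [h4 q hq, ← smul_eq_C_mul]
    exact sub_mem hq (Submodule.smul_mem _ _ h1)
  · intro hp
    refine ⟨_, hp, ?_⟩
    ext i
    simp [elimMap, coeff_divX]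

lemma pspan_elim (Z : List Unit) (B : List (List F)) (p : F[X]) :
    p ∈ pspan (Z.foldl (fun B _ => elimStep B) B) ↔ X ^ Z.length * p ∈ pspan B := by
  induction Z generalizing B p with
  | nil => simp
  | cons a Z ih =>
    rw [List.foldl_cons, ih, pspan_elimStep, List.length_cons, pow_succ', mul_assoc]

/-- The generators in `relation`. -/
lemma mem_generators (Z D : List Unit) (C : List (List F)) (q : List F) :
    q ∈ (((upto C).zip C).map fun y => shifts Z D y.1 y.2).flatten ↔
      ∃ j < C.length, ∃ i < D.length, q = zeros (List.replicate i ()) ++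
        padd (C.getD j []) (zeros (Z ++ ((List.replicate j ()).map fun _ => D).flatten) ++ [1]) := by
  have h1 : (upto C).zip C = (List.range C.length).map fun j =>
      (List.replicate j (), C.getD j []) := by
    rw [upto_eq]
    refine List.ext_getElem (by simp) fun i hi hi' => ?_
    simp only [List.length_map, List.length_range] at hi'
    simp [hi']
  rw [h1]
  simp only [shifts, upto_eq, List.map_map, List.mem_flatten, List.mem_map, List.mem_range,
    Function.comp_apply]
  constructor
  · rintro ⟨_, ⟨j, hj, rfl⟩, hq⟩
    obtain ⟨i, hi, rfl⟩ := List.mem_map.1 hq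
    exact ⟨j, hj, i, List.mem_range.1 hi, rfl⟩
  · rintro ⟨j, hj, i, hi, rfl⟩
    exact ⟨_, ⟨j, hj, rfl⟩, List.mem_map.2 ⟨i, List.mem_range.2 hi, rfl⟩⟩

lemma length_flatten_replicate (j : ℕ) (D : List Unit) :
    ((List.replicate j ()).map fun _ => D).flatten.length = j * D.length := by
  simp [List.map_replicate]

lemma polyOf_generator (Z D : List Unit) (c : List F) (i j : ℕ) :
    polyOf (zeros (List.replicate i ()) ++
      padd c (zeros (Z ++ ((List.replicate j ()).map fun _ => D).flatten) ++ [1])) =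
    X ^ i * (polyOf c + X ^ (Z.length + j * D.length)) := by
  rw [polyOf_append, polyOf_padd, polyOf_append, polyOf_zeros, polyOf_zeros, length_zeros,
    length_zeros, List.length_append, length_flatten_replicate, List.length_replicate]
  simp [polyOf]

lemma coeff_chunk (D : List Unit) (j : ℕ) (p : List F) (i : ℕ) :
    (polyOf (chunk D (List.replicate j ()) p)).coeff i =
      if i < D.length then (polyOf p).coeff (j * D.length + i) else 0 := by
  rw [coeff_polyOf, coeff_polyOf, chunk, length_flatten_replicate]
  split
  · rename_i h
    rw [List.getD_eq_getElem _ _ (by simp; omega)]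
    simp only [List.getElem_map, List.getElem_zip]
    by_cases h2 : j * D.length + i < p.length
    · rw [List.getElem_append_left (by simp; omega), List.getElem_drop,
        List.getD_eq_getElem _ _ h2]
    · rw [List.getElem_append_right (by simp; omega), List.getD_eq_default _ _ (by omega)]
      simp [zeros]
  · rename_i h
    rw [List.getD_eq_default]
    simp only [List.length_map, List.length_zip]
    omega

lemma length_chunk (D j : List Unit) (p : List F) : (chunk D j p).length = D.length := by
  simp [chunk]

lemma length_relation (D : List Unit) (C : List (List F)) :
    (relation D C).length = C.length := by
  simp [relation, upto_eq]

lemma length_of_mem_relation (D : List Unit) (C : List (List F)) {g : List F}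
    (hg : g ∈ relation D C) : g.length = D.length := by
  obtain ⟨j, -, rfl⟩ := List.mem_map.1 hg
  exact length_chunk _ _ _

/-- Polynomials of degree less than `d` can be recovered from `∑ l, Q l * X ^ (l * d)`. -/
lemma coeff_sum_mul_X_pow {Q : ℕ → F[X]} {d L : ℕ} (hQ : ∀ l < L, Q l ∈ degreeLT F d) {j i : ℕ}
    (hj : j < L) (hi : i < d) :
    (∑ l ∈ Finset.range L, Q l * X ^ (l * d)).coeff (j * d + i) = (Q j).coeff i := by
  rw [finsetSum_coeff, Finset.sum_eq_single j]
  · rw [add_comm, coeff_mul_X_pow]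
  · intro l hlL hl
    rw [coeff_mul_X_pow']
    split
    · rename_i hle
      have h1 : l < j := by
        by_contra h2
        have h4 := Nat.mul_le_mul_right d (show j + 1 ≤ l by omega)
        rw [add_mul, one_mul] at h4
        omega
      have h2 := Nat.mul_le_mul_right d (show l + 1 ≤ j from h1)
      rw [add_mul, one_mul] at h2
      exact coeff_eq_zero_of_degree_lt ((mem_degreeLT.1 (hQ l (Finset.mem_range.1 hlL))).trans_le
        (by exact_mod_cast (show d ≤ j * d + i - l * d by omega)))
    · rfl
  · intro h; exact absurd (Finset.mem_range.2 hj) h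

/-- If there is a nontrivial relation with coefficients of degree less than the length of `D`,
then `relation` finds one. As `∑ j, P j * C j` has degree less than `Z`, the equation
`X ^ Z * p = ∑ j, P j * (C j + X ^ (Z + j * D))` splits into `∑ j, P j * C j = 0` and
`p = ∑ j, P j * X ^ (j * D)`. -/
theorem relation_spec (D : List Unit) (C : List (List F)) (P : ℕ → F[X])
    (hP : ∀ j, P j ∈ degreeLT F D.length) (h0 : ∃ j < C.length, P j ≠ 0)
    (hC : ∑ j ∈ Finset.range C.length, P j * polyOf (C.getD j []) = 0) :
    (∃ j < C.length, polyOf ((relation D C).getD j []) ≠ 0) ∧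
    ∑ j ∈ Finset.range C.length, polyOf ((relation D C).getD j []) * polyOf (C.getD j []) = 0 := by
  classical
  obtain ⟨d, hd⟩ : ∃ d, d = D.length := ⟨_, rfl⟩
  obtain ⟨Z, hZ⟩ : ∃ Z, Z = D ++ unary C.flatten := ⟨_, rfl⟩
  obtain ⟨V, hV⟩ : ∃ V, V = pspan (((upto C).zip C).map fun y => shifts Z D y.1 y.2).flatten :=
    ⟨_, rfl⟩
  obtain ⟨p, hp⟩ : ∃ p, p = pick (Z.foldl (fun B _ => elimStep B)
    (((upto C).zip C).map fun y => shifts Z D y.1 y.2).flatten) := ⟨_, rfl⟩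
  have hrel : ∀ j < C.length, (relation D C).getD j [] = chunk D (List.replicate j ()) p := by
    intro j hj
    rw [List.getD_eq_getElem _ _ (by rwa [length_relation])]
    simp [relation, upto_eq, hp, hZ]
  have hV1 : ∀ v ∈ V, ∃ Q : ℕ → F[X], (∀ j, Q j ∈ degreeLT F D.length) ∧
      v = ∑ j ∈ Finset.range C.length, Q j *
        (polyOf (C.getD j []) + X ^ (Z.length + j * D.length)) := by
    intro v hv
    rw [hV] at hv
    induction hv using Submodule.span_induction with
    | mem q hq =>
      obtain ⟨q, hq, rfl⟩ := hq
      obtain ⟨j, hj, i, hi, rfl⟩ := (mem_generators _ _ _ _).1 hq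
      refine ⟨fun l => if l = j then X ^ i else 0, fun l => ?_, ?_⟩
      · dsimp only
        split
        · rw [mem_degreeLT, degree_X_pow]; exact_mod_cast hi
        · exact zero_mem _
      · rw [polyOf_generator, Finset.sum_eq_single j]
        · simp
        · intro l _ hl; simp [hl]
        · intro h; exact absurd (Finset.mem_range.2 hj) h
    | zero => exact ⟨0, fun j => zero_mem _, by simp⟩
    | add a b _ _ ha hb =>
      obtain ⟨Q, hQ, rfl⟩ := ha
      obtain ⟨R, hR, rfl⟩ := hb
      exact ⟨Q + R, fun j => add_mem (hQ j) (hR j), by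
        simp only [Pi.add_apply, add_mul, Finset.sum_add_distrib]⟩
    | smul c a _ ha =>
      obtain ⟨Q, hQ, rfl⟩ := ha
      exact ⟨c • Q, fun j => Submodule.smul_mem _ _ (hQ j), by
        simp only [Pi.smul_apply, smul_mul_assoc, Finset.smul_sum]⟩
  have hV2 : ∀ (Q : F[X]), Q ∈ degreeLT F D.length → ∀ j < C.length,
      Q * (polyOf (C.getD j []) + X ^ (Z.length + j * D.length)) ∈ V := by
    intro Q hQ j hj
    rw [degreeLT_eq_span_X_pow] at hQ
    induction hQ using Submodule.span_induction with
    | mem q hq =>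
      simp only [Finset.coe_image, Set.mem_image, Finset.coe_range, Set.mem_Iio] at hq
      obtain ⟨i, hi, rfl⟩ := hq
      rw [← polyOf_generator, hV]
      exact mem_pspan ((mem_generators _ _ _ _).2 ⟨j, hj, i, hi, rfl⟩)
    | zero => rw [zero_mul]; exact zero_mem _
    | add a b _ _ ha hb => rw [add_mul]; exact add_mem ha hb
    | smul c a _ ha => rw [smul_mul_assoc]; exact Submodule.smul_mem _ _ ha
  have hW : ∀ q, q ∈ pspan (Z.foldl (fun B _ => elimStep B)
      (((upto C).zip C).map fun y => shifts Z D y.1 y.2).flatten) ↔ X ^ Z.length * q ∈ V := by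
    intro q; rw [pspan_elim, hV]
  obtain ⟨hp1, hp2⟩ := pick_spec (Z.foldl (fun B _ => elimStep B)
      (((upto C).zip C).map fun y => shifts Z D y.1 y.2).flatten)
  rw [← hp] at hp1 hp2
  have hco : ∀ Q : ℕ → F[X], (∀ j, Q j ∈ degreeLT F D.length) → ∀ j < C.length, ∀ i < D.length,
      (∑ l ∈ Finset.range C.length, Q l * X ^ (l * D.length)).coeff (j * D.length + i) =
        (Q j).coeff i := fun Q hQ j hj i hi => coeff_sum_mul_X_pow (fun l _ => hQ l) hj hi
  -- the given relation shows that the space found by the elimination is not zero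
  have hne : polyOf p ≠ 0 := by
    intro h
    have h1 := hp2 h
    have h2 : (∑ l ∈ Finset.range C.length, P l * X ^ (l * D.length)) = 0 := by
      rw [← Submodule.mem_bot F, ← h1, hW]
      have h3 : X ^ Z.length * ∑ l ∈ Finset.range C.length, P l * X ^ (l * D.length) =
          ∑ j ∈ Finset.range C.length, P j *
            (polyOf (C.getD j []) + X ^ (Z.length + j * D.length)) := by
        simp only [mul_add, Finset.sum_add_distrib]
        rw [hC, zero_add, Finset.mul_sum]
        exact Finset.sum_congr rfl fun j _ => by rw [pow_add]; ring
      rw [h3]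
      exact sum_mem fun j hj => hV2 _ (hP j) j (Finset.mem_range.1 hj)
    obtain ⟨j, hj, hj0⟩ := h0
    apply hj0
    ext i
    by_cases hi : i < D.length
    · rw [← hco P hP j hj i hi, h2, coeff_zero, coeff_zero]
    · rw [coeff_zero]
      exact coeff_eq_zero_of_degree_lt ((mem_degreeLT.1 (hP j)).trans_le
        (by exact_mod_cast not_lt.1 hi))
  obtain ⟨Q, hQ, hpQ⟩ := hV1 _ ((hW _).1 hp1)
  have hlow : ∑ j ∈ Finset.range C.length, Q j * polyOf (C.getD j []) ∈ degreeLT F Z.length := by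
    refine sum_mem fun j hj => ?_
    rcases eq_or_ne (Q j * polyOf (C.getD j [])) 0 with h1 | h1
    · rw [h1]; exact zero_mem _
    have hj := Finset.mem_range.1 hj
    have h2 := hQ j
    have h3 := polyOf_mem_degreeLT (C.getD j [])
    have h4 : (C.getD j []).length ≤ C.flatten.length := by
      rw [List.getD_eq_getElem _ _ hj, List.length_flatten]
      exact List.le_sum_of_mem (List.mem_map_of_mem (List.getElem_mem hj))
    rw [mem_degreeLT, degree_eq_natDegree h1]
    rw [mem_degreeLT, degree_eq_natDegree (left_ne_zero_of_mul h1)] at h2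
    rw [mem_degreeLT, degree_eq_natDegree (right_ne_zero_of_mul h1)] at h3
    have h5 : (Q j).natDegree < D.length := by exact_mod_cast h2
    have h6 : (polyOf (C.getD j [])).natDegree < (C.getD j []).length := by exact_mod_cast h3
    rw [natDegree_mul (left_ne_zero_of_mul h1) (right_ne_zero_of_mul h1), hZ, List.length_append,
      unary, List.length_map]
    exact_mod_cast (by omega)
  have hsplit : ∑ j ∈ Finset.range C.length, Q j * polyOf (C.getD j []) =
      X ^ Z.length * (polyOf p - ∑ l ∈ Finset.range C.length, Q l * X ^ (l * D.length)) := by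
    rw [mul_sub, hpQ, Finset.mul_sum, ← Finset.sum_sub_distrib]
    refine Finset.sum_congr rfl fun j _ => ?_
    rw [pow_add]; ring
  have hzero : polyOf p - ∑ l ∈ Finset.range C.length, Q l * X ^ (l * D.length) = 0 := by
    by_contra hne0
    rw [hsplit, mem_degreeLT, degree_mul, degree_X_pow] at hlow
    rw [degree_eq_natDegree hne0] at hlow
    have : Z.length + (polyOf p - ∑ l ∈ Finset.range C.length,
      Q l * X ^ (l * D.length)).natDegree < Z.length := by exact_mod_cast hlow
    omega
  have hch : ∀ j < C.length, polyOf ((relation D C).getD j []) = Q j := by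
    intro j hj
    rw [hrel j hj]
    ext i
    rw [coeff_chunk]
    split
    · rename_i hi
      rw [sub_eq_zero.1 hzero, hco Q hQ j hj i hi]
    · rename_i hi
      exact (coeff_eq_zero_of_degree_lt ((mem_degreeLT.1 (hQ j)).trans_le
        (by exact_mod_cast not_lt.1 hi))).symm
  constructor
  · by_contra! hall
    apply hne
    rw [sub_eq_zero.1 hzero]
    refine Finset.sum_eq_zero fun j hj => ?_
    rw [← hch j (Finset.mem_range.1 hj), hall j (Finset.mem_range.1 hj), zero_mul]
  · rw [Finset.sum_congr rfl fun j hj => by rw [hch j (Finset.mem_range.1 hj)], hsplit, hzero,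
      mul_zero]

end elimination

/-! ### Relations of small degree -/

section siegel

variable {F : Type u} [Field F]

lemma mul_mem_degreeLT {p q : F[X]} {a b : ℕ} (hp : p ∈ degreeLT F a) (hq : q ∈ degreeLT F b) :
    p * q ∈ degreeLT F (a + b) := by
  rcases eq_or_ne (p * q) 0 with h | h
  · rw [h]; exact zero_mem _
  rw [mem_degreeLT, degree_eq_natDegree (left_ne_zero_of_mul h)] at hp
  rw [mem_degreeLT, degree_eq_natDegree (right_ne_zero_of_mul h)] at hq
  have h1 : p.natDegree < a := by exact_mod_cast hp
  have h2 : q.natDegree < b := by exact_mod_cast hq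
  rw [mem_degreeLT, degree_eq_natDegree h, natDegree_mul (left_ne_zero_of_mul h)
    (right_ne_zero_of_mul h)]
  exact_mod_cast (by omega)

/-- A system of homogeneous linear equations over `F[X]` with a nonzero solution has one of small
degree: at most `tau` of the equations are needed, and solutions of degree less than `D` are
found by comparing the numbers of coefficients. -/
lemma exists_small_solution {ι : Type v} {tau S D : ℕ} (M : ι → Fin (tau + 1) → F[X])
    (hM : ∀ i l, M i l ∈ degreeLT F S) {G : Fin (tau + 1) → RatFunc F} (hG : G ≠ 0)
    (hrel : ∀ i, ∑ l, G l * algebraMap F[X] (RatFunc F) (M i l) = 0) (hD : tau * S < D) :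
    ∃ P : Fin (tau + 1) → F[X], (∀ l, P l ∈ degreeLT F D) ∧ P ≠ 0 ∧
      ∀ i, ∑ l, P l * M i l = 0 := by
  classical
  let row : ι → Fin (tau + 1) → RatFunc F := fun i l => algebraMap F[X] (RatFunc F) (M i l)
  let fn : (Fin (tau + 1) → RatFunc F) → (Fin (tau + 1) → RatFunc F) →ₗ[RatFunc F] RatFunc F :=
    fun A => ∑ l, A l • LinearMap.proj l
  have hfn : ∀ A w, fn A w = ∑ l, A l * w l := by
    intro A w; simp [fn]
  obtain ⟨f, hf1, hf2, -⟩ := Submodule.exists_fun_fin_finrank_span_eq (RatFunc F) (Set.range row)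
  have hr : Module.finrank (RatFunc F) (Submodule.span (RatFunc F) (Set.range row)) ≤ tau := by
    have h1 : Submodule.span (RatFunc F) (Set.range row) ≠ ⊤ := by
      intro h
      have h2 : Submodule.span (RatFunc F) (Set.range row) ≤ LinearMap.ker (fn G) := by
        rw [Submodule.span_le]
        rintro _ ⟨i, rfl⟩
        exact (hfn _ _).trans (hrel i)
      rw [h] at h2
      apply hG
      funext l
      have h3 := LinearMap.mem_ker.1 (h2 (Submodule.mem_top (x := Pi.single l 1)))
      rw [hfn, Finset.sum_eq_single l] at h3
      · simpa using h3
      · intro b _ hb; rw [Pi.single_eq_of_ne hb, mul_zero]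
      · simp
    have h2 := Submodule.finrank_lt h1
    rw [Module.finrank_fin_fun] at h2
    omega
  revert f hr
  generalize Module.finrank (RatFunc F) (Submodule.span (RatFunc F) (Set.range row)) = r
  intro f hf1 hf2 hr
  choose ind hind using hf1
  let Φ : (Fin (tau + 1) → degreeLT F D) →ₗ[F] (Fin r → degreeLT F (D + S)) :=
    LinearMap.pi fun a => ∑ l, LinearMap.codRestrict (degreeLT F (D + S))
      ((LinearMap.mulRight F (M (ind a) l)).comp ((degreeLT F D).subtype.comp (LinearMap.proj l)))
      (fun P => mul_mem_degreeLT (P l).2 (hM _ _))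
  have hdim : ∀ d, Module.finrank F (degreeLT F d) = d := fun d => by
    rw [(degreeLTEquiv F d).finrank_eq, Module.finrank_fin_fun]
  have hfin : ∀ d, Module.Finite F (degreeLT F d) := fun d =>
    Module.Finite.equiv (degreeLTEquiv F d).symm
  have hker : LinearMap.ker Φ ≠ ⊥ := by
    have := hfin D
    have := hfin (D + S)
    apply LinearMap.ker_ne_bot_of_finrank_lt
    rw [Module.finrank_pi_fintype, Module.finrank_pi_fintype]
    simp only [hdim, Finset.sum_const, Finset.card_univ, Fintype.card_fin, smul_eq_mul]
    calc r * (D + S) ≤ tau * (D + S) := Nat.mul_le_mul_right _ hr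
      _ < (tau + 1) * D := by rw [mul_add, add_mul]; omega
  obtain ⟨P, hP, hP0⟩ := Submodule.exists_mem_ne_zero_of_ne_bot hker
  refine ⟨fun l => P l, fun l => (P l).2, fun h => hP0 ?_, fun i => ?_⟩
  · funext l; exact Subtype.ext (congrFun h l)
  have hPa : ∀ a, ∑ l, (P l : F[X]) * M (ind a) l = 0 := by
    intro a
    have h1 := congrArg Subtype.val (congrFun (LinearMap.mem_ker.1 hP) a)
    refine Eq.trans ?_ h1
    simp only [Φ, LinearMap.pi_apply, LinearMap.sum_apply, Submodule.coe_sum]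
    rfl
  have h2 : Submodule.span (RatFunc F) (Set.range row) ≤
      LinearMap.ker (fn fun l => algebraMap F[X] (RatFunc F) (P l)) := by
    rw [← hf2, Submodule.span_le]
    rintro _ ⟨a, rfl⟩
    rw [SetLike.mem_coe, LinearMap.mem_ker, hfn, ← hind a]
    have h3 := congrArg (algebraMap F[X] (RatFunc F)) (hPa a)
    rwa [map_sum, map_zero, Finset.sum_congr rfl fun l _ => map_mul _ _ _] at h3
  have h4 := LinearMap.mem_ker.1 (h2 (Submodule.subset_span ⟨i, rfl⟩))
  rw [hfn, Finset.sum_congr rfl fun l _ => (map_mul (algebraMap F[X] (RatFunc F)) _ _).symm,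
    ← map_sum] at h4
  exact (map_eq_zero_iff _ (RatFunc.algebraMap_injective F)).1 h4

lemma polyOf_pack (W : List Unit) (l : List (List F)) :
    polyOf (pack W l) =
      ∑ i ∈ Finset.range l.length, polyOf (l.getD i []) * X ^ (i * W.length) := by
  induction l with
  | nil => simp [pack, polyOf]
  | cons p l ih =>
    have : pack W (p :: l) = padd p (zeros W ++ pack W l) := rfl
    rw [this, polyOf_padd, polyOf_append, polyOf_zeros, length_zeros, ih, List.length_cons,
      Finset.sum_range_succ', add_comm, zero_add, Finset.mul_sum]
    congr 1
    · refine Finset.sum_congr rfl fun i _ => ?_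
      rw [List.getD_cons_succ, add_mul, one_mul, pow_add]; ring
    · simp

/-- Relations between several polynomials at once, each list being packed into one polynomial. -/
lemma relation_pack_spec (D W : List Unit) {tau R S : ℕ} (bl : ℕ → List (List F))
    (hlen : ∀ j < tau + 1, (bl j).length = R) (hS : ∀ j < tau + 1, ∀ p ∈ bl j, p.length ≤ S)
    (hD : tau * S < D.length) (hW : D.length + S ≤ W.length) {G : Fin (tau + 1) → RatFunc F}
    (hG : G ≠ 0) (hrel : ∀ i < R, ∑ l, G l * pval ((bl l).getD i []) = 0) :
    (∃ j < tau + 1, pval ((relation D ((List.range (tau + 1)).map fun j =>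
      pack W (bl j))).getD j []) ≠ 0) ∧
    ∀ i < R, ∑ j ∈ Finset.range (tau + 1), pval ((relation D ((List.range (tau + 1)).map fun j =>
      pack W (bl j))).getD j []) * pval ((bl j).getD i []) = 0 := by
  obtain ⟨C, hC⟩ : ∃ C, C = (List.range (tau + 1)).map fun j => pack W (bl j) := ⟨_, rfl⟩
  have hCl : C.length = tau + 1 := by simp [hC]
  have hCj : ∀ j < tau + 1, C.getD j [] = pack W (bl j) := by
    intro j hj
    rw [List.getD_eq_getElem _ _ (by omega)]
    simp [hC]
  have hent : ∀ j < tau + 1, ∀ i, polyOf ((bl j).getD i []) ∈ degreeLT F S := by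
    intro j hj i
    refine degreeLT_mono ?_ (polyOf_mem_degreeLT _)
    by_cases hi : i < (bl j).length
    · rw [List.getD_eq_getElem _ _ hi]
      exact hS j hj _ (List.getElem_mem hi)
    · rw [List.getD_eq_default _ _ (not_lt.1 hi)]; simp
  obtain ⟨P, hP1, hP2, hP3⟩ := exists_small_solution
    (fun (i : Fin R) (l : Fin (tau + 1)) => polyOf ((bl l).getD i []))
    (fun i l => hent l l.2 i) hG (fun i => hrel i i.2) hD
  have hsum : ∀ Q : ℕ → F[X], ∑ j ∈ Finset.range C.length, Q j * polyOf (C.getD j []) =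
      ∑ i ∈ Finset.range R, (∑ j ∈ Finset.range (tau + 1), Q j * polyOf ((bl j).getD i [])) *
        X ^ (i * W.length) := by
    intro Q
    simp only [Finset.sum_mul]
    rw [Finset.sum_comm, hCl]
    refine Finset.sum_congr rfl fun j hj => ?_
    have hj := Finset.mem_range.1 hj
    rw [hCj j hj, polyOf_pack, hlen j hj, Finset.mul_sum]
    exact Finset.sum_congr rfl fun i _ => by ring
  rw [← hC]
  obtain ⟨h1, h2⟩ := relation_spec D C (fun j => if hj : j < tau + 1 then P ⟨j, hj⟩ else 0)
    (fun j => by split <;> [exact hP1 _; exact zero_mem _])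
    (by
      by_contra! h
      apply hP2
      funext l
      simpa [Nat.le_of_lt_succ l.2] using h l (by omega))
    (by
      rw [hsum]
      refine Finset.sum_eq_zero fun i hi => ?_
      have h3 := hP3 ⟨i, Finset.mem_range.1 hi⟩
      rw [Finset.sum_range]
      simp only [Fin.is_lt, dif_pos, Fin.eta]
      rw [h3, zero_mul])
  refine ⟨?_, fun i hi => ?_⟩
  · obtain ⟨j, hj, hj0⟩ := h1
    exact ⟨j, by omega, fun h => hj0 (pval_eq_zero.1 h)⟩
  · rw [hsum] at h2
    have h5 : ∀ i < R, ∑ j ∈ Finset.range (tau + 1), polyOf ((relation D C).getD j []) *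
        polyOf ((bl j).getD i []) ∈ degreeLT F W.length := by
      intro i _
      refine sum_mem fun j hj => degreeLT_mono hW (mul_mem_degreeLT ?_
        (hent j (Finset.mem_range.1 hj) i))
      have h6 : (relation D C).getD j [] ∈ relation D C := by
        rw [List.getD_eq_getElem _ _ (by rw [length_relation, hCl]; exact Finset.mem_range.1 hj)]
        exact List.getElem_mem _
      rw [← length_of_mem_relation D C h6]
      exact polyOf_mem_degreeLT _
    have h7 : ∑ j ∈ Finset.range (tau + 1), polyOf ((relation D C).getD j []) *
        polyOf ((bl j).getD i []) = 0 := by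
      ext a
      by_cases ha : a < W.length
      · rw [← coeff_sum_mul_X_pow h5 hi ha, h2, coeff_zero, coeff_zero]
      · rw [coeff_zero]
        exact coeff_eq_zero_of_degree_lt ((mem_degreeLT.1 (h5 i hi)).trans_le
          (by exact_mod_cast not_lt.1 ha))
    simpa [pval] using congrArg (algebraMap F[X] (RatFunc F)) h7

end siegel

/-! ### The meaning of fractions and vectors -/

section fractions

variable {F : Type u} [Field F]

/-- The fraction `x` represents `y`, and its numerator and denominator have the same number of
entries, so that they are multiplied by the same factor under the homogenised action of
automorphisms. -/
structure IsFrac (x : List F × List F) (y : RatFunc F) : Prop where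
  ne_zero : pval x.2 ≠ 0
  eq : pval x.1 = y * pval x.2
  length : x.1.length = x.2.length

lemma IsFrac.pos {x : List F × List F} {y : RatFunc F} (h : IsFrac x y) : x.1 ≠ [] ∧ x.2 ≠ [] := by
  have h2 : x.2 ≠ [] := fun h2 => h.ne_zero (by rw [h2, pval_nil])
  refine ⟨fun h1 => h2 ?_, h2⟩
  rw [← List.length_eq_zero_iff, ← h.length, h1, List.length_nil]

lemma isFrac_fpad {x : List F × List F} {y : RatFunc F} (h0 : pval x.2 ≠ 0)
    (h : pval x.1 = y * pval x.2) : IsFrac (fpad x) y := by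
  have h1 : ∀ p q : List F, pval (p ++ (zeros q : List F)) = pval p := fun p q => by
    rw [pval, polyOf_append, polyOf_zeros, mul_zero, add_zero, pval]
  refine ⟨?_, ?_, ?_⟩
  · rwa [fpad, h1]
  · simpa only [fpad, h1] using h
  · simp [fpad, add_comm]

lemma IsFrac.fadd {x x' : List F × List F} {y y' : RatFunc F} (h : IsFrac x y)
    (h' : IsFrac x' y') : IsFrac (fadd x x') (y + y') := by
  refine ⟨?_, ?_, ?_⟩
  · simp [SkewConstacyclic.fadd, h.ne_zero, h'.ne_zero]
  · simp only [SkewConstacyclic.fadd, pval_padd, pval_pmul, h.eq, h'.eq]; ring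
  · have h1 := length_pmul x.1 x'.2 h'.pos.2 h.pos.1
    have h2 := length_pmul x'.1 x.2 h.pos.2 h'.pos.1
    have h3 := length_pmul x.2 x'.2 h'.pos.2 h.pos.2
    have := h.length
    have := h'.length
    simp only [SkewConstacyclic.fadd, length_padd]
    omega

lemma IsFrac.fmul {x x' : List F × List F} {y y' : RatFunc F} (h : IsFrac x y)
    (h' : IsFrac x' y') : IsFrac (fmul x x') (y * y') := by
  refine ⟨?_, ?_, ?_⟩
  · simp [SkewConstacyclic.fmul, h.ne_zero, h'.ne_zero]
  · simp only [SkewConstacyclic.fmul, pval_pmul, h.eq, h'.eq]; ring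
  · have h1 := length_pmul x.1 x'.1 h'.pos.1 h.pos.1
    have h3 := length_pmul x.2 x'.2 h'.pos.2 h.pos.2
    have := h.length
    have := h'.length
    simp only [SkewConstacyclic.fmul]
    omega

lemma isFrac_zero : IsFrac (([0], [1]) : List F × List F) 0 := by
  refine ⟨?_, ?_, rfl⟩ <;> simp

lemma isFrac_neg_one : IsFrac (([-1], [1]) : List F × List F) (-1) := by
  refine ⟨?_, ?_, rfl⟩ <;> simp

variable {s : (List F × List F) × List Unit} {σ : RingAut (RatFunc F)}

lemma IsFrac.fhom (hs : IsAutData s.1 σ) {x : List F × List F} {y : RatFunc F} (h : IsFrac x y) :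
    IsFrac (fhom s.1 x) (σ y) := by
  obtain ⟨κ, hκ, h1⟩ := hs.exists_factor x.1.length 1
  have h2 := h1 x.1 rfl
  have h3 := h1 x.2 h.length.symm
  rw [Function.iterate_one, pow_one] at h2 h3
  refine ⟨?_, ?_, ?_⟩
  · simp only [SkewConstacyclic.fhom, h3]
    exact mul_ne_zero hκ ((map_ne_zero_iff σ σ.injective).2 h.ne_zero)
  · simp only [SkewConstacyclic.fhom, h3, h2, h.eq, map_mul]; ring
  · simp [SkewConstacyclic.fhom, h.length]

lemma ptwist_eq (s : (List F × List F) × List Unit) (p : List F) :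
    ptwist s p = (phom s.1)^[s.2.length] p := by
  unfold ptwist
  generalize s.2 = m
  induction m generalizing p with
  | nil => rfl
  | cons a m ih => rw [List.foldl_cons, ih, List.length_cons, Function.iterate_succ_apply]

lemma length_ptwist_iterate (s : (List F × List F) × List Unit) (j : ℕ) (p : List F) :
    ((ptwist s)^[j] p).length = p.length := by
  induction j with
  | zero => rfl
  | succ j ih => rw [Function.iterate_succ_apply', dim_ptwist, ih]

/-- Polynomials with the same number of entries are twisted with the same factor. -/
lemma exists_twist_factor (hs : IsAutData s.1 σ) (L j : ℕ) : ∃ κ : RatFunc F, κ ≠ 0 ∧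
    ∀ p : List F, p.length = L →
      pval ((ptwist s)^[j] p) = κ * ((σ ^ s.2.length) ^ (j : ℤ)) (pval p) := by
  obtain ⟨κ, hκ, h1⟩ := hs.exists_factor L (s.2.length * j)
  refine ⟨κ, hκ, fun p hp => ?_⟩
  have h2 : ptwist s = (phom s.1)^[s.2.length] := funext (ptwist_eq s)
  rw [zpow_natCast, ← pow_mul, ← h1 p hp, h2, ← Function.iterate_mul]

lemma IsFrac.ftwist (hs : IsAutData s.1 σ) {x : List F × List F} {y : RatFunc F}
    (h : IsFrac x y) : IsFrac (ftwist s x) ((σ ^ s.2.length) y) := by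
  obtain ⟨κ, hκ, h1⟩ := exists_twist_factor (s := s) hs x.1.length 1
  have h2 := h1 x.1 rfl
  have h3 := h1 x.2 h.length.symm
  rw [Function.iterate_one, Nat.cast_one, zpow_one] at h2 h3
  refine ⟨?_, ?_, ?_⟩
  · simp only [SkewConstacyclic.ftwist, h3]
    exact mul_ne_zero hκ ((map_ne_zero_iff _ (σ ^ s.2.length).injective).2 h.ne_zero)
  · simp only [SkewConstacyclic.ftwist, h3, h2, h.eq, map_mul]; ring
  · simp [SkewConstacyclic.ftwist, dim_ptwist, h.length]

/-- The entries of a list of fractions represent the entries of a vector. -/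
def IsVec {n : ℕ} (v : List (List F × List F)) (g : Fin n → RatFunc F) : Prop :=
  ∃ c : Fin n → List F × List F, v = List.ofFn c ∧ ∀ i, IsFrac (c i) (g i)

lemma IsVec.length {n : ℕ} {v : List (List F × List F)} {g : Fin n → RatFunc F}
    (h : IsVec v g) : v.length = n := by
  obtain ⟨c, rfl, -⟩ := h; simp

lemma IsVec.map {n : ℕ} {v : List (List F × List F)} {g g' : Fin n → RatFunc F} (h : IsVec v g)
    (φ : List F × List F → List F × List F)
    (hφ : ∀ x i, IsFrac x (g i) → IsFrac (φ x) (g' i)) : IsVec (v.map φ) g' := by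
  obtain ⟨c, rfl, hc⟩ := h
  exact ⟨φ ∘ c, List.map_ofFn .., fun i => hφ _ i (hc i)⟩

lemma zip_ofFn {α : Type v} {β : Type w} {n : ℕ} (a : Fin n → α) (b : Fin n → β) :
    (List.ofFn a).zip (List.ofFn b) = List.ofFn fun i => (a i, b i) :=
  List.ext_getElem (by simp) fun i _ _ => by simp

lemma IsVec.zip_map {n : ℕ} {v v' : List (List F × List F)} {g g' g'' : Fin n → RatFunc F}
    (h : IsVec v g) (h' : IsVec v' g') (φ : (List F × List F) × (List F × List F) → List F × List F)
    (hφ : ∀ x x' i, IsFrac x (g i) → IsFrac x' (g' i) → IsFrac (φ (x, x')) (g'' i)) :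
    IsVec ((v.zip v').map φ) g'' := by
  obtain ⟨c, rfl, hc⟩ := h
  obtain ⟨c', rfl, hc'⟩ := h'
  rw [zip_ofFn, List.map_ofFn]
  exact ⟨_, rfl, fun i => hφ _ _ i (hc i) (hc' i)⟩

lemma isVec_vsum {n : ℕ} {i : List (List F × List F)} {g : Fin n → RatFunc F} (h : IsVec i g)
    (k : ℕ) (a : ℕ → List (List F × List F)) (b : ℕ → Fin n → RatFunc F)
    (hab : ∀ j < k, IsVec (a j) (b j)) :
    IsVec (vsum i ((List.range k).map a)) (g + ∑ j ∈ Finset.range k, b j) := by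
  induction k with
  | zero => simpa [vsum] using h
  | succ k ih =>
    rw [List.range_succ, List.map_append, vsum, List.foldl_append, ← vsum,
      Finset.sum_range_succ, ← add_assoc]
    exact (ih fun j hj => hab j (by omega)).zip_map (hab k (by omega)) _
      fun x x' i h h' => h.fadd h'

variable {n : ℕ} {lam : RatFunc F}

lemma IsVec.xmul (h : IsCyclicDatum σ n lam) (hs : IsAutData s.1 σ) {l : List F × List F}
    (hl : IsFrac l lam) {v : List (List F × List F)} {f : Alg σ n lam} (hv : IsVec v (coords f)) :
    IsVec (xmul s.1 l v) (coords (gen σ n lam * f)) := by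
  obtain ⟨c, rfl, hc⟩ := hv
  obtain ⟨N, rfl⟩ : ∃ N, n = N + 1 := ⟨n - 1, by have := h.pos; omega⟩
  have h1 : SkewConstacyclic.xmul s.1 l (List.ofFn c) = List.ofFn (Fin.cons
      (SkewConstacyclic.fmul l (SkewConstacyclic.fhom s.1 (c (Fin.last N))))
      fun j : Fin N => SkewConstacyclic.fhom s.1 (c j.castSucc)) := by
    rw [SkewConstacyclic.xmul, List.ofFn_succ', List.concat_eq_append, List.reverse_append,
      List.reverse_singleton, List.singleton_append, listElim_cons, List.reverse_reverse,
      List.map_ofFn, List.ofFn_succ]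
    rfl
  refine ⟨_, h1, fun i => ?_⟩
  rw [h.coords_gen_mul]
  cases i using Fin.cases with
  | zero =>
    rw [Fin.cons_zero]
    exact hl.fmul ((hc (Fin.last N)).fhom hs)
  | succ j =>
    rw [Fin.cons_succ]
    exact (hc j.castSucc).fhom hs

lemma IsVec.xmul_iterate (h : IsCyclicDatum σ n lam) (hs : IsAutData s.1 σ) {l : List F × List F}
    (hl : IsFrac l lam) {v : List (List F × List F)} {f : Alg σ n lam} (hv : IsVec v (coords f))
    (j : ℕ) : IsVec ((SkewConstacyclic.xmul s.1 l)^[j] v) (coords (gen σ n lam ^ j * f)) := by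
  induction j with
  | zero => simpa using hv
  | succ j ih =>
    rw [Function.iterate_succ_apply', pow_succ', mul_assoc]
    exact ih.xmul h hs hl

lemma IsVec.amul (h : IsCyclicDatum σ n lam) (hs : IsAutData s.1 σ) {l : List F × List F}
    (hl : IsFrac l lam) {v v' : List (List F × List F)} {e f : Alg σ n lam}
    (hv : IsVec v (coords e)) (hv' : IsVec v' (coords f)) :
    IsVec (amul s.1 l v v') (coords (f * e)) := by
  have h0 := hv'.length
  obtain ⟨c, hc, hcf⟩ := hv'
  have h1 : (v'.zip (v :: (iters (SkewConstacyclic.xmul s.1 l) v' v).reverse)) =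
      (List.range n).map fun j => (v'.getD j ([], []), (SkewConstacyclic.xmul s.1 l)^[j] v) := by
    rw [iters_eq, List.reverse_reverse, h0]
    refine List.ext_getElem (by simp [h0]) fun i hi hi' => ?_
    have : i < n := by simpa using hi'
    simp only [List.getElem_zip, List.getElem_map, List.getElem_range]
    rw [List.getD_eq_getElem _ _ (by omega)]
    cases i <;> simp
  have h2 : coords (f * e) = 0 + ∑ j ∈ Finset.range n,
      fun i => (if hj : j < n then coords f ⟨j, hj⟩ else 0) * coords (gen σ n lam ^ j * e) i := by
    conv_lhs => rw [← h.ofCoeffs_coords f]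
    rw [ofCoeffs_eq, Finset.sum_mul, h.coords_sum, zero_add, Finset.sum_range]
    refine Finset.sum_congr rfl fun j _ => ?_
    funext i
    rw [mul_assoc, h.coords_cst_mul, dif_pos j.2]
  rw [SkewConstacyclic.amul, h1, List.map_map, h2]
  refine isVec_vsum (hv.map _ fun x i _ => isFrac_zero) n _ _ fun j hj => ?_
  rw [dif_pos hj]
  refine (hv.xmul_iterate h hs hl j).map _ fun x i hx => ?_
  have h3 : v'.getD j ([], []) = c ⟨j, hj⟩ := by
    rw [List.getD_eq_getElem _ _ (by omega)]; simp [hc]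
  dsimp only
  rw [h3]
  exact (hcf _).fmul hx

lemma IsVec.ftwist_iterate (hs : IsAutData s.1 σ) {T : RingAut (Alg σ n lam)}
    (hT : ∀ f i, coords (T f) i = (σ ^ s.2.length) (coords f i))
    {v : List (List F × List F)} {f : Alg σ n lam} (hv : IsVec v (coords f)) (j : ℕ) :
    IsVec ((List.map (SkewConstacyclic.ftwist s))^[j] v) (coords ((T ^ (j : ℤ)) f)) := by
  induction j with
  | zero => simpa using hv
  | succ j ih =>
    rw [Function.iterate_succ_apply', zpow_natCast, pow_succ', RingAut.mul_apply, ← zpow_natCast]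
    refine ih.map _ fun x i hx => ?_
    rw [hT]
    exact hx.ftwist hs

end fractions

/-! ### The meaning of the table of syndromes -/

section table

variable {F : Type u} [Field F]

/-- The polynomials `t.1`, all with the same number of entries, represent `y 0, ..., y (k - 1)`
with common denominator `t.2`. -/
structure IsRow (t : List (List F) × List F) (k : ℕ) (y : ℕ → RatFunc F) : Prop where
  length : t.1.length = k
  ne_zero : pval t.2 ≠ 0
  uniform : ∃ L, ∀ p ∈ t.1, p.length = L
  eq : ∀ i < k, pval (t.1.getD i []) = y i * pval t.2

lemma fcommon_spec (k : ℕ) (l : List (List F × List F)) (hl : l.length = k) (y : ℕ → RatFunc F)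
    (h : ∀ i < k, IsFrac (l.getD i ([], [])) (y i)) :
    (fcommon l).1.length = k ∧ pval (fcommon l).2 ≠ 0 ∧
      ∀ i < k, pval ((fcommon l).1.getD i []) = y i * pval (fcommon l).2 := by
  induction l generalizing k y with
  | nil => subst hl; simp [fcommon]
  | cons x l ih =>
    subst hl
    obtain ⟨h1, h2, h3⟩ := ih l.length rfl (fun i => y (i + 1)) fun i hi => by
      simpa using h (i + 1) (by simpa using hi)
    have hx : IsFrac x (y 0) := by simpa using h 0 (by simp)
    have h4 : fcommon (x :: l) = (pmul x.1 (fcommon l).2 :: (fcommon l).1.map (pmul x.2),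
      pmul x.2 (fcommon l).2) := rfl
    rw [h4]
    refine ⟨by simp [h1], by simp [hx.ne_zero, h2], fun i hi => ?_⟩
    cases i with
    | zero => simp only [List.getD_cons_zero, pval_pmul, hx.eq]; ring
    | succ i =>
      have hi' : i < l.length := by simpa using hi
      have h5 := h3 i hi'
      rw [List.getD_eq_getElem _ _ (by omega)] at h5
      rw [List.getD_cons_succ, List.getD_eq_getElem _ _ (by simp; omega), List.getElem_map,
        pval_pmul, pval_pmul, h5]
      ring

lemma isRow_padAll {k : ℕ} {l : List (List F × List F)} (hl : l.length = k) {y : ℕ → RatFunc F}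
    (h : ∀ i < k, IsFrac (l.getD i ([], [])) (y i)) :
    IsRow (padAll (fcommon l).1, (fcommon l).2) k y := by
  obtain ⟨h1, h2, h3⟩ := fcommon_spec k l hl y h
  refine ⟨by simp [padAll, h1], h2, ⟨(fcommon l).1.flatten.length, fun p hp => ?_⟩,
    fun i hi => ?_⟩
  · obtain ⟨q, hq, rfl⟩ := List.mem_map.1 hp
    rw [length_padd, length_zeros, List.length_flatten]
    exact max_eq_right (List.le_sum_of_mem (List.mem_map_of_mem hq))
  · rw [← h3 i hi, padAll, List.getD_eq_getElem _ _ (by simp; omega),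
      List.getD_eq_getElem _ _ (by omega), List.getElem_map, pval_padd]
    simp [pval]

omit [Field F] in
lemma transp_eq {n : ℕ} (e : List (List F × List F)) (he : e.length = n)
    (l : List (List (List F × List F))) (hl : ∀ v ∈ l, v.length = n) :
    transp e l = List.ofFn fun i : Fin n => l.map fun v => v.getD i ([], []) := by
  induction l with
  | nil =>
    refine List.ext_getElem (by simp [transp, he]) fun i _ _ => by simp [transp]
  | cons v l ih =>
    have h1 : transp e (v :: l) = (v.zip (transp e l)).map fun y => y.1 :: y.2 := rfl
    have h2 := hl v (by simp)
    rw [h1, ih fun v hv => hl v (by simp [hv])]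
    refine List.ext_getElem (by simp [h2]) fun i hi hi' => ?_
    have hi2 : i < v.length := by rw [h2]; simpa using hi'
    simp [hi2]

variable {s : (List F × List F) × List Unit} {σ : RingAut (RatFunc F)}
  {n : ℕ} {lam : RatFunc F}

lemma zpow_sub_natCast_of_pow_eq_one {G : Type v} [Group G] {x : G} {N b : ℕ} (h : x ^ N = 1)
    (hb : b ≤ N) : x ^ ((N - b : ℕ) : ℤ) = x ^ (-(b : ℤ)) := by
  rw [Nat.cast_sub hb, sub_eq_add_neg, zpow_add, zpow_natCast x N, h, one_mul]

/-- The rows of the table consist of the coefficients of `T ^ (-b) f * e`. -/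
lemma syndromes_spec (h : IsCyclicDatum σ n lam) (hs : IsAutData s.1 σ)
    {T : RingAut (Alg σ n lam)} (hT : ∀ f i, coords (T f) i = (σ ^ s.2.length) (coords f i))
    {N : ℕ} (hN : T ^ N = 1) (hm : 0 < s.2.length) (hNn : n / s.2.length = N)
    {l : List F × List F} (hl : IsFrac l lam)
    {k : List Unit} (hk : k.length ≤ N) {v w : List (List F × List F)} {e r : Alg σ n lam}
    (hv : IsVec v (coords e)) (hw : IsVec w (coords r)) :
    ∃ t : Fin n → List (List F) × List F, syndromes s l k v w = List.ofFn t ∧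
      ∀ i, IsRow (t i) (k.length - 1) fun b => coords ((T ^ (-(b : ℤ))) r * e) i := by
  have h1 : ((k.tail.zip (iters (List.map (ftwist s)) (udiv (unary w) s.2) w)).map
      fun y => y.2) = (List.range (k.length - 1)).map
        fun b => (List.map (ftwist s))^[N - b] w := by
    have hu : (udiv (unary w) s.2).length = N := by
      rw [length_udiv _ _ hm, unary, List.length_map, hw.length, hNn]
    rw [iters_eq, hu]
    refine List.ext_getElem (by simp; omega) fun i hi hi' => ?_
    have : i < k.length - 1 := by simpa using hi'
    simp only [List.getElem_map, List.getElem_zip, List.getElem_reverse, List.getElem_range,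
      List.length_map, List.length_range]
    congr 2
    omega
  have h2 : ∀ b < k.length - 1, IsVec (amul s.1 l v ((List.map (ftwist s))^[N - b] w))
      (coords ((T ^ (-(b : ℤ))) r * e)) := by
    intro b hb
    have h3 := hw.ftwist_iterate hs hT (N - b)
    rw [zpow_sub_natCast_of_pow_eq_one hN (by omega)] at h3
    exact hv.amul h hs hl h3
  refine ⟨fun i => (padAll (fcommon (((List.range (k.length - 1)).map fun b =>
      amul s.1 l v ((List.map (ftwist s))^[N - b] w)).map fun v => v.getD i ([], []))).1,
    (fcommon (((List.range (k.length - 1)).map fun b =>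
      amul s.1 l v ((List.map (ftwist s))^[N - b] w)).map fun v => v.getD i ([], []))).2),
    ?_, fun i => ?_⟩
  rotate_left
  · exact isRow_padAll (by simp) fun b hb => by
        rw [List.getD_eq_getElem _ _ (by simpa using hb)]
        simp only [List.getElem_map, List.getElem_range]
        obtain ⟨c, hc, hci⟩ := h2 b hb
        rw [hc, List.getD_eq_getElem _ _ (by simp), List.getElem_ofFn]
        exact hci i
  · rw [syndromes, h1, List.map_map, transp_eq v hv.length]
    · rw [List.map_ofFn]; rfl
    · intro u hu
      obtain ⟨b, hb, rfl⟩ := List.mem_map.1 hu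
      exact (h2 b (List.mem_range.1 hb)).length

/-! ### The meaning of the recurrence -/

lemma blocks_eq (s : (List F × List F) × List Unit) (l : List (List F)) :
    (blocks s l).length = l.length ∧
      ∀ i, (blocks s l).getD i [] = (ptwist s)^[i] (l.getD i []) := by
  induction l with
  | nil =>
    refine ⟨rfl, fun i => ?_⟩
    have : (ptwist s)^[i] [] = [] := List.length_eq_zero_iff.1 (by rw [length_ptwist_iterate]; rfl)
    simp [blocks, this]
  | cons p l ih =>
    have h1 : blocks s (p :: l) = p :: (blocks s l).map (ptwist s) := rfl
    rw [h1]
    refine ⟨by simp [ih.1], fun i => ?_⟩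
    cases i with
    | zero => simp
    | succ i =>
      rw [List.getD_cons_succ, List.getD_cons_succ, Function.iterate_succ_apply', ← ih.2 i]
      by_cases hi : i < (blocks s l).length
      · rw [List.getD_eq_getElem _ _ (by simpa using hi), List.getD_eq_getElem _ _ hi,
          List.getElem_map]
      · rw [List.getD_eq_default _ _ (by simpa using hi), List.getD_eq_default _ _ (by omega)]
        exact (List.length_eq_zero_iff.1 (by rw [dim_ptwist]; rfl)).symm

lemma getD_flatten_of_uniform {α : Type v} (d : α) (c : ℕ) (L : List (List α))
    (hL : ∀ l ∈ L, l.length = c) (i b : ℕ) (hb : b < c) :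
    L.flatten.getD (i * c + b) d = (L.getD i []).getD b d := by
  induction L generalizing i with
  | nil => simp
  | cons l L ih =>
    have h1 := hL l (by simp)
    rw [List.flatten_cons]
    cases i with
    | zero =>
      rw [zero_mul, zero_add, List.getD_cons_zero, List.getD_append _ _ _ _ (by omega)]
    | succ i =>
      rw [List.getD_cons_succ, List.getD_append_right _ _ _ _ (by rw [h1, add_mul]; omega), h1,
        ← ih (fun l hl => hL l (by simp [hl]))]
      congr 1
      rw [add_mul]; omega

lemma getD_ofFn {α : Type v} {n : ℕ} (c : Fin n → α) (i : Fin n) (d : α) :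
    (List.ofFn c).getD i d = c i := by
  rw [List.getD_eq_getElem _ _ (by simp)]; simp

omit [Field F] in
lemma length_le_tableSize {T : List (List (List F) × List F)} {t : List (List F) × List F}
    (ht : t ∈ T) {p : List F} (hp : p ∈ t.1) : p.length ≤ (tableSize T).length := by
  rw [tableSize, unary, List.length_map, List.length_flatten]
  refine le_trans ?_ (List.le_sum_of_mem (List.mem_map_of_mem (List.mem_map_of_mem ht)))
  rw [List.length_flatten]
  exact List.le_sum_of_mem (List.mem_map_of_mem hp)

/-- If the sequences in the table satisfy a common twisted recurrence with `tau + 1`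
coefficients, then such a recurrence is found. -/
lemma recurrence_spec (hs : IsAutData s.1 σ) {k tau : List Unit}
    (t : Fin n → List (List F) × List F) (y : ℕ → Fin n → RatFunc F)
    (ht : ∀ i, IsRow (t i) (k.length - 1) fun b => y b i)
    {G : Fin (tau.length + 1) → RatFunc F} (hG : G ≠ 0)
    (hrel : ∀ b < k.length - 1 - tau.length, ∀ i,
      ∑ l, G l * ((σ ^ s.2.length) ^ (b : ℤ)) (y (b + l) i) = 0) :
    ∃ d, (recurrence s k tau (List.ofFn t)).length = tau.length + 1 ∧
      (∀ p ∈ recurrence s k tau (List.ofFn t), p.length = d) ∧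
      (∃ j < tau.length + 1, pval ((recurrence s k tau (List.ofFn t)).getD j []) ≠ 0) ∧
      ∀ b < k.length - 1 - tau.length, ∀ i, ∑ l ∈ Finset.range (tau.length + 1),
        pval ((recurrence s k tau (List.ofFn t)).getD l []) *
          ((σ ^ s.2.length) ^ (b : ℤ)) (y (b + l) i) = 0 := by
  obtain ⟨cnt, hcnt⟩ : ∃ cnt, cnt = k.length - 1 - tau.length := ⟨_, rfl⟩
  obtain ⟨D, hD⟩ : ∃ D, D = () :: ((() :: tau).map fun _ => tableSize (List.ofFn t)).flatten :=
    ⟨_, rfl⟩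
  have hDl : D.length = 1 + (tau.length + 1) * (tableSize (List.ofFn t)).length := by
    rw [hD]; simp; ring
  let bl : ℕ → List (List F) := fun j => ((List.ofFn t).map fun t =>
    blocks s (((k.tail.drop tau.length).zip (t.1.drop j)).map Prod.snd)).flatten
  have hcol : recurrence s k tau (List.ofFn t) = relation D ((List.range (tau.length + 1)).map
      fun j => pack (D ++ tableSize (List.ofFn t)) (bl j)) := by
    rw [recurrence, upto_eq, ← hD, List.map_map]
    simp only [column, Function.comp_def, bl, List.length_cons, List.length_replicate]
  -- the entries of the columns
  have hzip : ∀ j < tau.length + 1, ∀ i,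
      (((k.tail.drop tau.length).zip ((t i).1.drop j)).map Prod.snd).length = cnt ∧
      ∀ b < cnt, (((k.tail.drop tau.length).zip ((t i).1.drop j)).map Prod.snd).getD b [] =
        (t i).1.getD (b + j) [] := by
    intro j hj i
    have h1 := (ht i).length
    have h2 : (((k.tail.drop tau.length).zip ((t i).1.drop j)).map Prod.snd).length = cnt := by
      simp only [List.length_map, List.length_zip, List.length_drop, List.length_tail]
      omega
    refine ⟨h2, fun b hb => ?_⟩
    rw [List.getD_eq_getElem _ _ (by omega), List.getD_eq_getElem _ _ (by omega)]
    simp only [List.getElem_map, List.getElem_zip, List.getElem_drop]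
    congr 1
    omega
  have hunif : ∀ j < tau.length + 1, ∀ l ∈ ((List.ofFn t).map fun t =>
      blocks s (((k.tail.drop tau.length).zip (t.1.drop j)).map Prod.snd)), l.length = cnt := by
    intro j hj l hl
    rw [List.map_ofFn] at hl
    obtain ⟨i, rfl⟩ := (List.mem_ofFn' _ _).1 hl
    exact (blocks_eq s _).1.trans (hzip j hj i).1
  have hlen : ∀ j < tau.length + 1, (bl j).length = n * cnt := by
    intro j hj
    have h1 := List.map_congr_left (f := List.length) (g := fun _ => cnt) (hunif j hj)
    rw [List.length_flatten, h1, List.map_const', List.sum_replicate, List.length_map,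
      List.length_ofFn, smul_eq_mul]
  have hent : ∀ j < tau.length + 1, ∀ (i : Fin n), ∀ b < cnt,
      (bl j).getD (i * cnt + b) [] = (ptwist s)^[b] ((t i).1.getD (b + j) []) := by
    intro j hj i b hb
    rw [getD_flatten_of_uniform _ _ _ (hunif j hj) _ _ hb, List.map_ofFn,
      getD_ofFn, Function.comp_apply,
      (blocks_eq s _).2, (hzip j hj i).2 b hb]
  have hidx : ∀ a < n * cnt, ∃ (i : Fin n) (b : ℕ), b < cnt ∧ a = i * cnt + b := by
    intro a ha
    have hc : 0 < cnt := Nat.pos_of_mul_pos_left (Nat.zero_lt_of_lt ha)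
    exact ⟨⟨a / cnt, Nat.div_lt_of_lt_mul (by rwa [mul_comm])⟩, a % cnt, Nat.mod_lt _ hc,
      by rw [mul_comm]; exact (Nat.div_add_mod a cnt).symm⟩
  -- all entries in a row of the linear system carry the same factor
  have hval : ∀ (i : Fin n), ∀ b < cnt, ∃ κ : RatFunc F, κ ≠ 0 ∧ ∀ j < tau.length + 1,
      pval ((bl j).getD (i * cnt + b) []) = κ * ((σ ^ s.2.length) ^ (b : ℤ)) (y (b + j) i) := by
    intro i b hb
    obtain ⟨L, hL⟩ := (ht i).uniform
    obtain ⟨κ, hκ, h1⟩ := exists_twist_factor hs L b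
    refine ⟨κ * ((σ ^ s.2.length) ^ (b : ℤ)) (pval (t i).2), mul_ne_zero hκ
      ((map_ne_zero_iff _ (RingEquiv.injective _)).2 (ht i).ne_zero), fun j hj => ?_⟩
    have h2 : b + j < (t i).1.length := by rw [(ht i).length]; omega
    rw [hent j hj i b hb, h1 _ (by rw [List.getD_eq_getElem _ _ h2]; exact hL _ (List.getElem_mem _)),
      (ht i).eq _ (by rw [← (ht i).length]; exact h2), map_mul]
    ring
  have hS : ∀ j < tau.length + 1, ∀ p ∈ bl j, p.length ≤ (tableSize (List.ofFn t)).length := by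
    intro j hj p hp
    obtain ⟨a, ha, rfl⟩ := List.mem_iff_getElem.1 hp
    obtain ⟨i, b, hb, rfl⟩ := hidx a (by rw [← hlen j hj]; exact ha)
    rw [← List.getD_eq_getElem _ [] ha, hent j hj i b hb, length_ptwist_iterate]
    have h2 : b + j < (t i).1.length := by rw [(ht i).length]; omega
    rw [List.getD_eq_getElem _ _ h2]
    exact length_le_tableSize ((List.mem_ofFn' _ _).2 ⟨i, rfl⟩) (List.getElem_mem _)
  obtain ⟨h1, h2⟩ := relation_pack_spec D (D ++ tableSize (List.ofFn t)) bl hlen hS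
    (by rw [hDl, add_mul]; omega) (by simp) hG (fun a ha => by
      obtain ⟨i, b, hb, rfl⟩ := hidx a ha
      obtain ⟨κ, -, hκ⟩ := hval i b hb
      have h3 := hrel b (by omega) i
      calc ∑ l, G l * pval ((bl l).getD (i * cnt + b) [])
          = κ * ∑ l, G l * ((σ ^ s.2.length) ^ (b : ℤ)) (y (b + l) i) := by
            rw [Finset.mul_sum]
            refine Finset.sum_congr rfl fun l _ => ?_
            rw [hκ l l.2]; ring
        _ = 0 := by rw [h3, mul_zero])
  rw [hcol]
  refine ⟨D.length, by rw [length_relation]; simp, fun p hp => length_of_mem_relation _ _ hp, h1,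
    fun b hb i => ?_⟩
  have hb' : b < cnt := by omega
  obtain ⟨κ, hκ0, hκ⟩ := hval i b hb'
  have h3 := h2 (i * cnt + b) (by
    calc (i : ℕ) * cnt + b < (i : ℕ) * cnt + cnt := by omega
      _ = (i + 1) * cnt := by ring
      _ ≤ n * cnt := Nat.mul_le_mul_right _ i.2)
  refine (mul_eq_zero.1 (Eq.trans ?_ h3)).resolve_left hκ0
  rw [Finset.mul_sum]
  refine Finset.sum_congr rfl fun l hl => ?_
  rw [hκ l (Finset.mem_range.1 hl)]
  ring

end table

/-! ### The meaning of the extension of the syndromes -/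

section extension

variable {F : Type u} [Field F] {s : (List F × List F) × List Unit} {σ : RingAut (RatFunc F)}

lemma pflag_eq_zero_iff_pval (p : List F) : pflag p = 0 ↔ pval p = 0 := by
  rw [pflag_eq_zero, pval_eq_zero]

/-- Removing leading zeros keeps a relation valid: if `G 0 = 0` then the coefficients
`σ ^ m (G (l + 1))` satisfy the shifted relation. -/
lemma trim_spec (hs : IsAutData s.1 σ) {ι : Type v} (f : ι → RatFunc F) {d : ℕ}
    {G : List (List F)} (hlen : ∀ p ∈ G, p.length = d)
    (hrel : ∀ i, ∑ l ∈ Finset.range G.length, pval (G.getD l []) *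
      ((σ ^ s.2.length) ^ (-(l : ℤ))) (f i) = 0)
    (hne : ∃ p ∈ G, pval p ≠ 0) :
    (∀ p ∈ trim s G, p.length = d) ∧ (trim s G).length ≤ G.length ∧
      pval ((trim s G).getD 0 []) ≠ 0 ∧
      ∀ i, ∑ l ∈ Finset.range (trim s G).length, pval ((trim s G).getD l []) *
        ((σ ^ s.2.length) ^ (-(l : ℤ))) (f i) = 0 := by
  classical
  let step : List (List F) → List F → List (List F) := fun G _ => listElim G [] fun g gs =>
    if pflag g = 0 then gs.map (ptwist s) else G
  have hkeep : ∀ (L : List (List F)) (G : List (List F)), pval (G.getD 0 []) ≠ 0 →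
      L.foldl step G = G := by
    intro L
    induction L with
    | nil => intro G _; rfl
    | cons a L ih =>
      intro G hG
      have : step G a = G := by
        cases G with
        | nil => simp at hG
        | cons g gs =>
          rw [List.getD_cons_zero, ne_eq, ← pflag_eq_zero_iff_pval] at hG
          simp [step, hG]
      rw [List.foldl_cons, this, ih G hG]
  have key : ∀ (L : List (List F)) (G : List (List F)), (∀ p ∈ G, p.length = d) →
      (∀ i, ∑ l ∈ Finset.range G.length, pval (G.getD l []) *
        ((σ ^ s.2.length) ^ (-(l : ℤ))) (f i) = 0) → (∃ p ∈ G, pval p ≠ 0) →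
      G.length ≤ L.length → (∀ p ∈ L.foldl step G, p.length = d) ∧
      (L.foldl step G).length ≤ G.length ∧ pval ((L.foldl step G).getD 0 []) ≠ 0 ∧
      ∀ i, ∑ l ∈ Finset.range (L.foldl step G).length, pval ((L.foldl step G).getD l []) *
        ((σ ^ s.2.length) ^ (-(l : ℤ))) (f i) = 0 := by
    intro L
    induction L with
    | nil =>
      rintro G _ _ ⟨p, hp, -⟩ h0
      rw [List.length_nil, Nat.le_zero, List.length_eq_zero_iff] at h0
      simp [h0] at hp
    | cons a L ih =>
      intro G hlen hrel hne h0
      by_cases hG : pval (G.getD 0 []) = 0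
      swap
      · rw [hkeep _ G hG]; exact ⟨hlen, le_rfl, hG, hrel⟩
      cases G with
      | nil => simp at hne
      | cons g gs =>
      rw [List.getD_cons_zero] at hG
      have h1 : step (g :: gs) a = gs.map (ptwist s) := by
        simp [step, (pflag_eq_zero_iff_pval g).2 hG]
      obtain ⟨κ, hκ, hκ1⟩ := exists_twist_factor hs d 1
      rw [Function.iterate_one, Nat.cast_one, zpow_one] at hκ1
      have h2 : ∀ l, l < gs.length → pval ((gs.map (ptwist s)).getD l []) =
          κ * (σ ^ s.2.length) (pval (gs.getD l [])) := by
        intro l hl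
        rw [List.getD_eq_getElem _ _ (by simpa using hl), List.getElem_map,
          List.getD_eq_getElem _ _ hl]
        exact hκ1 _ (hlen _ (by simp))
      rw [List.foldl_cons, h1]
      obtain ⟨h3, h4, h5, h6⟩ := ih (gs.map (ptwist s))
        (fun p hp => by
          obtain ⟨q, hq, rfl⟩ := List.mem_map.1 hp
          rw [dim_ptwist]; exact hlen q (by simp [hq]))
        (fun i => by
          have h7 := congrArg (σ ^ s.2.length) (hrel i)
          rw [List.length_cons, Finset.sum_range_succ', List.getD_cons_zero, hG, zero_mul,
            add_zero, map_zero, map_sum] at h7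
          rw [List.length_map, ← mul_zero κ, ← h7, Finset.mul_sum]
          refine Finset.sum_congr rfl fun l hl => ?_
          rw [h2 l (Finset.mem_range.1 hl), map_mul, List.getD_cons_succ, mul_assoc,
            ← RingAut.mul_apply (σ ^ s.2.length), ← zpow_one_add]
          congr 4
          push_cast; ring)
        (by
          obtain ⟨p, hp, hp0⟩ := hne
          rcases List.mem_cons.1 hp with rfl | hp
          · exact absurd hG hp0
          · refine ⟨_, List.mem_map_of_mem hp, ?_⟩
            rw [hκ1 _ (hlen p (by simp [hp]))]
            exact mul_ne_zero hκ ((map_ne_zero_iff _ (RingEquiv.injective _)).2 hp0))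
        (by simpa using h0)
      exact ⟨h3, h4.trans (by simp), h5, h6⟩
  exact key G G hlen hrel hne le_rfl

lemma pval_sum_zip (gs ys : List (List F)) (h : gs.length ≤ ys.length) :
    pval (((gs.zip ys).map fun y => pmul y.1 y.2).foldl padd []) =
      ∑ l ∈ Finset.range gs.length, pval (gs.getD l []) * pval (ys.getD l []) := by
  have key : ∀ (gs ys : List (List F)) (acc : List F), gs.length ≤ ys.length →
      pval (((gs.zip ys).map fun y => pmul y.1 y.2).foldl padd acc) = pval acc +
        ∑ l ∈ Finset.range gs.length, pval (gs.getD l []) * pval (ys.getD l []) := by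
    intro gs
    induction gs with
    | nil => simp
    | cons g gs ih =>
      intro ys acc h
      cases ys with
      | nil => simp at h
      | cons y ys =>
        rw [List.zip_cons_cons, List.map_cons, List.foldl_cons, ih _ _ (by simpa using h),
          pval_padd, pval_pmul, List.length_cons, Finset.sum_range_succ']
        simp only [List.getD_cons_succ, List.getD_cons_zero]
        ring
  rw [key gs ys [] h, pval_nil, zero_add]

/-- The terms with negative index of a sequence, from those with index `0, ..., k - 1` and
recurrences with nonzero leading coefficient. -/
lemma extSeq_spec {t : List (List F) × List F} {k : ℕ} {y : ℤ → RatFunc F}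
    (ht : IsRow t k fun b => y b) (N : ℕ) (R : ℕ → List (List F))
    (hR : ∀ i < N, (R i).length ≤ k + 1) (h0 : ∀ i < N, pval ((R i).getD 0 []) ≠ 0)
    (hrel : ∀ i < N, ∑ l ∈ Finset.range (R i).length,
      pval ((R i).getD l []) * y ((l : ℤ) - (i + 1)) = 0) :
    (extSeq ((List.range N).map R) t).length = N ∧ ∀ l < N,
      pval ((extSeq ((List.range N).map R) t).getD l ([], [])).2 ≠ 0 ∧
      pval ((extSeq ((List.range N).map R) t).getD l ([], [])).1 =
        y ((l : ℤ) - N) * pval ((extSeq ((List.range N).map R) t).getD l ([], [])).2 := by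
  have key : ∀ st : List F × List (List F) × List (List F × List F),
      st = ((List.range N).map R).foldl extStep (t.2, t.1, []) →
      (pval st.1 ≠ 0 ∧ st.2.1.length = k + N ∧
        ∀ l < k + N, pval (st.2.1.getD l []) = y ((l : ℤ) - N) * pval st.1) ∧
      st.2.2.length = N ∧ ∀ l < N, pval (st.2.2.getD l ([], [])).2 ≠ 0 ∧
        pval (st.2.2.getD l ([], [])).1 =
          y ((l : ℤ) - N) * pval (st.2.2.getD l ([], [])).2 := by
    induction N with
    | zero =>
      rintro st rfl
      simp only [List.range_zero, List.map_nil, List.foldl_nil]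
      exact ⟨⟨ht.ne_zero, ht.length, fun l hl => by simpa using ht.eq l hl⟩, rfl,
        fun l hl => absurd hl (Nat.not_lt_zero l)⟩
    | succ N ih =>
      rintro st rfl
      rw [List.range_succ, List.map_append, List.map_singleton, List.foldl_append,
        List.foldl_cons, List.foldl_nil]
      obtain ⟨⟨h1, h2, h3⟩, h4, h5⟩ := ih (fun i hi => hR i (by omega)) (fun i hi => h0 i (by omega))
        (fun i hi => hrel i (by omega)) _ rfl
      revert h1 h2 h3 h4 h5
      generalize ((List.range N).map R).foldl extStep (t.2, t.1, []) = st
      intro h1 h2 h3 h4 h5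
      have hRN := hR N (by omega)
      have h0N := h0 N (by omega)
      have hrelN := hrel N (by omega)
      revert hRN h0N hrelN
      rcases R N with _ | ⟨g, gs⟩
      · intro _ h; simp at h
      intro hRN h0N hrelN
      rw [List.length_cons] at hRN
      rw [List.getD_cons_zero] at h0N
      rw [List.length_cons, Finset.sum_range_succ', List.getD_cons_zero] at hrelN
      simp only [List.getD_cons_succ] at hrelN
      have h6 : pval (((gs.zip st.2.1).map fun y => pmul y.1 y.2).foldl padd []) =
          (∑ l ∈ Finset.range gs.length, pval (gs.getD l []) *
            y (((l + 1 : ℕ) : ℤ) - (N + 1))) * pval st.1 := by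
        rw [pval_sum_zip _ _ (by omega), Finset.sum_mul]
        refine Finset.sum_congr rfl fun l hl => ?_
        rw [h3 l (by have := Finset.mem_range.1 hl; omega), ← mul_assoc]
        congr 3
        push_cast; ring
      have h7 : pval (psmul (-1) (((gs.zip st.2.1).map fun y => pmul y.1 y.2).foldl padd [])) =
          y ((0 : ℕ) - ((N + 1 : ℕ) : ℤ)) * pval (pmul g st.1) := by
        rw [pval_psmul, h6, pval_pmul]
        push_cast at hrelN ⊢
        rw [map_neg, map_one]
        linear_combination (-pval st.1) * hrelN
      rw [extStep, listElim_cons]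
      refine ⟨⟨by simp [h0N, h1], by simp [h2]; omega, fun l hl => ?_⟩, by simp [h4],
        fun l hl => ?_⟩
      · cases l with
        | zero => exact h7
        | succ l =>
          have hl' : l < st.2.1.length := by omega
          have h8 := h3 l (by omega)
          rw [List.getD_eq_getElem _ _ hl'] at h8
          rw [List.getD_cons_succ, List.getD_eq_getElem _ _ (by simpa using hl'),
            List.getElem_map, pval_pmul, pval_pmul, h8, Nat.cast_succ, Nat.cast_succ,
            add_sub_add_right_eq_sub]
          ring
      · cases l with
        | zero => exact ⟨by simp [h0N, h1], h7⟩
        | succ l =>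
          rw [List.getD_cons_succ, Nat.cast_succ, Nat.cast_succ, add_sub_add_right_eq_sub]
          exact h5 l (by omega)
  exact (key _ rfl).2

lemma twistSum_spec (hs : IsAutData s.1 σ) (l : List (List F × List F)) (w : ℕ → RatFunc F)
    (hl : ∀ b < l.length, pval (l.getD b ([], [])).2 ≠ 0 ∧
      pval (l.getD b ([], [])).1 = w b * pval (l.getD b ([], [])).2) :
    IsFrac (twistSum s l.reverse)
      (∑ b ∈ Finset.range l.length, ((σ ^ s.2.length) ^ (b : ℤ)) (w b)) := by
  induction l generalizing w with
  | nil => exact isFrac_zero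
  | cons x l ih =>
    have h1 := ih (fun b => w (b + 1)) fun b hb => by
      simpa using hl (b + 1) (by simpa using hb)
    have h2 := hl 0 (by simp)
    rw [List.getD_cons_zero] at h2
    rw [List.reverse_cons, twistSum, List.foldl_append, ← twistSum, List.length_cons,
      Finset.sum_range_succ']
    have h3 := (h1.ftwist (s := s) hs).fadd (isFrac_fpad h2.1 h2.2)
    rw [map_sum] at h3
    refine (congrArg (IsFrac _) ?_).mp h3
    congr 1
    refine Finset.sum_congr rfl fun b _ => ?_
    rw [← RingAut.mul_apply, ← zpow_one_add, Nat.cast_succ, add_comm]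

lemma map_iterate {α : Type v} (φ : α → α) (j : ℕ) (l : List α) :
    (List.map φ)^[j] l = l.map φ^[j] := by
  induction j with
  | zero => simp
  | succ j ih => rw [Function.iterate_succ_apply', ih, List.map_map, Function.iterate_succ']

/-- The error is determined by its syndromes and by a recurrence with nonzero leading
coefficient. -/
lemma errors_entry (hs : IsAutData s.1 σ) {t : List (List F) × List F} {k d : ℕ}
    {y : ℤ → RatFunc F} (ht : IsRow t k fun b => y b) (r : List Unit) {G : List (List F)}
    (hd : ∀ p ∈ G, p.length = d) (hG : G.length ≤ k + 1) (h0 : pval (G.getD 0 []) ≠ 0)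
    (hrel : ∀ b : ℤ, ∑ l ∈ Finset.range G.length,
      pval (G.getD l []) * ((σ ^ s.2.length) ^ b) (y (b + l)) = 0) :
    IsFrac (twistSum s (extSeq (iters (List.map (ptwist s)) r G).reverse t).reverse)
      (∑ b ∈ Finset.range r.length, ((σ ^ s.2.length) ^ (b : ℤ)) (y ((b : ℤ) - r.length))) := by
  have hval : ∀ i, ∃ κ : RatFunc F, κ ≠ 0 ∧ ∀ l < G.length,
      pval (((List.map (ptwist s))^[i + 1] G).getD l []) =
        κ * ((σ ^ s.2.length) ^ ((i : ℤ) + 1)) (pval (G.getD l [])) := by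
    intro i
    obtain ⟨κ, hκ, h1⟩ := exists_twist_factor hs d (i + 1)
    refine ⟨κ, hκ, fun l hl => ?_⟩
    rw [map_iterate, List.getD_eq_getElem _ _ (by simpa using hl), List.getElem_map,
      List.getD_eq_getElem _ _ hl]
    exact_mod_cast h1 _ (hd _ (List.getElem_mem hl))
  have hlen : ∀ i, ((List.map (ptwist s))^[i + 1] G).length = G.length := fun i => by
    rw [map_iterate, List.length_map]
  have hpos : 0 < G.length := List.length_pos_iff.2 fun h => h0 (by simp [h])
  rw [iters_eq, List.reverse_reverse]
  obtain ⟨h1, h2⟩ := extSeq_spec ht r.length (fun i => (List.map (ptwist s))^[i + 1] G)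
    (fun i _ => (hlen i).trans_le hG)
    (fun i _ => by
      obtain ⟨κ, hκ, h3⟩ := hval i
      rw [h3 0 hpos]
      exact mul_ne_zero hκ ((map_ne_zero_iff _ (RingEquiv.injective _)).2 h0))
    (fun i _ => by
      obtain ⟨κ, hκ, h3⟩ := hval i
      have h4 := congrArg ((σ ^ s.2.length) ^ ((i : ℤ) + 1)) (hrel (-((i : ℤ) + 1)))
      rw [map_sum, map_zero] at h4
      rw [hlen, ← mul_zero κ, ← h4, Finset.mul_sum]
      refine Finset.sum_congr rfl fun l hl => ?_
      rw [h3 l (Finset.mem_range.1 hl), map_mul, ← RingAut.mul_apply, ← zpow_add,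
        add_neg_cancel, zpow_zero, RingAut.one_apply, mul_assoc]
      congr 3)
  have h3 := twistSum_spec hs (extSeq ((List.range r.length).map
    fun i => (List.map (ptwist s))^[i + 1] G) t) (fun b => y ((b : ℤ) - r.length))
    (fun b hb => h2 b (by rwa [h1] at hb))
  rwa [h1] at h3

end extension

/-! ### Correctness of the decoder -/

section correctness

variable {F : Type u} [Field F] {s : (List F × List F) × List Unit} {σ : RingAut (RatFunc F)}
  {n : ℕ} {lam : RatFunc F}

lemma IsRow.congr {t : List (List F) × List F} {k : ℕ} {y y' : ℕ → RatFunc F} (h : IsRow t k y)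
    (hy : ∀ b < k, y b = y' b) : IsRow t k y' :=
  ⟨h.length, h.ne_zero, h.uniform, fun i hi => by rw [h.eq i hi, hy i hi]⟩

open Classical in
lemma IsCyclicDatum.hamming_eq (h : IsCyclicDatum σ n lam) (f g : Alg σ n lam) :
    hamming f g = (Finset.univ.filter fun i => coords (f - g) i ≠ 0).card := by
  rw [h.coords_sub, hamming, hammingDist]
  congr 1
  ext i
  simp [sub_ne_zero]

lemma decodeAux_spec (h : IsCyclicDatum σ n lam) (hs : IsAutData s.1 σ)
    {T : RingAut (Alg σ n lam)} (hT : ∀ f i, coords (T f) i = (σ ^ s.2.length) (coords f i))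
    {N : ℕ} (hN : T ^ N = 1) (hm : 0 < s.2.length) (hNn : n / s.2.length = N)
    {l : List F × List F} (hl : IsFrac l lam) {k : List Unit} (hk : k.length ≤ N)
    {v w : List (List F × List F)} {e r c : Alg σ n lam}
    (hv : IsVec v (coords e)) (hw : IsVec w (coords r))
    (he : ∑ b ∈ Finset.range N, (T ^ (b : ℤ)) e = 1)
    (hc : ∀ b < k.length - 1, c * (T ^ (b : ℤ)) e = 0) (hrc : 2 * hamming r c < k.length) :
    IsVec (decodeAux s l k v w) (coords c) := by
  classical
  obtain ⟨f, hf⟩ : ∃ f, f = r - c := ⟨_, rfl⟩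
  obtain ⟨tau, htau⟩ : ∃ tau, tau = udiv k.tail [(), ()] := ⟨_, rfl⟩
  have htl : tau.length = (k.length - 1) / 2 := by
    rw [htau, length_udiv _ _ (by simp), List.length_tail]; rfl
  obtain ⟨t, ht, hrow⟩ := syndromes_spec h hs hT hN hm hNn hl hk hv hw
  -- the syndromes of the received word are those of the error
  have hrow' : ∀ i, IsRow (t i) (k.length - 1) fun b =>
      coords ((T ^ (-(b : ℤ))) f * e) i := fun i => (hrow i).congr fun b hb => by
    have h1 : (T ^ (-(b : ℤ))) c * e = 0 := by
      have h2 := congrArg (T ^ (-(b : ℤ))) (hc b hb)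
      rwa [map_mul, ← RingAut.mul_apply, ← zpow_add, neg_add_cancel, zpow_zero, map_zero] at h2
    rw [hf, map_sub, sub_mul, h1, sub_zero]
  obtain ⟨S, hS⟩ : ∃ S : Finset (Fin n), S = Finset.univ.filter fun i => coords f i ≠ 0 := ⟨_, rfl⟩
  have hSf : ∀ i ∉ S, coords f i = 0 := fun i hi => by simpa [hS] using hi
  have hScard : S.card ≤ tau.length := by
    rw [h.hamming_eq, ← hf, ← hS] at hrc
    omega
  obtain ⟨G₀, hG₀, hG₀f⟩ := IsCyclicDatum.exists_annihilator (θ := σ ^ s.2.length) f tau.length S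
    hScard hSf
  obtain ⟨d, h1, h2, h3, h4⟩ := recurrence_spec hs t
    (fun b i => coords ((T ^ (-(b : ℤ))) f * e) i) hrow' hG₀ (fun b _ i => by
      have := h.syndrome_relation (e := e) hT hG₀f b i
      simpa using this)
  obtain ⟨G, hG⟩ : ∃ G, G = recurrence s k tau (List.ofFn t) := ⟨_, rfl⟩
  rw [← hG] at h1 h2 h3 h4
  have h5 := h.annihilator_of_syndrome_relation (s := k.length - 1 - tau.length)
    (G := fun l : Fin (tau.length + 1) => pval (G.getD l [])) hT he S (by omega) hSf
    (fun b hb i => by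
      have := h4 b hb i
      rw [Finset.sum_range] at this
      simpa using this)
  obtain ⟨h6, h7, h8, h9⟩ := trim_spec (s := s) hs (coords f) h2
    (fun i => by rw [h1, Finset.sum_range]; exact h5 i)
    (by
      obtain ⟨j, hj, hj0⟩ := h3
      rw [List.getD_eq_getElem _ _ (by omega)] at hj0
      exact ⟨_, List.getElem_mem _, hj0⟩)
  have hNl : (udiv (unary w) s.2).length = N := by
    rw [length_udiv _ _ hm, unary, List.length_map, hw.length, hNn]
  have herr : IsVec (errors s (udiv (unary w) s.2) (trim s G) (List.ofFn t)) (coords f) := by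
    rw [errors, List.map_ofFn]
    refine ⟨_, rfl, fun i => ?_⟩
    have h10 := errors_entry hs (y := fun z => coords ((T ^ (-z)) f * e) i) (hrow' i)
      (udiv (unary w) s.2) h6 (by omega) h8 (fun b => by
        have := h.syndrome_relation (e := e) (L := (trim s G).length)
          (G := fun l => pval ((trim s G).getD l [])) hT
          (fun i => by rw [← h9 i, Finset.sum_range]) b i
        rw [Finset.sum_range]; exact this)
    rw [hNl] at h10
    rw [h.eq_sum_syndromes hT he hN f i]
    simp only [neg_sub] at h10
    exact h10
  rw [decodeAux, ht, ← htau, ← hG]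
  refine hw.zip_map herr _ fun x x' i hx hx' => ?_
  have h11 := hx.fadd (isFrac_neg_one.fmul hx')
  refine (congrArg (IsFrac _) ?_).mp h11
  rw [hf, h.coords_sub, Pi.sub_apply]
  ring

/-! ### Encodings -/

lemma isAutData_of_encodesAut {v : Val F} (hv : EncodesAut v σ) :
    ∃ a : List F × List F, v = enc a ∧ IsAutData a σ := by
  obtain ⟨bits, a, b, c, d, rfl, h1, h2⟩ := hv
  have h3 : RatFunc.C c * RatFunc.X + RatFunc.C d ≠ (0 : RatFunc F) := by
    intro h0
    rw [h0, div_zero, map_eq_zero_iff σ σ.injective] at h2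
    exact RatFunc.X_ne_zero h2
  refine ⟨(bits.map fun b => if b then 1 else 0, [a, b, c, d]), rfl, ?_, h3, ?_⟩
  · intro x
    rw [h1, ← frob_eq]
  · rw [h2]
    exact div_mul_cancel₀ _ h3

lemma exists_enc_of_encodesRat {v : Val F} {f : RatFunc F} (hv : EncodesRat v f) :
    ∃ x : List F × List F, v = enc x ∧ IsFrac (fpad x) f := by
  obtain ⟨a, b, rfl, h0, rfl⟩ := hv
  have h1 : pval b ≠ 0 := fun h => h0 (pval_eq_zero.1 h)
  exact ⟨(a, b), rfl, isFrac_fpad h1 (div_mul_cancel₀ _ h1).symm⟩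

lemma exists_enc_of_encodesAlg {v : Val F} {f : Alg σ n lam} (hv : EncodesAlg v f) :
    ∃ x : List (List F × List F), v = enc x ∧ IsVec (x.map fpad) (coords f) := by
  obtain ⟨c, rfl, hc⟩ := hv
  choose x hx hxf using fun i => exists_enc_of_encodesRat (hc i)
  refine ⟨List.ofFn x, ?_, fpad ∘ x, List.map_ofFn .., hxf⟩
  change _ = Val.ofList ((List.ofFn x).map enc)
  rw [List.map_ofFn]
  congr 2
  exact funext hx

lemma IsVec.encodesAlg {v : List (List F × List F)} {f : Alg σ n lam} (h : IsVec v (coords f)) :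
    EncodesAlg (enc v) f := by
  obtain ⟨c, rfl, hc⟩ := h
  refine ⟨fun i => enc (c i), ?_, fun i => ⟨(c i).1, (c i).2, rfl,
    fun h0 => (hc i).ne_zero (pval_eq_zero.2 h0), ?_⟩⟩
  · change Val.ofList ((List.ofFn c).map enc) = _
    rw [List.map_ofFn]; rfl
  · exact eq_div_of_mul_eq (hc i).ne_zero (hc i).eq.symm

lemma exists_enc_of_encodesInput {v : Val F} {m k : ℕ} {e r : Alg σ n lam}
    (hv : EncodesInput v m k e r) : ∃ x : (List F × List F) × (List F × List F) × List Unit ×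
      List Unit × List (List F × List F) × List (List F × List F) × Unit,
      v = enc x ∧ IsAutData x.1 σ ∧ IsFrac (fpad x.2.1) lam ∧ x.2.2.1.length = m ∧
      x.2.2.2.1.length = k ∧ IsVec (x.2.2.2.2.1.map fpad) (coords e) ∧
      IsVec (x.2.2.2.2.2.1.map fpad) (coords r) := by
  obtain ⟨vσ, vlam, ve, vr, h1, h2, h3, h4, rfl⟩ := hv
  obtain ⟨a, rfl, ha⟩ := isAutData_of_encodesAut h1
  obtain ⟨b, rfl, hb⟩ := exists_enc_of_encodesRat h2
  obtain ⟨c, rfl, hc⟩ := exists_enc_of_encodesAlg h3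
  obtain ⟨d, rfl, hd⟩ := exists_enc_of_encodesAlg h4
  have hnat : ∀ j : ℕ, (Val.ofNat j : Val F) = enc (List.replicate j ()) := by
    intro j
    change _ = Val.ofList ((List.replicate j ()).map enc)
    rw [List.map_replicate]; rfl
  refine ⟨(a, b, List.replicate m (), List.replicate k (), c, d, ()), ?_, ha, hb, by simp,
    by simp, hc, hd⟩
  rw [hnat, hnat]
  rfl

end correctness

/-! ### Least common left multiples -/

section multiples

variable {A : Type u} [Ring A]

lemma mul_eq_zero_of_mem_span {k : ℕ} {e : Fin k → A} (he : ∀ i, IsIdempotentElem (e i)) {g : A}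
    (hg : IsLCLM (fun i => 1 - e i) g) {c : A} (hc : c ∈ Ideal.span {g}) (i : Fin k) :
    c * e i = 0 := by
  obtain ⟨a, rfl⟩ := Ideal.mem_span_singleton'.1 hc
  obtain ⟨b, hb⟩ := hg.1 i
  rw [hb, mul_assoc, mul_assoc, sub_mul, one_mul, (he i).eq, sub_self, mul_zero, mul_zero]

/-- The elements `1 - e i` have `1 - ∑ i, e i` as a least common left multiple. -/
lemma isLCLM_one_sub_sum {k : ℕ} {e : Fin k → A} (he : OrthogonalIdempotents e) :
    IsLCLM (fun i => 1 - e i) (1 - ∑ i, e i) := by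
  refine ⟨fun i => ⟨1 - ∑ j, e j, ?_⟩, fun h hh => ⟨h, ?_⟩⟩
  · have h1 : (∑ j, e j) * e i = e i := by
      rw [Finset.sum_mul, Finset.sum_eq_single i, (he.idem i).eq]
      · intro j _ hj; exact he.ortho hj
      · simp
    change 1 - ∑ j, e j = (1 - ∑ j, e j) * (1 - e i)
    rw [mul_sub, mul_one, sub_mul, one_mul, h1, sub_self, sub_zero]
  · have h1 : ∀ i, h * e i = 0 := by
      intro i
      obtain ⟨a, ha⟩ := hh i
      rw [ha, mul_assoc, sub_mul, one_mul, (he.idem i).eq, sub_self, mul_zero]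
    rw [mul_sub, mul_one, Finset.mul_sum, Finset.sum_eq_zero fun i _ => h1 i, sub_zero]

end multiples

end

end SkewConstacyclic

theorem mainTheorem4 :
    ∃ (P : Prog) (p : Polynomial ℕ),
      ∀ (F : Type u) [Field F] [Finite F] (σ : RingAut (RatFunc F)) (n : ℕ) (lam : RatFunc F)
        (m k : ℕ) (e₀ : Alg σ n lam),
        0 < n → orderOf σ = n → σ lam = lam → lam ≠ 0 →
        HasIndex (Alg σ n lam) m →
        IsPrimitiveIdempotent e₀ →
        OrthogonalIdempotents (fun i : Fin (n / m) => coeffAut (m * i) e₀) →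
        1 ≤ k → k ≤ n / m →
        (∃ g, IsLCLM (fun i : Fin (k - 1) => coeffAut (m * i) (1 - e₀)) g) ∧
        ∀ g, IsLCLM (fun i : Fin (k - 1) => coeffAut (m * i) (1 - e₀)) g →
          (∀ a ∈ Ideal.span {g}, ∀ b ∈ Ideal.span {g}, a ≠ b → k ≤ hamming a b) ∧
          ∀ (r : Alg σ n lam) (v : Val F), EncodesInput v m k e₀ r →
            ∃ (w : Val F) (t : ℕ), Runs P v w t ∧ t + w.size ≤ p.eval v.size ∧
              ∀ c ∈ Ideal.span {g}, 2 * hamming r c < k → EncodesAlg w c := by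
  obtain ⟨code, hcode⟩ := exists_decode.{u}
  refine ⟨code.prog, code.bound, ?_⟩
  intro F _ _ σ n lam m k e₀ hn hord hfix hlam hidx hprim horth hk1 hkn
  have h : IsCyclicDatum σ n lam := ⟨hn, hord, hfix, hlam⟩
  obtain ⟨hmn, hsum⟩ := h.index hidx
  obtain ⟨N, hN⟩ : ∃ N, N = n / m := ⟨_, rfl⟩
  have hm : 0 < m := Nat.pos_of_mul_pos_right (hmn.symm ▸ hn)
  obtain ⟨T, hTdef⟩ : ∃ T, T = h.conj ^ m := ⟨_, rfl⟩
  have hT : ∀ f i, coords (T f) i = (σ ^ m) (coords f i) := by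
    intro f i
    rw [hTdef, ← zpow_natCast, ← zpow_natCast, h.coords_conj_zpow]
  have hTN : T ^ N = 1 := by rw [hTdef, ← pow_mul, hN, hmn, h.conj_pow_eq_one]
  have hE : ∀ (i : ℕ) (f : Alg σ n lam), coeffAut (m * i) f = (T ^ (i : ℤ)) f := by
    intro i f
    rw [h.coeffAut_eq, pow_mul, ← hTdef, zpow_natCast]
  have he : ∑ b ∈ Finset.range N, (T ^ (b : ℤ)) e₀ = 1 := by
    rw [Finset.sum_range, hN]
    refine Eq.trans (Finset.sum_congr rfl fun i _ => (hE i e₀).symm) (hsum _ horth fun i => ?_)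
    rw [hE]
    exact (map_ne_zero_iff _ (RingEquiv.injective _)).2 hprim.2.1
  have horth' : OrthogonalIdempotents (fun i : Fin (k - 1) => coeffAut (m * i) e₀) :=
    horth.embedding (Fin.castLEEmb (show k - 1 ≤ n / m by omega))
  have hfam : (fun i : Fin (k - 1) => coeffAut (m * i) (1 - e₀)) =
      fun i : Fin (k - 1) => 1 - coeffAut (m * i) e₀ := by
    funext i
    rw [hE, hE, map_sub, map_one]
  rw [hfam]
  refine ⟨⟨_, isLCLM_one_sub_sum horth'⟩, fun g hg => ?_⟩
  have hkill : ∀ c ∈ Ideal.span {g}, ∀ b < k - 1, c * (T ^ (b : ℤ)) e₀ = 0 := by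
    intro c hc b hb
    rw [← hE]
    exact mul_eq_zero_of_mem_span horth'.idem hg hc ⟨b, hb⟩
  constructor
  · intro a ha b hb hab
    by_contra hlt
    apply hab
    rw [← sub_eq_zero]
    classical
    refine h.eq_zero_of_mul_eq_zero hT he (k - 1) 0 _
      (Finset.univ.filter fun i => coords (a - b) i ≠ 0) ?_ (fun i hi => by simpa using hi)
      fun z hz0 hz => ?_
    · have := h.hamming_eq a b
      omega
    · lift z to ℕ using hz0
      exact hkill _ (sub_mem ha hb) z (by omega)
  · intro r v hv
    obtain ⟨x, rfl, hx1, hx2, hx3, hx4, hx5, hx6⟩ := exists_enc_of_encodesInput hv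
    obtain ⟨t, ht, hsize⟩ := hcode F x
    refine ⟨_, t, ht, hsize, fun c hc hrc => IsVec.encodesAlg ?_⟩
    subst hx3 hx4
    exact decodeAux_spec (s := (x.1, x.2.2.1)) h hx1 hT hTN hm hN.symm hx2 (by omega) hx5 hx6 he
      (hkill c hc) hrc
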